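/- Let $\lambda$ be a regular cardinal. A factorization system $(\mathcal E,\mathcal M)$ on a category means an orthogonal one: $\mathcal E={}^{\perp}\mathcal M$, $\mathcal M=\mathcal E^{\perp}$ (unique diagonals), and every morphism factors as an $\mathcal E$-morphism followed by an $\mathcal M$-morphism. A $\lambda$-directed colimit of $\mathcal M$-morphisms is a colimit of a diagram indexed by a small $\lambda$-directed poset all of whose transition morphisms are in $\mathcal M$. An object $A$ of a category $\mathcal K$ is $\lambda$-generated w.r.t. $\mathcal M$ if $\mathcal K(A,-):\mathcal K\to\mathbf{Set}$ preserves $\lambda$-directed colimits of $\mathcal M$-morphisms. The system $(\mathcal E,\mathcal M)$ is $\lambda$-convenient if every object has, up to isomorphism, only a set of $\mathcal E$-quotients (i.e. $\mathcal E$-morphisms out of it) and, for every $\lambda$-directed colimit of $\mathcal M$-morphisms, the colimit cocone consists of $\mathcal M$-morphisms and every cocone of $\mathcal M$-morphisms induces an $\mathcal M$-morphism out of the colimit. A (locally small) category $\mathcal K$ with a factorization system $(\mathcal E,\mathcal M)$ is $\mathcal M$-locally $\lambda$-generated if it is cocomplete, $(\mathcal E,\mathcal M)$ is $\lambda$-convenient,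 and there is a set $\mathcal A$ of objects that are $\lambda$-generated w.r.t. $\mathcal M$ such that every object is a $\lambda$-directed colimit of objects from $\mathcal A$ and morphisms from $\mathcal M$. Let $\mathbf{LG}_\lambda$ be the 2-category of these categories with their factorization systems; its 1-cells $R:\mathcal K\to\mathcal L$ are the right adjoint functors preserving $\mathcal M$-morphisms and $\lambda$-directed colimits of $\mathcal M$-morphisms, and its 2-cells are the natural transformations. A $\lambda$-nest is a small category $\mathcal A$ with a factorization system $(\mathcal E_{\mathcal A},\mathcal M_{\mathcal A})$ that has $\lambda$-small limits and all small multiple pullbacks of $\mathcal M_{\mathcal A}$-morphisms (limits of diagrams consisting of a set-indexed family of $\mathcal M_{\mathcal A}$-morphisms with a common codomain). Let $\mathbf N_\lambda$ be the 2-category of $\lambda$-nests; its 1-cells are the functors preserving $\lambda$-small limits, $\mathcal M$-morphisms and multiple pullbacks of $\mathcal M$-morphisms, and its 2-cells are the natural transformations. For $\mathcal K$ in $\mathbf{LG}_\lambda$, let $\mathrm{Gen}_\lambda(\mathcal K)$ be the full subcategory of the objects that are $\lambda$-generated w.r.t. $\mathcal M$. Then $\mathrm{Gen}_\lambda(\mathcal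 K)$ is essentially small and $\mathrm{Gen}_\lambda(\mathcal K)^{\mathrm{op}}$ (replaced by an equivalent small category), whose left and right class are the opposites of the $\mathcal M$-morphisms and of the $\mathcal E$-morphisms of $\mathcal K$ respectively, is a $\lambda$-nest. For a 1-cell $R:\mathcal K\to\mathcal L$ of $\mathbf{LG}_\lambda$, the left adjoint of $R$ restricts to a functor $\mathrm{Gen}_\lambda(\mathcal L)\to\mathrm{Gen}_\lambda(\mathcal K)$ whose opposite is a morphism of $\lambda$-nests. For a $\lambda$-nest $\mathcal A$, let $\mathrm{Mod}_\lambda(\mathcal A)$ be the full subcategory of $\mathbf{Set}^{\mathcal A}$ of the functors preserving $\lambda$-small limits and multiple pullbacks of $\mathcal M_{\mathcal A}$-morphisms; let $\mathcal M$ be the class of the morphisms in it that are right orthogonal to the image of $\mathcal M_{\mathcal A}$ under the Yoneda embedding $\mathcal A^{\mathrm{op}}\to\mathrm{Mod}_\lambda(\mathcal A)$, and $\mathcal E={}^{\perp}\mathcal M$. Then $\mathrm{Mod}_\lambda(\mathcal A)$ is $\mathcal M$-locally $\lambda$-generated, and for every morphism $F:\mathcal A\to\mathcal B$ of $\lambda$-nests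 the functor $\mathrm{Mod}_\lambda(F):\mathrm{Mod}_\lambda(\mathcal B)\to\mathrm{Mod}_\lambda(\mathcal A)$, $H\mapsto H\circ F$, is a 1-cell of $\mathbf{LG}_\lambda$. With the evident action on 2-cells (passage to conjugate transformations of left adjoints, and whiskering, respectively), these constructions are pseudofunctors $$\mathrm{Gen}_\lambda:\mathbf{LG}_\lambda\to\mathbf N_\lambda^{\mathrm{op}},\qquad \mathrm{Mod}_\lambda:\mathbf N_\lambda^{\mathrm{op}}\to\mathbf{LG}_\lambda$$ (where $\mathrm{op}$ reverses 1-cells only), and they form a biequivalence: $\mathrm{Mod}_\lambda\circ\mathrm{Gen}_\lambda$ and $\mathrm{Gen}_\lambda\circ\mathrm{Mod}_\lambda$ are equivalent to the identity pseudofunctors in the bicategories of pseudofunctors, pseudonatural transformations and modifications. -/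

import Mathlib

open CategoryTheory CategoryTheory.Limits Opposite
open scoped CategoryTheory.Bicategory CategoryTheory.Pseudofunctor.StrongTrans

universe w v u v₁ u₁ v₂ u₂

noncomputable section

namespace ExtendedGabrielUlmer

/-! ### Orthogonality and factorization systems -/

section Factorization

variable {C : Type u} [Category.{v} C]

/-- `e` is (left) orthogonal to `m`: every commutative square `u ≫ m = e ≫ v` has a unique
diagonal. -/
def Orthogonal {A B X Y : C} (e : A ⟶ B) (m : X ⟶ Y) : Prop :=
  ∀ (u : A ⟶ X) (v : B ⟶ Y), u ≫ m = e ≫ v → ∃! d : B ⟶ X, e ≫ d = u ∧ d ≫ m = v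

/-- The class `W^⊥` of all morphisms with the unique right lifting property against `W`. -/
def rightOrth (W : MorphismProperty C) : MorphismProperty C :=
  fun _ _ m => ∀ ⦃A B : C⦄ (e : A ⟶ B), W e → Orthogonal e m

/-- The class `^⊥W` of all morphisms with the unique left lifting property against `W`. -/
def leftOrth (W : MorphismProperty C) : MorphismProperty C :=
  fun _ _ e => ∀ ⦃X Y : C⦄ (m : X ⟶ Y), W m → Orthogonal e m

/-- `(E, M)` is an (orthogonal) factorization system. -/
structure IsFactorizationSystem (E M : MorphismProperty C) : Prop where
  left_eq : E = leftOrth M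
  right_eq : M = rightOrth E
  exists_factorization : ∀ ⦃X Y : C⦄ (f : X ⟶ Y),
    ∃ (Z : C) (e : X ⟶ Z) (m : Z ⟶ Y), E e ∧ M m ∧ e ≫ m = f

end Factorization

/-! ### `M`-locally `κ`-generated categories -/

section LocallyGenerated

variable (κ : Cardinal.{w}) [Fact κ.IsRegular]
variable {C : Type u} [Category.{v} C] {D : Type u₁} [Category.{v₁} D]

/-- All the transition morphisms of the diagram `F` lie in `M`. -/
def IsDiagramIn (M : MorphismProperty C) {J : Type u₂} [Category.{v₂} J] (F : J ⥤ C) : Prop :=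
  ∀ ⦃i j : J⦄ (f : i ⟶ j), M (F.map f)

/-- The functor `G` preserves `κ`-directed colimits of `M`-morphisms, i.e. the colimits of the
diagrams of `M`-morphisms which are indexed by (small) `κ`-directed posets. -/
def PreservesDirectedColimitsOf (M : MorphismProperty C) (G : C ⥤ D) : Prop :=
  ∀ (J : Type w) [PartialOrder J] [IsCardinalFiltered J κ] (F : J ⥤ C),
    IsDiagramIn M F → PreservesColimit F G

/-- `A` is `κ`-generated with respect to `M`. -/
def IsGenerated (M : MorphismProperty C) : ObjectProperty C :=
  fun A => PreservesDirectedColimitsOf κ M (coyoneda.obj (op A))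

/-- The factorization system `(E, M)` is `κ`-convenient. -/
structure IsConvenient (E M : MorphismProperty C) : Prop where
  isFactorizationSystem : IsFactorizationSystem E M
  /-- Every object has, up to isomorphism, only a small set of `E`-quotients. -/
  cowellpowered : ∀ X : C,
    ObjectProperty.EssentiallySmall.{w} (fun q : Under X => E q.hom)
  /-- The colimit cocones of `κ`-directed diagrams of `M`-morphisms consist of `M`-morphisms. -/
  ι_mem : ∀ (J : Type w) [PartialOrder J] [IsCardinalFiltered J κ] (F : J ⥤ C),
    IsDiagramIn M F → ∀ (c : Cocone F), IsColimit c → ∀ j, M (c.ι.app j)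
  /-- The morphism out of such a colimit that is induced by a cocone of `M`-morphisms
  is in `M`. -/
  desc_mem : ∀ (J : Type w) [PartialOrder J] [IsCardinalFiltered J κ] (F : J ⥤ C),
    IsDiagramIn M F → ∀ (c : Cocone F) (hc : IsColimit c) (s : Cocone F),
      (∀ j, M (s.ι.app j)) → M (hc.desc s)

/-- The category `C` with the classes `E`, `M` is `M`-locally `κ`-generated: it is cocomplete,
`(E, M)` is a `κ`-convenient factorization system, and there is a set `S` of objects which are
`κ`-generated w.r.t. `M` such that every object is a `κ`-directed colimit of objects from `S`
and morphisms from `M`. -/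
structure IsLocallyGenerated (E M : MorphismProperty C) : Prop where
  cocomplete : HasColimitsOfSize.{w, w} C
  isConvenient : IsConvenient κ E M
  exists_generators : ∃ S : ObjectProperty C, ObjectProperty.Small.{w} S ∧
    S ≤ IsGenerated κ M ∧
    ∀ X : C, ∃ (J : Type w) (_ : PartialOrder J) (_ : IsCardinalFiltered J κ) (F : J ⥤ C)
      (c : Cocone F), IsDiagramIn M F ∧ (∀ j, S (F.obj j)) ∧ Nonempty (IsColimit c) ∧
        Nonempty (c.pt ≅ X)

/-- `R` is a morphism of locally `κ`-generated categories: a right adjoint which preserves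
`M`-morphisms and `κ`-directed colimits of `M`-morphisms. -/
structure IsLocGenMorphism (M : MorphismProperty C) (M' : MorphismProperty D) (R : C ⥤ D) :
    Prop where
  isRightAdjoint : R.IsRightAdjoint
  map_mem : ∀ ⦃X Y : C⦄ (f : X ⟶ Y), M f → M' (R.map f)
  preserves : PreservesDirectedColimitsOf κ M R

end LocallyGenerated

/-! ### `κ`-nests -/

section Nests

variable (κ : Cardinal.{w})
variable {A : Type u} [Category.{v} A] {B : Type u₁} [Category.{v₁} B]

/-- The diagram `F`, which consists of a family of morphisms with a common codomain, is a
diagram of `M`-morphisms. The limit of `F` is a multiple pullback of `M`-morphisms. -/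
def IsWideCospanIn (M : MorphismProperty A) {I : Type w} (F : WidePullbackShape I ⥤ A) : Prop :=
  ∀ i : I, M (F.map (WidePullbackShape.Hom.term i))

/-- The functor `G` preserves `κ`-small limits. -/
def PreservesSmallLimits (G : A ⥤ B) : Prop :=
  ∀ (J : Type w) [SmallCategory J], HasCardinalLT (Arrow J) κ → PreservesLimitsOfShape J G

/-- The functor `G` preserves (small) multiple pullbacks of `M`-morphisms. -/
def PreservesMultiplePullbacksOf (M : MorphismProperty A) (G : A ⥤ B) : Prop :=
  ∀ (I : Type w) (F : WidePullbackShape I ⥤ A), IsWideCospanIn M F → PreservesLimit F G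

/-- `A` with the classes `E`, `M` satisfies the axioms of a `κ`-nest (smallness of `A` is
required in the structure `Nest` below). -/
structure IsNest (E M : MorphismProperty A) : Prop where
  isFactorizationSystem : IsFactorizationSystem E M
  hasSmallLimits : ∀ (J : Type w) [SmallCategory J], HasCardinalLT (Arrow J) κ →
    HasLimitsOfShape J A
  hasMultiplePullbacks : ∀ (I : Type w) (F : WidePullbackShape I ⥤ A),
    IsWideCospanIn M F → HasLimit F

/-- `G` is a morphism of `κ`-nests. -/
structure IsNestMorphism (M : MorphismProperty A) (M' : MorphismProperty B) (G : A ⥤ B) :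
    Prop where
  map_mem : ∀ ⦃X Y : A⦄ (f : X ⟶ Y), M f → M' (G.map f)
  preservesSmallLimits : PreservesSmallLimits κ G
  preservesMultiplePullbacks : PreservesMultiplePullbacksOf.{w} M G

/-- `H` is a model of a `κ`-nest with right class `M`. -/
structure IsModel (M : MorphismProperty A) (H : A ⥤ Type w) : Prop where
  preservesSmallLimits : PreservesSmallLimits κ H
  preservesMultiplePullbacks : PreservesMultiplePullbacksOf.{w} M H

end Nests

/-! ### The 2-category of locally `κ`-generated categories -/

section LocGenCat

variable (κ : Cardinal.{w}) [Fact κ.IsRegular]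

/-- The 0-cells of `LG_κ`: `M`-locally `κ`-generated categories (locally small, possibly large),
equipped with their factorization systems. -/
structure LocGenCat : Type (w + 2) where
  carrier : Type (w + 1)
  [category : Category.{w} carrier]
  E : MorphismProperty carrier
  M : MorphismProperty carrier
  isLocallyGenerated : IsLocallyGenerated κ E M

variable {κ}

namespace LocGenCat

instance (K : LocGenCat κ) : Category.{w} K.carrier := K.category

/-- The 1-cells of `LG_κ`. -/
structure Hom (K L : LocGenCat κ) where
  functor : K.carrier ⥤ L.carrier
  isLocGenMorphism : IsLocGenMorphism κ K.M L.M functor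

lemma isLocGenMorphism_id (K : LocGenCat κ) : IsLocGenMorphism κ K.M K.M (𝟭 K.carrier) where
  isRightAdjoint := inferInstance
  map_mem _ _ _ h := h
  preserves _ _ _ _ _ := inferInstance

lemma isLocGenMorphism_comp {K L N : LocGenCat κ} (R : Hom K L) (S : Hom L N) :
    IsLocGenMorphism κ K.M N.M (R.functor ⋙ S.functor) where
  isRightAdjoint := by
    have := R.isLocGenMorphism.isRightAdjoint
    have := S.isLocGenMorphism.isRightAdjoint
    infer_instance
  map_mem _ _ f h := S.isLocGenMorphism.map_mem _ (R.isLocGenMorphism.map_mem f h)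
  preserves J _ _ F hF := by
    have := R.isLocGenMorphism.preserves J F hF
    have := S.isLocGenMorphism.preserves J (F ⋙ R.functor)
      (fun _ _ f => R.isLocGenMorphism.map_mem _ (hF f))
    infer_instance

@[simps id_functor comp_functor]
instance : CategoryStruct (LocGenCat κ) where
  Hom K L := Hom K L
  id K := ⟨𝟭 _, K.isLocGenMorphism_id⟩
  comp R S := ⟨R.functor ⋙ S.functor, isLocGenMorphism_comp R S⟩

/-- The 2-cells of `LG_κ`: all natural transformations. -/
@[ext]
structure Hom₂ {K L : LocGenCat κ} (R S : K ⟶ L) where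
  natTrans : R.functor ⟶ S.functor

@[simps id_natTrans comp_natTrans]
instance homCategory (K L : LocGenCat κ) : Category (K ⟶ L) where
  Hom R S := Hom₂ R S
  id R := ⟨𝟙 R.functor⟩
  comp α β := ⟨α.natTrans ≫ β.natTrans⟩

@[ext]
lemma hom₂_ext {K L : LocGenCat κ} {R S : K ⟶ L} {α β : R ⟶ S}
    (h : α.natTrans = β.natTrans) : α = β := Hom₂.ext h

/-- A natural isomorphism between the underlying functors is an invertible 2-cell. -/
@[simps]
def isoMk {K L : LocGenCat κ} {R S : K ⟶ L} (φ : R.functor ≅ S.functor) : R ≅ S where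
  hom := ⟨φ.hom⟩
  inv := ⟨φ.inv⟩

@[simps! whiskerLeft_natTrans whiskerRight_natTrans associator_hom_natTrans
  associator_inv_natTrans leftUnitor_hom_natTrans leftUnitor_inv_natTrans
  rightUnitor_hom_natTrans rightUnitor_inv_natTrans]
instance : Bicategory (LocGenCat κ) where
  homCategory := homCategory
  whiskerLeft R S S' α :=
    (⟨Functor.whiskerLeft R.functor α.natTrans⟩ : Hom₂ (R ≫ S) (R ≫ S'))
  whiskerRight {_ _ _ R R'} α S :=
    (⟨Functor.whiskerRight α.natTrans S.functor⟩ : Hom₂ (R ≫ S) (R' ≫ S))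
  associator R S T := isoMk (R := (R ≫ S) ≫ T) (S := R ≫ S ≫ T)
    (Functor.associator R.functor S.functor T.functor)
  leftUnitor {K _} R := isoMk (R := 𝟙 K ≫ R) (S := R) (Functor.leftUnitor R.functor)
  rightUnitor {_ L} R := isoMk (R := R ≫ 𝟙 L) (S := R) (Functor.rightUnitor R.functor)

end LocGenCat

end LocGenCat

/-! ### The 2-category of `κ`-nests -/

section Nest

variable (κ : Cardinal.{w})

/-- The 0-cells of `N_κ`: `κ`-nests. -/
structure Nest : Type (w + 1) where
  carrier : Type w
  [category : SmallCategory carrier]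
  E : MorphismProperty carrier
  M : MorphismProperty carrier
  isNest : IsNest κ E M

variable {κ}

namespace Nest

instance (A : Nest κ) : SmallCategory A.carrier := A.category

/-- The 1-cells of `N_κ`. -/
structure Hom (A B : Nest κ) where
  functor : A.carrier ⥤ B.carrier
  isNestMorphism : IsNestMorphism κ A.M B.M functor

lemma isNestMorphism_id (A : Nest κ) : IsNestMorphism κ A.M A.M (𝟭 A.carrier) where
  map_mem _ _ _ h := h
  preservesSmallLimits _ _ _ := inferInstance
  preservesMultiplePullbacks _ _ _ := inferInstance

lemma isNestMorphism_comp {A B C : Nest κ} (F : Hom A B) (G : Hom B C) :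
    IsNestMorphism κ A.M C.M (F.functor ⋙ G.functor) where
  map_mem _ _ f h := G.isNestMorphism.map_mem _ (F.isNestMorphism.map_mem f h)
  preservesSmallLimits J _ hJ := by
    have := F.isNestMorphism.preservesSmallLimits J hJ
    have := G.isNestMorphism.preservesSmallLimits J hJ
    infer_instance
  preservesMultiplePullbacks I D hD := by
    have := F.isNestMorphism.preservesMultiplePullbacks I D hD
    have := G.isNestMorphism.preservesMultiplePullbacks I (D ⋙ F.functor)
      (fun i => F.isNestMorphism.map_mem _ (hD i))
    infer_instance

@[simps id_functor comp_functor]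
instance : CategoryStruct (Nest κ) where
  Hom A B := Hom A B
  id A := ⟨𝟭 _, A.isNestMorphism_id⟩
  comp F G := ⟨F.functor ⋙ G.functor, isNestMorphism_comp F G⟩

/-- The 2-cells of `N_κ`: all natural transformations. -/
@[ext]
structure Hom₂ {A B : Nest κ} (F G : A ⟶ B) where
  natTrans : F.functor ⟶ G.functor

@[simps id_natTrans comp_natTrans]
instance homCategory (A B : Nest κ) : Category (A ⟶ B) where
  Hom F G := Hom₂ F G
  id F := ⟨𝟙 F.functor⟩
  comp α β := ⟨α.natTrans ≫ β.natTrans⟩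

@[ext]
lemma hom₂_ext {A B : Nest κ} {F G : A ⟶ B} {α β : F ⟶ G}
    (h : α.natTrans = β.natTrans) : α = β := Hom₂.ext h

/-- A natural isomorphism between the underlying functors is an invertible 2-cell. -/
@[simps]
def isoMk {A B : Nest κ} {F G : A ⟶ B} (φ : F.functor ≅ G.functor) : F ≅ G where
  hom := ⟨φ.hom⟩
  inv := ⟨φ.inv⟩

@[simps! whiskerLeft_natTrans whiskerRight_natTrans associator_hom_natTrans
  associator_inv_natTrans leftUnitor_hom_natTrans leftUnitor_inv_natTrans
  rightUnitor_hom_natTrans rightUnitor_inv_natTrans]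
instance : Bicategory (Nest κ) where
  homCategory := homCategory
  whiskerLeft F G G' α :=
    (⟨Functor.whiskerLeft F.functor α.natTrans⟩ : Hom₂ (F ≫ G) (F ≫ G'))
  whiskerRight {_ _ _ F F'} α G :=
    (⟨Functor.whiskerRight α.natTrans G.functor⟩ : Hom₂ (F ≫ G) (F' ≫ G))
  associator F G H := isoMk (F := (F ≫ G) ≫ H) (G := F ≫ G ≫ H)
    (Functor.associator F.functor G.functor H.functor)
  leftUnitor {A _} F := isoMk (F := 𝟙 A ≫ F) (G := F) (Functor.leftUnitor F.functor)
  rightUnitor {_ B} F := isoMk (F := F ≫ 𝟙 B) (G := F) (Functor.rightUnitor F.functor)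

lemma op_hom₂_ext {A B : (Nest κ)ᵒᵖ} {F G : A ⟶ B} {α β : F ⟶ G}
    (H : α.unop2.natTrans = β.unop2.natTrans) : α = β :=
  congrArg (Bicategory.Opposite.Hom2.op2' (f := F) (g := G)) (Nest.hom₂_ext H)

end Nest

end Nest

/-! ### The pseudofunctor `Mod_κ` -/

section Models

variable {κ : Cardinal.{w}}

namespace Nest

/-- The category `Mod_κ(A)` of models of the `κ`-nest `A`: the full subcategory of the functor
category `Set^A` on the models. -/
abbrev Mod (A : Nest κ) : Type (w + 1) :=
  ObjectProperty.FullSubcategory (fun H : A.carrier ⥤ Type w => IsModel κ A.M H)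

/-- The Yoneda embedding of `Aᵒᵖ` into `Mod_κ(A)`; representable functors are models since they
preserve all limits. -/
def modYoneda (A : Nest κ) : A.carrierᵒᵖ ⥤ A.Mod :=
  ObjectProperty.lift _ coyoneda
    (fun _ => ⟨fun _ _ _ => inferInstance, fun _ _ _ => inferInstance⟩)

/-- The right class of the factorization system of `Mod_κ(A)`: the morphisms which are orthogonal
to the image of the `M`-morphisms of `A` under the Yoneda embedding. -/
def modM (A : Nest κ) : MorphismProperty A.Mod :=
  fun _ _ f => ∀ ⦃X Y : A.carrier⦄ (m : X ⟶ Y), A.M m → Orthogonal (A.modYoneda.map m.op) f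

/-- The left class of the factorization system of `Mod_κ(A)`. -/
def modE (A : Nest κ) : MorphismProperty A.Mod := leftOrth A.modM

lemma isModel_precomp {A B : Nest κ} (F : A ⟶ B) (H : B.Mod) :
    IsModel κ A.M (F.functor ⋙ H.obj) where
  preservesSmallLimits J _ hJ := by
    have := F.isNestMorphism.preservesSmallLimits J hJ
    have := H.property.preservesSmallLimits J hJ
    infer_instance
  preservesMultiplePullbacks I D hD := by
    have := F.isNestMorphism.preservesMultiplePullbacks I D hD
    have := H.property.preservesMultiplePullbacks I (D ⋙ F.functor)
      (fun i => F.isNestMorphism.map_mem _ (hD i))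
    infer_instance

/-- The functor `Mod_κ(F) : Mod_κ(B) ⥤ Mod_κ(A)`, `H ↦ H ∘ F`, for a morphism of nests
`F : A ⟶ B`. -/
@[simps]
def modMap {A B : Nest κ} (F : A ⟶ B) : B.Mod ⥤ A.Mod where
  obj H := ⟨F.functor ⋙ H.obj, isModel_precomp F H⟩
  map f := ObjectProperty.homMk (Functor.whiskerLeft F.functor f.hom)

/-- The natural transformation `Mod_κ(F) ⟶ Mod_κ(G)` induced by `α : F ⟶ G`. -/
@[simps]
def modMap₂ {A B : Nest κ} {F G : A ⟶ B} (α : F ⟶ G) : modMap F ⟶ modMap G where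
  app H := ObjectProperty.homMk (Functor.whiskerRight α.natTrans H.obj)
  naturality _ _ f := by
    apply ObjectProperty.hom_ext
    ext X : 2
    exact (f.hom.naturality (α.natTrans.app X)).symm

/-- The canonical isomorphism `H ∘ id ≅ H`, natural in `H`. -/
def modMapId (A : Nest κ) : modMap (𝟙 A) ≅ 𝟭 A.Mod :=
  NatIso.ofComponents (fun H => ObjectProperty.isoMk _ (Functor.leftUnitor H.obj))

/-- The canonical isomorphism `H ∘ (G ∘ F) ≅ (H ∘ G) ∘ F`, natural in `H`. -/
def modMapComp {A B C : Nest κ} (F : A ⟶ B) (G : B ⟶ C) :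
    modMap (F ≫ G) ≅ modMap G ⋙ modMap F :=
  NatIso.ofComponents
    (fun H => ObjectProperty.isoMk _ (Functor.associator F.functor G.functor H.obj))

lemma modMap_hom_ext {A B : Nest κ} {S T : B.Mod ⥤ A.Mod} {α β : S ⟶ T}
    (h : ∀ H X, (α.app H).hom.app X = (β.app H).hom.app X) : α = β := by
  ext H : 2
  apply ObjectProperty.hom_ext
  ext X : 2
  exact h H X

end Nest

variable [Fact κ.IsRegular]

variable (κ) in
/-- The constructions `A ↦ Mod_κ(A)` and `F ↦ Mod_κ(F)` take their values in locally
`κ`-generated categories and their morphisms. -/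
structure ModWellDefined : Prop where
  isLocallyGenerated : ∀ A : Nest κ, IsLocallyGenerated κ A.modE A.modM
  isLocGenMorphism : ∀ {A B : Nest κ} (F : A ⟶ B),
    IsLocGenMorphism κ B.modM A.modM (Nest.modMap F)

namespace ModWellDefined

variable (h : ModWellDefined κ)

/-- `Mod_κ(A)` as an object of `LG_κ`. -/
@[simps carrier E M]
def obj (A : Nest κ) : LocGenCat κ where
  carrier := A.Mod
  E := A.modE
  M := A.modM
  isLocallyGenerated := h.isLocallyGenerated A

/-- `Mod_κ(F)` as a morphism of `LG_κ`. -/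
@[simps functor]
def map {A B : Nest κ} (F : A ⟶ B) : LocGenCat.Hom (h.obj B) (h.obj A) where
  functor := Nest.modMap F
  isLocGenMorphism := h.isLocGenMorphism F

/-- The pseudofunctor `Mod_κ`. -/
def pseudofunctor : (Nest κ)ᵒᵖ ⥤ᵖ LocGenCat κ where
  obj A := h.obj A.unop
  map F := h.map F.unop
  map₂ {_ _ F G} α := (⟨Nest.modMap₂ α.unop2⟩ : LocGenCat.Hom₂ (h.map F.unop) (h.map G.unop))
  mapId A := LocGenCat.isoMk (R := h.map (𝟙 A.unop)) (S := 𝟙 (h.obj A.unop))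
    (Nest.modMapId A.unop)
  mapComp F G := LocGenCat.isoMk (R := h.map (G.unop ≫ F.unop))
    (S := (h.map F.unop : h.obj _ ⟶ h.obj _) ≫ h.map G.unop)
    (Nest.modMapComp G.unop F.unop)
  map₂_id F := LocGenCat.hom₂_ext (Nest.modMap_hom_ext fun H X => by
    exact H.obj.map_id _)
  map₂_comp α β := LocGenCat.hom₂_ext (Nest.modMap_hom_ext fun H X => by
    exact H.obj.map_comp _ _)
  map₂_whisker_left F G G' α := LocGenCat.hom₂_ext (Nest.modMap_hom_ext fun H X => by
    exact ((Category.id_comp _).trans (Category.comp_id _)).symm)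
  map₂_whisker_right α G := LocGenCat.hom₂_ext (Nest.modMap_hom_ext fun H X => by
    exact ((Category.id_comp _).trans (Category.comp_id _)).symm)
  map₂_associator F G K := LocGenCat.hom₂_ext (Nest.modMap_hom_ext fun H X => by
    exact (H.obj.map_id _).trans rfl)
  map₂_left_unitor F := LocGenCat.hom₂_ext (Nest.modMap_hom_ext fun H X => by
    exact (H.obj.map_id _).trans rfl)
  map₂_right_unitor F := LocGenCat.hom₂_ext (Nest.modMap_hom_ext fun H X => by
    exact (H.obj.map_id _).trans rfl)

end ModWellDefined

end Models

/-! ### The pseudofunctor `Gen_κ` -/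

section Generated

variable {κ : Cardinal.{w}} [Fact κ.IsRegular]

namespace LocGenCat

/-- The category `Gen_κ(K)`: the full subcategory of `K` on the objects which are `κ`-generated
w.r.t. `M`. -/
abbrev Gen (K : LocGenCat κ) : Type (w + 1) := (IsGenerated κ K.M).FullSubcategory

/-- The (chosen) left adjoint of a morphism of locally `κ`-generated categories. -/
def Hom.left {K L : LocGenCat κ} (R : K ⟶ L) : L.carrier ⥤ K.carrier :=
  haveI := R.isLocGenMorphism.isRightAdjoint
  R.functor.leftAdjoint

/-- The adjunction between a morphism of locally `κ`-generated categories and its left adjoint. -/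
def Hom.adj {K L : LocGenCat κ} (R : K ⟶ L) : Hom.left R ⊣ R.functor :=
  haveI := R.isLocGenMorphism.isRightAdjoint
  Adjunction.ofIsRightAdjoint R.functor

/-- The transformation of left adjoints which is conjugate to a 2-cell. -/
def conj {K L : LocGenCat κ} {R S : K ⟶ L} (α : R ⟶ S) : Hom.left S ⟶ Hom.left R :=
  (conjugateEquiv (Hom.adj R) (Hom.adj S)).symm α.natTrans

/-- The left adjoint of the identity is isomorphic to the identity. -/
def leftId (K : LocGenCat κ) : Hom.left (𝟙 K) ≅ 𝟭 K.carrier :=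
  Adjunction.leftAdjointIdIso (Hom.adj (𝟙 K)) (Iso.refl (𝟭 K.carrier))

/-- The left adjoint of a composition is isomorphic to the composition of the left adjoints. -/
def leftComp {K L N : LocGenCat κ} (R : K ⟶ L) (S : L ⟶ N) :
    Hom.left S ⋙ Hom.left R ≅ Hom.left (R ≫ S) :=
  Adjunction.leftAdjointCompIso (Hom.adj S) (Hom.adj R) (Hom.adj (R ≫ S))
    (Iso.refl (R.functor ⋙ S.functor))

section

variable [∀ K : LocGenCat κ, EssentiallySmall.{w} K.Gen]

/-- A small category equivalent to `Gen_κ(K)`. -/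
abbrev SmallGen (K : LocGenCat κ) : Type w := SmallModel.{w} K.Gen

/-- The fully faithful functor from (the small model of) `Gen_κ(K)` to `K`. -/
def incl (K : LocGenCat κ) : K.SmallGen ⥤ K.carrier :=
  (equivSmallModel.{w} K.Gen).inverse ⋙ (IsGenerated κ K.M).ι

/-- `incl` is fully faithful. -/
def inclFullyFaithful (K : LocGenCat κ) : K.incl.FullyFaithful :=
  (equivSmallModel.{w} K.Gen).fullyFaithfulInverse.comp (IsGenerated κ K.M).fullyFaithfulι

/-- The left class of the nest `Gen_κ(K)ᵒᵖ`: the opposites of the `M`-morphisms of `K`. -/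
def genE (K : LocGenCat κ) : MorphismProperty K.SmallGenᵒᵖ :=
  (K.M.inverseImage K.incl).op

/-- The right class of the nest `Gen_κ(K)ᵒᵖ`: the opposites of the `E`-morphisms of `K`. -/
def genM (K : LocGenCat κ) : MorphismProperty K.SmallGenᵒᵖ :=
  (K.E.inverseImage K.incl).op

/-- The left adjoint of `R` preserves `κ`-generated objects. -/
def Hom.PreservesGen {K L : LocGenCat κ} (R : K ⟶ L) : Prop :=
  ∀ X : L.carrier, IsGenerated κ L.M X → IsGenerated κ K.M ((Hom.left R).obj X)

/-- The restriction `Gen_κ(L) ⥤ Gen_κ(K)` of the left adjoint of `R : K ⟶ L`, transported to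
the small models. -/
def genMap {K L : LocGenCat κ} (R : K ⟶ L) (hR : Hom.PreservesGen R) :
    L.SmallGen ⥤ K.SmallGen :=
  (equivSmallModel.{w} L.Gen).inverse ⋙
    ObjectProperty.lift _ ((IsGenerated κ L.M).ι ⋙ Hom.left R) (fun X => hR _ X.property) ⋙
    (equivSmallModel.{w} K.Gen).functor

/-- `genMap R` is, up to isomorphism, the restriction of the left adjoint of `R`. -/
def genMapIncl {K L : LocGenCat κ} (R : K ⟶ L) (hR : Hom.PreservesGen R) :
    genMap R hR ⋙ K.incl ≅ L.incl ⋙ Hom.left R :=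
  Functor.isoWhiskerRight
    (Functor.isoWhiskerLeft
      ((equivSmallModel.{w} L.Gen).inverse ⋙
        ObjectProperty.lift _ ((IsGenerated κ L.M).ι ⋙ Hom.left R) (fun X => hR _ X.property))
      (equivSmallModel.{w} K.Gen).unitIso.symm)
    (IsGenerated κ K.M).ι

variable {K L N P : LocGenCat κ}

/-- The restriction to the `κ`-generated objects of the transformation of left adjoints which is
conjugate to a 2-cell `α : R ⟶ S`. -/
def genMap₂ {R S : K ⟶ L} (hR : Hom.PreservesGen R) (hS : Hom.PreservesGen S) (α : R ⟶ S) :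
    genMap S hS ⟶ genMap R hR :=
  (K.inclFullyFaithful.whiskeringRight _).preimage
    ((genMapIncl S hS).hom ≫ Functor.whiskerLeft L.incl (conj α) ≫ (genMapIncl R hR).inv)

/-- `Gen_κ` preserves identities up to isomorphism. -/
def genMapId (h : Hom.PreservesGen (𝟙 K)) : genMap (𝟙 K) h ≅ 𝟭 K.SmallGen :=
  (K.inclFullyFaithful.whiskeringRight _).preimageIso
    (genMapIncl (𝟙 K) h ≪≫ Functor.isoWhiskerLeft K.incl K.leftId ≪≫
      Functor.rightUnitor _ ≪≫ (Functor.leftUnitor _).symm)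

/-- `Gen_κ` preserves compositions up to isomorphism. -/
def genMapComp (R : K ⟶ L) (S : L ⟶ N) (hR : Hom.PreservesGen R) (hS : Hom.PreservesGen S)
    (hRS : Hom.PreservesGen (R ≫ S)) :
    genMap S hS ⋙ genMap R hR ≅ genMap (R ≫ S) hRS :=
  (K.inclFullyFaithful.whiskeringRight _).preimageIso
    (Functor.associator _ _ _ ≪≫ Functor.isoWhiskerLeft _ (genMapIncl R hR) ≪≫
      (Functor.associator _ _ _).symm ≪≫
      Functor.isoWhiskerRight (genMapIncl S hS) (Hom.left R) ≪≫ Functor.associator _ _ _ ≪≫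
      Functor.isoWhiskerLeft _ (leftComp R S) ≪≫ (genMapIncl (R ≫ S) hRS).symm)

@[simp]
lemma incl_map_genMap₂ {R S : K ⟶ L} (hR : Hom.PreservesGen R) (hS : Hom.PreservesGen S)
    (α : R ⟶ S) (X : L.SmallGen) :
    K.incl.map ((genMap₂ hR hS α).app X) =
      (genMapIncl S hS).hom.app X ≫ (conj α).app (L.incl.obj X) ≫
        (genMapIncl R hR).inv.app X := by
  simp [genMap₂]

@[simp]
lemma incl_map_genMapId_hom (h : Hom.PreservesGen (𝟙 K)) (X : K.SmallGen) :
    K.incl.map ((genMapId h).hom.app X) =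
      (genMapIncl (𝟙 K) h).hom.app X ≫ K.leftId.hom.app (K.incl.obj X) := by
  simp [genMapId]

@[simp]
lemma incl_map_genMapId_inv (h : Hom.PreservesGen (𝟙 K)) (X : K.SmallGen) :
    K.incl.map ((genMapId h).inv.app X) =
      K.leftId.inv.app (K.incl.obj X) ≫ (genMapIncl (𝟙 K) h).inv.app X := by
  simp [genMapId]

@[simp]
lemma incl_map_genMapComp_hom (R : K ⟶ L) (S : L ⟶ N) (hR : Hom.PreservesGen R)
    (hS : Hom.PreservesGen S) (hRS : Hom.PreservesGen (R ≫ S)) (X : N.SmallGen) :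
    K.incl.map ((genMapComp R S hR hS hRS).hom.app X) =
      (genMapIncl R hR).hom.app ((genMap S hS).obj X) ≫
        (Hom.left R).map ((genMapIncl S hS).hom.app X) ≫
          (leftComp R S).hom.app (N.incl.obj X) ≫ (genMapIncl (R ≫ S) hRS).inv.app X := by
  simp [genMapComp]

@[simp]
lemma incl_map_genMapComp_inv (R : K ⟶ L) (S : L ⟶ N) (hR : Hom.PreservesGen R)
    (hS : Hom.PreservesGen S) (hRS : Hom.PreservesGen (R ≫ S)) (X : N.SmallGen) :
    K.incl.map ((genMapComp R S hR hS hRS).inv.app X) =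
      (genMapIncl (R ≫ S) hRS).hom.app X ≫ (leftComp R S).inv.app (N.incl.obj X) ≫
        (Hom.left R).map ((genMapIncl S hS).inv.app X) ≫
          (genMapIncl R hR).inv.app ((genMap S hS).obj X) := by
  simp [genMapComp]

end

lemma conj_id {K L : LocGenCat κ} (R : K ⟶ L) : conj (𝟙 R) = 𝟙 (Hom.left R) :=
  conjugateEquiv_symm_id _

lemma conj_comp {K L : LocGenCat κ} {R S T : K ⟶ L} (α : R ⟶ S) (β : S ⟶ T) :
    conj (α ≫ β) = conj β ≫ conj α :=
  (conjugateEquiv_symm_comp _ _ _ _ _).symm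

lemma leftComp_conj_whiskerLeft {K L N : LocGenCat κ} (R : K ⟶ L) {S S' : L ⟶ N}
    (α : S ⟶ S') :
    (leftComp R S').hom ≫ conj (R ◁ α) =
      Functor.whiskerRight (conj α) (Hom.left R) ≫ (leftComp R S).hom := by
  obtain ⟨τ, hτ⟩ := (conjugateEquiv (Hom.adj S) (Hom.adj S')).surjective α.natTrans
  have h : conj α = τ := by simp [conj, ← hτ]
  apply (conjugateEquiv (Hom.adj (R ≫ S)) ((Hom.adj S').comp (Hom.adj R))).injective
  rw [← conjugateEquiv_comp _ (Hom.adj (R ≫ S')),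
    ← conjugateEquiv_comp _ ((Hom.adj S).comp (Hom.adj R)), h,
    conjugateEquiv_whiskerRight, hτ]
  simp only [conj, Equiv.apply_symm_apply, leftComp, Adjunction.leftAdjointCompIso_hom,
    Adjunction.leftAdjointCompNatTrans]
  exact (Category.comp_id _).trans (Category.id_comp _).symm

lemma leftComp_conj_whiskerRight {K L N : LocGenCat κ} {R R' : K ⟶ L} (α : R ⟶ R')
    (S : L ⟶ N) :
    (leftComp R' S).hom ≫ conj (α ▷ S) =
      Functor.whiskerLeft (Hom.left S) (conj α) ≫ (leftComp R S).hom := by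
  obtain ⟨τ, hτ⟩ := (conjugateEquiv (Hom.adj R) (Hom.adj R')).surjective α.natTrans
  have h : conj α = τ := by simp [conj, ← hτ]
  apply (conjugateEquiv (Hom.adj (R ≫ S)) ((Hom.adj S).comp (Hom.adj R'))).injective
  rw [← conjugateEquiv_comp _ (Hom.adj (R' ≫ S)),
    ← conjugateEquiv_comp _ ((Hom.adj S).comp (Hom.adj R)), h,
    conjugateEquiv_whiskerLeft, hτ]
  simp only [conj, Equiv.apply_symm_apply, leftComp, Adjunction.leftAdjointCompIso_hom,
    Adjunction.leftAdjointCompNatTrans]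
  exact (Category.comp_id _).trans (Category.id_comp _).symm

lemma leftComp_assoc {K L N P : LocGenCat κ} (R : K ⟶ L) (S : L ⟶ N) (T : N ⟶ P)
    (X : P.carrier) :
    (leftComp R S).hom.app ((Hom.left T).obj X) ≫ (leftComp (R ≫ S) T).hom.app X =
      (Hom.left R).map ((leftComp S T).hom.app X) ≫ (leftComp R (S ≫ T)).hom.app X ≫
        (conj (α_ R S T).hom).app X := by
  have h := Adjunction.leftAdjointCompIso_assoc (Hom.adj T) (Hom.adj S) (Hom.adj R)
    (Hom.adj (S ≫ T)) (Hom.adj (R ≫ S)) (Hom.adj (R ≫ S ≫ T))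
    (Iso.refl _) (Iso.refl _) (Iso.refl _) (Iso.refl _) (by ext; simp)
  have h' := congr_app (congrArg Iso.hom h) X
  have h'' : conj (α_ R S T).hom = 𝟙 (Hom.left (R ≫ S ≫ T)) :=
    conjugateEquiv_symm_id (Hom.adj (R ≫ S ≫ T))
  rw [h'']
  refine Eq.trans ?_ (h'.trans ?_)
  · rfl
  · exact (Category.id_comp _).trans (congrArg _ (Category.comp_id _).symm)

lemma leftComp_id_left {K L : LocGenCat κ} (R : K ⟶ L) (X : L.carrier) :
    K.leftId.hom.app ((Hom.left R).obj X) ≫ (conj (λ_ R).hom).app X =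
      (leftComp (𝟙 K) R).hom.app X := by
  have h := Adjunction.leftAdjointCompIso_comp_id (Hom.adj R) (Hom.adj (𝟙 K))
    (Iso.refl _) (Iso.refl _) (by ext; simp)
  have h' := congr_app (congrArg Iso.hom h) X
  have h'' : conj (λ_ R).hom = 𝟙 (Hom.left R) := conjugateEquiv_symm_id (Hom.adj R)
  rw [h'']
  exact h'.symm

lemma leftComp_id_right {K L : LocGenCat κ} (R : K ⟶ L) (X : L.carrier) :
    (Hom.left R).map (L.leftId.hom.app X) ≫ (conj (ρ_ R).hom).app X =
      (leftComp R (𝟙 L)).hom.app X := by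
  have h := Adjunction.leftAdjointCompIso_id_comp (Hom.adj (𝟙 L)) (Hom.adj R)
    (Iso.refl _) (Iso.refl _) (by ext; simp)
  have h' := congr_app (congrArg Iso.hom h) X
  have h'' : conj (ρ_ R).hom = 𝟙 (Hom.left R) := conjugateEquiv_symm_id (Hom.adj R)
  rw [h'']
  exact h'.symm

section

variable [∀ K : LocGenCat κ, EssentiallySmall.{w} K.Gen] {K L N P : LocGenCat κ}

lemma gen_hom_ext {F G : L.SmallGen ⥤ K.SmallGen} {σ τ : F ⟶ G}
    (h : ∀ X, K.incl.map (σ.app X) = K.incl.map (τ.app X)) : σ = τ := by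
  ext X
  exact K.inclFullyFaithful.map_injective (h X)

lemma genMap₂_id (R : K ⟶ L) (hR : Hom.PreservesGen R) :
    genMap₂ hR hR (𝟙 R) = 𝟙 _ :=
  gen_hom_ext fun X => by simp [conj_id]

lemma genMap₂_comp {R S T : K ⟶ L} (hR : Hom.PreservesGen R) (hS : Hom.PreservesGen S)
    (hT : Hom.PreservesGen T) (α : R ⟶ S) (β : S ⟶ T) :
    genMap₂ hR hT (α ≫ β) = genMap₂ hS hT β ≫ genMap₂ hR hS α :=
  gen_hom_ext fun X => by simp [conj_comp]

lemma genMapIncl_naturality (R : K ⟶ L) (hR : Hom.PreservesGen R) {X Y : L.SmallGen}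
    (f : X ⟶ Y) :
    K.incl.map ((genMap R hR).map f) ≫ (genMapIncl R hR).hom.app Y =
      (genMapIncl R hR).hom.app X ≫ (Hom.left R).map (L.incl.map f) :=
  (genMapIncl R hR).hom.naturality f

lemma genMapIncl_naturality_assoc (R : K ⟶ L) (hR : Hom.PreservesGen R) {X Y : L.SmallGen}
    (f : X ⟶ Y) {Z : K.carrier} (g : (Hom.left R).obj (L.incl.obj Y) ⟶ Z) :
    K.incl.map ((genMap R hR).map f) ≫ (genMapIncl R hR).hom.app Y ≫ g =
      (genMapIncl R hR).hom.app X ≫ (Hom.left R).map (L.incl.map f) ≫ g := by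
  rw [← Category.assoc, genMapIncl_naturality, Category.assoc]

lemma genMap₂_whiskerLeft (R : K ⟶ L) {S S' : L ⟶ N} (hR : Hom.PreservesGen R)
    (hS : Hom.PreservesGen S) (hS' : Hom.PreservesGen S')
    (hRS : Hom.PreservesGen (R ≫ S)) (hRS' : Hom.PreservesGen (R ≫ S')) (α : S ⟶ S') :
    genMap₂ hRS hRS' (R ◁ α) =
      (genMapComp R S' hR hS' hRS').inv ≫
        Functor.whiskerRight (genMap₂ hS hS' α) (genMap R hR) ≫
          (genMapComp R S hR hS hRS).hom :=
  (Iso.eq_inv_comp _).2 <| gen_hom_ext fun X => by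
    have h1 := congr_app (leftComp_conj_whiskerLeft R α) (N.incl.obj X)
    dsimp at h1
    simp [genMapIncl_naturality_assoc, reassoc_of% h1]

lemma genMap₂_whiskerRight {R R' : K ⟶ L} (S : L ⟶ N) (hR : Hom.PreservesGen R)
    (hR' : Hom.PreservesGen R') (hS : Hom.PreservesGen S)
    (hRS : Hom.PreservesGen (R ≫ S)) (hRS' : Hom.PreservesGen (R' ≫ S)) (α : R ⟶ R') :
    genMap₂ hRS hRS' (α ▷ S) =
      (genMapComp R' S hR' hS hRS').inv ≫
        Functor.whiskerLeft (genMap S hS) (genMap₂ hR hR' α) ≫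
          (genMapComp R S hR hS hRS).hom :=
  (Iso.eq_inv_comp _).2 <| gen_hom_ext fun X => by
    have h1 := congr_app (leftComp_conj_whiskerRight α S) (N.incl.obj X)
    dsimp at h1
    simp [reassoc_of% h1]

lemma genMap₂_associator (R : K ⟶ L) (S : L ⟶ N) (T : N ⟶ P) (hR : Hom.PreservesGen R)
    (hS : Hom.PreservesGen S) (hT : Hom.PreservesGen T)
    (hRS : Hom.PreservesGen (R ≫ S)) (hST : Hom.PreservesGen (S ≫ T))
    (h : Hom.PreservesGen ((R ≫ S) ≫ T)) (h' : Hom.PreservesGen (R ≫ S ≫ T)) :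
    genMap₂ h h' (α_ R S T).hom =
      (genMapComp R (S ≫ T) hR hST h').inv ≫
        Functor.whiskerRight (genMapComp S T hS hT hST).inv (genMap R hR) ≫
          (Functor.associator _ _ _).hom ≫
            Functor.whiskerLeft (genMap T hT) (genMapComp R S hR hS hRS).hom ≫
              (genMapComp (R ≫ S) T hRS hT h).hom := by
  rw [Iso.eq_inv_comp]
  have h2 : Functor.whiskerRight (genMapComp S T hS hT hST).inv (genMap R hR) =
    (Functor.isoWhiskerRight (genMapComp S T hS hT hST) (genMap R hR)).inv := rfl
  rw [h2, Iso.eq_inv_comp]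
  refine gen_hom_ext fun X => ?_
  have h1 := leftComp_assoc R S T (P.incl.obj X)
  have h3 := (leftComp R S).hom.naturality ((genMapIncl T hT).hom.app X)
  dsimp at h3
  simp [genMapIncl_naturality_assoc, ← reassoc_of% h1, reassoc_of% h3]

lemma genMap₂_leftUnitor (R : K ⟶ L) (hR : Hom.PreservesGen R)
    (h1 : Hom.PreservesGen (𝟙 K)) (h : Hom.PreservesGen (𝟙 K ≫ R)) :
    genMap₂ h hR (λ_ R).hom =
      (Functor.rightUnitor _).inv ≫ Functor.whiskerLeft (genMap R hR) (genMapId h1).inv ≫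
        (genMapComp (𝟙 K) R h1 hR h).hom := by
  have h2 : Functor.whiskerLeft (genMap R hR) (genMapId h1).inv =
    (Functor.isoWhiskerLeft (genMap R hR) (genMapId h1)).inv := rfl
  rw [Iso.eq_inv_comp, h2, Iso.eq_inv_comp]
  refine gen_hom_ext fun X => ?_
  have h1 := leftComp_id_left R (L.incl.obj X)
  simp [← reassoc_of% h1]

lemma genMap₂_rightUnitor (R : K ⟶ L) (hR : Hom.PreservesGen R)
    (h1 : Hom.PreservesGen (𝟙 L)) (h : Hom.PreservesGen (R ≫ 𝟙 L)) :
    genMap₂ h hR (ρ_ R).hom =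
      (Functor.leftUnitor _).inv ≫ Functor.whiskerRight (genMapId h1).inv (genMap R hR) ≫
        (genMapComp R (𝟙 L) hR h1 h).hom := by
  have h2 : Functor.whiskerRight (genMapId h1).inv (genMap R hR) =
    (Functor.isoWhiskerRight (genMapId h1) (genMap R hR)).inv := rfl
  rw [Iso.eq_inv_comp, h2, Iso.eq_inv_comp]
  refine gen_hom_ext fun X => ?_
  have h1 := leftComp_id_right R (L.incl.obj X)
  simp [genMapIncl_naturality_assoc, ← reassoc_of% h1, -NatTrans.naturality,
    -NatTrans.naturality_assoc]

end

end LocGenCat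

variable (κ) in
/-- The constructions `K ↦ Gen_κ(K)ᵒᵖ` and `R ↦` (restriction of the left adjoint of `R`) take
their values in `κ`-nests and morphisms of `κ`-nests. -/
structure GenWellDefined : Prop where
  essentiallySmall : ∀ K : LocGenCat κ, EssentiallySmall.{w} K.Gen
  isNest : ∀ K : LocGenCat κ, IsNest κ K.genE K.genM
  preservesGen : ∀ {K L : LocGenCat κ} (R : K ⟶ L), LocGenCat.Hom.PreservesGen R
  isNestMorphism : ∀ {K L : LocGenCat κ} (R : K ⟶ L),
    IsNestMorphism κ L.genM K.genM (LocGenCat.genMap R (preservesGen R)).op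

namespace GenWellDefined

variable (h : GenWellDefined κ)

/-- `Gen_κ(K)ᵒᵖ` as an object of `N_κ`. -/
def obj (K : LocGenCat κ) : Nest κ :=
  haveI := h.essentiallySmall
  { carrier := K.SmallGenᵒᵖ
    E := K.genE
    M := K.genM
    isNest := h.isNest K }

/-- The morphism of nests `Gen_κ(L)ᵒᵖ ⟶ Gen_κ(K)ᵒᵖ` induced by `R : K ⟶ L`. -/
def map {K L : LocGenCat κ} (R : K ⟶ L) : h.obj L ⟶ h.obj K :=
  haveI := h.essentiallySmall
  { functor := (LocGenCat.genMap R (h.preservesGen R)).op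
    isNestMorphism := h.isNestMorphism R }

/-- The 2-cell induced by a 2-cell `α : R ⟶ S`. -/
def map₂ {K L : LocGenCat κ} {R S : K ⟶ L} (α : R ⟶ S) : h.map R ⟶ h.map S :=
  haveI := h.essentiallySmall
  (⟨NatTrans.op (LocGenCat.genMap₂ (h.preservesGen R) (h.preservesGen S) α)⟩ :
    Nest.Hom₂ (h.map R) (h.map S))

/-- Compatibility with identities. -/
def mapId (K : LocGenCat κ) : h.map (𝟙 K) ≅ 𝟙 (h.obj K) :=
  haveI := h.essentiallySmall
  Nest.isoMk (F := h.map (𝟙 K)) (G := 𝟙 (h.obj K))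
    (NatIso.op (LocGenCat.genMapId (h.preservesGen (𝟙 K))).symm)

/-- Compatibility with compositions. -/
def mapComp {K L N : LocGenCat κ} (R : K ⟶ L) (S : L ⟶ N) :
    h.map (R ≫ S) ≅ h.map S ≫ h.map R :=
  haveI := h.essentiallySmall
  Nest.isoMk (F := h.map (R ≫ S)) (G := h.map S ≫ h.map R)
    (NatIso.op (LocGenCat.genMapComp R S (h.preservesGen R) (h.preservesGen S)
      (h.preservesGen (R ≫ S))))

/-- The pseudofunctor `Gen_κ`. -/
def pseudofunctor : LocGenCat κ ⥤ᵖ (Nest κ)ᵒᵖ where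
  obj K := op (h.obj K)
  map R := (h.map R).op
  map₂ α := Bicategory.Opposite.op2 (h.map₂ α)
  mapId K := (h.mapId K).op2
  mapComp R S := (h.mapComp R S).op2
  map₂_id R := Nest.op_hom₂_ext <| by
    have := h.essentiallySmall
    exact congrArg NatTrans.op (LocGenCat.genMap₂_id R (h.preservesGen R))
  map₂_comp α β := Nest.op_hom₂_ext <| by
    have := h.essentiallySmall
    exact congrArg NatTrans.op (LocGenCat.genMap₂_comp (h.preservesGen _) (h.preservesGen _)
      (h.preservesGen _) α β)
  map₂_whisker_left R _ _ α := Nest.op_hom₂_ext <| by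
    have := h.essentiallySmall
    exact congrArg NatTrans.op ((LocGenCat.genMap₂_whiskerLeft R (h.preservesGen _)
      (h.preservesGen _) (h.preservesGen _) (h.preservesGen _) (h.preservesGen _) α).trans
      (Category.assoc _ _ _).symm)
  map₂_whisker_right α S := Nest.op_hom₂_ext <| by
    have := h.essentiallySmall
    exact congrArg NatTrans.op ((LocGenCat.genMap₂_whiskerRight S (h.preservesGen _)
      (h.preservesGen _) (h.preservesGen _) (h.preservesGen _) (h.preservesGen _) α).trans
      (Category.assoc _ _ _).symm)
  map₂_associator R S T := Nest.op_hom₂_ext <| by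
    have := h.essentiallySmall
    have H := LocGenCat.genMap₂_associator R S T (h.preservesGen _)
      (h.preservesGen _) (h.preservesGen _) (h.preservesGen _) (h.preservesGen _)
      (h.preservesGen _) (h.preservesGen _)
    rw [← Category.assoc, ← Category.assoc, ← Category.assoc] at H
    exact congrArg NatTrans.op H
  map₂_left_unitor R := Nest.op_hom₂_ext <| by
    have := h.essentiallySmall
    exact congrArg NatTrans.op ((LocGenCat.genMap₂_leftUnitor R (h.preservesGen _)
      (h.preservesGen _) (h.preservesGen _)).trans (Category.assoc _ _ _).symm)
  map₂_right_unitor R := Nest.op_hom₂_ext <| by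
    have := h.essentiallySmall
    exact congrArg NatTrans.op ((LocGenCat.genMap₂_rightUnitor R (h.preservesGen _)
      (h.preservesGen _) (h.preservesGen _)).trans (Category.assoc _ _ _).symm)

end GenWellDefined

end Generated

/-! ### Biequivalences -/

/-- The pseudofunctors `F` and `G` form a biequivalence: the composites `F ⋙ G` and `G ⋙ F` are
equivalent to the identity pseudofunctors, in the bicategories of pseudofunctors, strong
(pseudonatural) transformations and modifications. -/
structure IsBiequivalence {B : Type u₁} [Bicategory.{v, v₁} B] {C : Type u₂}
    [Bicategory.{w, v₂} C] (F : B ⥤ᵖ C) (G : C ⥤ᵖ B) : Prop where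
  unit : Nonempty (Bicategory.Equivalence (Pseudofunctor.id B) (F.comp G))
  counit : Nonempty (Bicategory.Equivalence (G.comp F) (Pseudofunctor.id C))

end ExtendedGabrielUlmer

end

noncomputable section

namespace ExtendedGabrielUlmer

/-! ### Pointwise equivalences of pseudofunctors -/

section PointwiseEquivalence

open Bicategory

variable {B : Type u₁} [Bicategory.{v, v₁} B] {C : Type u₂} [Bicategory.{w, v₂} C]

section Zigzag

variable {a b : C} (e : a ≌ b)

lemma equivalence_left_zigzag_inv :
    e.hom ◁ e.counit.inv ⊗≫ e.unit.inv ▷ e.hom = (ρ_ e.hom).hom ≫ (λ_ e.hom).inv := by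
  have h := congrArg Iso.inv e.left_triangle
  simpa [bicategoricalIsoComp, bicategoricalComp] using h

lemma equivalence_right_zigzag_inv :
    e.counit.inv ▷ e.inv ⊗≫ e.inv ◁ e.unit.inv = (λ_ e.inv).hom ≫ (ρ_ e.inv).inv := by
  have h := congrArg Iso.inv e.right_triangle
  simpa [bicategoricalIsoComp, bicategoricalComp] using h

end Zigzag

variable {F G : B ⥤ᵖ C}

/-- A strong transformation all of whose components are (adjoint) equivalences. -/
structure PointwiseEquivalence (F G : B ⥤ᵖ C) where
  equiv (a : B) : F.obj a ≌ G.obj a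
  naturality {a b : B} (f : a ⟶ b) : F.map f ≫ (equiv b).hom ≅ (equiv a).hom ≫ G.map f
  naturality_naturality {a b : B} {f g : a ⟶ b} (η : f ⟶ g) :
      F.map₂ η ▷ (equiv b).hom ≫ (naturality g).hom =
        (naturality f).hom ≫ (equiv a).hom ◁ G.map₂ η
  naturality_id (a : B) :
      (naturality (𝟙 a)).hom ≫ (equiv a).hom ◁ (G.mapId a).hom =
        (F.mapId a).hom ▷ (equiv a).hom ≫ (λ_ (equiv a).hom).hom ≫ (ρ_ (equiv a).hom).inv
  naturality_comp {a b c : B} (f : a ⟶ b) (g : b ⟶ c) :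
      (naturality (f ≫ g)).hom ≫ (equiv a).hom ◁ (G.mapComp f g).hom =
        (F.mapComp f g).hom ▷ (equiv c).hom ≫ (α_ _ _ _).hom ≫ F.map f ◁ (naturality g).hom ≫
        (α_ _ _ _).inv ≫ (naturality f).hom ▷ G.map g ≫ (α_ _ _ _).hom

namespace PointwiseEquivalence

variable (E : PointwiseEquivalence F G)

/-- The underlying strong transformation. -/
def hom : F ⟶ G where
  app a := (E.equiv a).hom
  naturality := E.naturality
  naturality_naturality := E.naturality_naturality
  naturality_id := E.naturality_id
  naturality_comp := E.naturality_comp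

/-- The naturality constraint of the inverse transformation. -/
def invNaturality {a b : B} (f : a ⟶ b) :
    G.map f ≫ (E.equiv b).inv ≅ (E.equiv a).inv ≫ F.map f :=
  (λ_ _).symm ≪≫ whiskerRightIso (E.equiv a).counit.symm _ ≪≫ α_ _ _ _ ≪≫
    whiskerLeftIso (E.equiv a).inv ((α_ _ _ _).symm ≪≫
      whiskerRightIso (E.naturality f).symm (E.equiv b).inv ≪≫ α_ _ _ _ ≪≫
      whiskerLeftIso (F.map f) (E.equiv b).unit.symm ≪≫ ρ_ _)

lemma invNaturality_hom {a b : B} (f : a ⟶ b) :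
    (E.invNaturality f).hom = 𝟙 _ ⊗≫ (E.equiv a).counit.inv ▷ (G.map f ≫ (E.equiv b).inv) ⊗≫
      (E.equiv a).inv ◁ (E.naturality f).inv ▷ (E.equiv b).inv ⊗≫
        ((E.equiv a).inv ≫ F.map f) ◁ (E.equiv b).unit.inv ⊗≫ 𝟙 _ := by
  simp only [invNaturality, Iso.trans_hom, Iso.symm_hom, whiskerRightIso_hom,
    whiskerLeftIso_hom]
  bicategory

lemma naturality_inv_naturality {a b : B} {f g : a ⟶ b} (η : f ⟶ g) :
    (E.equiv a).hom ◁ G.map₂ η ≫ (E.naturality g).inv =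
      (E.naturality f).inv ≫ F.map₂ η ▷ (E.equiv b).hom := by
  rw [Iso.eq_inv_comp, ← reassoc_of% E.naturality_naturality, Iso.hom_inv_id, Category.comp_id]

lemma invNaturality_naturality {a b : B} {f g : a ⟶ b} (η : f ⟶ g) :
    G.map₂ η ▷ (E.equiv b).inv ≫ (E.invNaturality g).hom =
      (E.invNaturality f).hom ≫ (E.equiv a).inv ◁ F.map₂ η := by
  rw [invNaturality_hom, invNaturality_hom]
  calc
    _ = 𝟙 _ ⊗≫ (𝟙 _ ◁ (G.map₂ η ▷ (E.equiv b).inv) ≫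
          (E.equiv a).counit.inv ▷ (G.map g ≫ (E.equiv b).inv)) ⊗≫
        (E.equiv a).inv ◁ (E.naturality g).inv ▷ (E.equiv b).inv ⊗≫
        ((E.equiv a).inv ≫ F.map g) ◁ (E.equiv b).unit.inv ⊗≫ 𝟙 _ := by bicategory
    _ = 𝟙 _ ⊗≫ (E.equiv a).counit.inv ▷ (G.map f ≫ (E.equiv b).inv) ⊗≫
        (E.equiv a).inv ◁ ((E.equiv a).hom ◁ G.map₂ η ≫ (E.naturality g).inv) ▷
          (E.equiv b).inv ⊗≫
        ((E.equiv a).inv ≫ F.map g) ◁ (E.equiv b).unit.inv ⊗≫ 𝟙 _ := by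
      rw [whisker_exchange]; bicategory
    _ = 𝟙 _ ⊗≫ (E.equiv a).counit.inv ▷ (G.map f ≫ (E.equiv b).inv) ⊗≫
        (E.equiv a).inv ◁ (E.naturality f).inv ▷ (E.equiv b).inv ⊗≫
        (((E.equiv a).inv ◁ F.map₂ η) ▷ _ ≫
        ((E.equiv a).inv ≫ F.map g) ◁ (E.equiv b).unit.inv) ⊗≫ 𝟙 _ := by
      rw [naturality_inv_naturality]; bicategory
    _ = _ := by
      rw [← whisker_exchange]; bicategory

lemma naturality_id_inv (a : B) :
    (E.naturality (𝟙 a)).inv = (E.equiv a).hom ◁ (G.mapId a).hom ≫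
      (ρ_ (E.equiv a).hom).hom ≫ (λ_ (E.equiv a).hom).inv ≫
        (F.mapId a).inv ▷ (E.equiv a).hom :=
  E.hom.naturality_id_inv a

lemma naturality_comp_inv {a b c : B} (f : a ⟶ b) (g : b ⟶ c) :
    (E.naturality (f ≫ g)).inv =
      (E.equiv a).hom ◁ (G.mapComp f g).hom ≫ (α_ _ _ _).inv ≫ (E.naturality f).inv ▷ G.map g ≫
      (α_ _ _ _).hom ≫ F.map f ◁ (E.naturality g).inv ≫ (α_ _ _ _).inv ≫
      (F.mapComp f g).inv ▷ (E.equiv c).hom :=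
  E.hom.naturality_comp_inv f g

lemma invNaturality_id (a : B) :
    (E.invNaturality (𝟙 a)).hom ≫ (E.equiv a).inv ◁ (F.mapId a).hom =
      (G.mapId a).hom ▷ (E.equiv a).inv ≫
        (λ_ (E.equiv a).inv).hom ≫ (ρ_ (E.equiv a).inv).inv := by
  rw [invNaturality_hom, naturality_id_inv]
  calc
    _ = 𝟙 _ ⊗≫ ((E.equiv a).counit.inv ▷ (G.map (𝟙 a) ≫ (E.equiv a).inv) ≫
          _ ◁ ((G.mapId a).hom ▷ (E.equiv a).inv)) ⊗≫
        (((E.equiv a).inv ◁ (F.mapId a).inv) ▷ ((E.equiv a).hom ≫ (E.equiv a).inv) ≫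
        ((E.equiv a).inv ≫ F.map (𝟙 a)) ◁ (E.equiv a).unit.inv) ⊗≫
          (E.equiv a).inv ◁ (F.mapId a).hom := by bicategory
    _ = 𝟙 _ ⊗≫ (G.mapId a).hom ▷ (E.equiv a).inv ⊗≫
        ((E.equiv a).counit.inv ▷ (E.equiv a).inv ⊗≫ (E.equiv a).inv ◁ (E.equiv a).unit.inv) ⊗≫
          (E.equiv a).inv ◁ ((F.mapId a).inv ≫ (F.mapId a).hom) := by
      rw [← whisker_exchange, ← whisker_exchange]; bicategory
    _ = _ := by
      rw [equivalence_right_zigzag_inv, Iso.inv_hom_id]; bicategory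

lemma invNaturality_comp {a b c : B} (f : a ⟶ b) (g : b ⟶ c) :
    (E.invNaturality (f ≫ g)).hom ≫ (E.equiv a).inv ◁ (F.mapComp f g).hom =
      (G.mapComp f g).hom ▷ (E.equiv c).inv ≫ (α_ _ _ _).hom ≫
        G.map f ◁ (E.invNaturality g).hom ≫
        (α_ _ _ _).inv ≫ (E.invNaturality f).hom ▷ F.map g ≫ (α_ _ _ _).hom := by
  rw [invNaturality_hom, naturality_comp_inv, E.invNaturality_hom f]
  let p : G.map f ⟶ (E.equiv a).inv ≫ F.map f ≫ (E.equiv b).hom :=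
    𝟙 _ ⊗≫ (E.equiv a).counit.inv ▷ G.map f ⊗≫ (E.equiv a).inv ◁ (E.naturality f).inv
  let q : (E.equiv b).hom ≫ G.map g ≫ (E.equiv c).inv ⟶ F.map g :=
    𝟙 _ ⊗≫ (E.naturality g).inv ▷ (E.equiv c).inv ⊗≫ F.map g ◁ (E.equiv c).unit.inv ⊗≫ 𝟙 _
  symm
  calc
    _ = 𝟙 _ ⊗≫ (G.mapComp f g).hom ▷ (E.equiv c).inv ⊗≫
        (G.map f ◁ (E.invNaturality g).hom ≫ p ▷ _) ⊗≫
        ((E.equiv a).inv ≫ F.map f) ◁ (E.equiv b).unit.inv ▷ F.map g ⊗≫ 𝟙 _ := by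
      dsimp only [p]; bicategory
    _ = 𝟙 _ ⊗≫ (G.mapComp f g).hom ▷ (E.equiv c).inv ⊗≫
        p ▷ (G.map g ≫ (E.equiv c).inv) ⊗≫
        (((E.equiv a).inv ≫ F.map f) ◁ (E.equiv b).hom ◁ (E.equiv b).counit.inv ▷
          (G.map g ≫ (E.equiv c).inv)) ⊗≫
        ((E.equiv a).inv ≫ F.map f) ◁ (((E.equiv b).hom ≫ (E.equiv b).inv) ◁ q ≫
          (E.equiv b).unit.inv ▷ F.map g) ⊗≫ 𝟙 _ := by
      rw [whisker_exchange, E.invNaturality_hom g]; dsimp only [p, q]; bicategory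
    _ = 𝟙 _ ⊗≫ (G.mapComp f g).hom ▷ (E.equiv c).inv ⊗≫
        p ▷ (G.map g ≫ (E.equiv c).inv) ⊗≫
        ((E.equiv a).inv ≫ F.map f) ◁ ((E.equiv b).hom ◁ (E.equiv b).counit.inv ⊗≫
          (E.equiv b).unit.inv ▷ (E.equiv b).hom) ▷ (G.map g ≫ (E.equiv c).inv) ⊗≫
        ((E.equiv a).inv ≫ F.map f) ◁ q ⊗≫ 𝟙 _ := by
      rw [whisker_exchange]; bicategory
    _ = 𝟙 _ ⊗≫ (𝟙 _ ◁ (G.mapComp f g).hom ▷ (E.equiv c).inv ≫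
          (E.equiv a).counit.inv ▷ _) ⊗≫
        (E.equiv a).inv ◁ (E.naturality f).inv ▷ (G.map g ≫ (E.equiv c).inv) ⊗≫
        ((E.equiv a).inv ≫ F.map f) ◁ (E.naturality g).inv ▷ (E.equiv c).inv ⊗≫
        ((E.equiv a).inv ≫ F.map f ≫ F.map g) ◁ (E.equiv c).unit.inv ⊗≫ 𝟙 _ := by
      rw [equivalence_left_zigzag_inv]; dsimp only [p, q]; bicategory
    _ = 𝟙 _ ⊗≫ (E.equiv a).counit.inv ▷ (G.map (f ≫ g) ≫ (E.equiv c).inv) ⊗≫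
        (E.equiv a).inv ◁ (E.equiv a).hom ◁ (G.mapComp f g).hom ▷ (E.equiv c).inv ⊗≫
        (E.equiv a).inv ◁ (E.naturality f).inv ▷ (G.map g ≫ (E.equiv c).inv) ⊗≫
        ((E.equiv a).inv ≫ F.map f) ◁ (E.naturality g).inv ▷ (E.equiv c).inv ⊗≫
        ((E.equiv a).inv ◁ ((F.mapComp f g).inv ≫ (F.mapComp f g).hom)) ▷
          ((E.equiv c).hom ≫ (E.equiv c).inv) ⊗≫
        ((E.equiv a).inv ≫ F.map f ≫ F.map g) ◁ (E.equiv c).unit.inv ⊗≫ 𝟙 _ := by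
      rw [whisker_exchange, Iso.inv_hom_id]; bicategory
    _ = 𝟙 _ ⊗≫ (E.equiv a).counit.inv ▷ (G.map (f ≫ g) ≫ (E.equiv c).inv) ⊗≫
        (E.equiv a).inv ◁ (E.equiv a).hom ◁ (G.mapComp f g).hom ▷ (E.equiv c).inv ⊗≫
        (E.equiv a).inv ◁ (E.naturality f).inv ▷ (G.map g ≫ (E.equiv c).inv) ⊗≫
        ((E.equiv a).inv ≫ F.map f) ◁ (E.naturality g).inv ▷ (E.equiv c).inv ⊗≫
        (E.equiv a).inv ◁ (F.mapComp f g).inv ▷ ((E.equiv c).hom ≫ (E.equiv c).inv) ⊗≫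
        (((E.equiv a).inv ◁ (F.mapComp f g).hom) ▷ ((E.equiv c).hom ≫ (E.equiv c).inv) ≫
        ((E.equiv a).inv ≫ F.map f ≫ F.map g) ◁ (E.equiv c).unit.inv) ⊗≫ 𝟙 _ := by bicategory
    _ = _ := by rw [← whisker_exchange]; bicategory

/-- The inverse transformation. -/
def inv : G ⟶ F where
  app a := (E.equiv a).inv
  naturality := E.invNaturality
  naturality_naturality := E.invNaturality_naturality
  naturality_id := E.invNaturality_id
  naturality_comp := E.invNaturality_comp

/-- The unit of the equivalence. -/
def unitIso : 𝟙 F ≅ E.hom ≫ E.inv :=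
  Pseudofunctor.StrongTrans.isoMk (fun a => (E.equiv a).unit) (fun {a b} f => by
    change F.map f ◁ (E.equiv b).unit.hom ≫ (α_ _ _ _).inv ≫
      (E.naturality f).hom ▷ (E.equiv b).inv ≫ (α_ _ _ _).hom ≫
        (E.equiv a).hom ◁ (E.invNaturality f).hom ≫ (α_ _ _ _).inv =
      ((ρ_ _).hom ≫ (λ_ _).inv) ≫ (E.equiv a).unit.hom ▷ F.map f
    rw [← cancel_mono ((E.equiv a).unit.inv ▷ F.map f), Category.assoc ((ρ_ _).hom ≫ _),
      ← comp_whiskerRight, Iso.hom_inv_id, invNaturality_hom]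
    let p : (E.equiv a).hom ≫ G.map f ≫ (E.equiv b).inv ⟶ F.map f :=
      𝟙 _ ⊗≫ (E.naturality f).inv ▷ (E.equiv b).inv ⊗≫
        F.map f ◁ (E.equiv b).unit.inv ⊗≫ 𝟙 _
    calc
      _ = 𝟙 _ ⊗≫ F.map f ◁ (E.equiv b).unit.hom ⊗≫
          (E.naturality f).hom ▷ (E.equiv b).inv ⊗≫
          (E.equiv a).hom ◁ (E.equiv a).counit.inv ▷ (G.map f ≫ (E.equiv b).inv) ⊗≫
          (((E.equiv a).hom ≫ (E.equiv a).inv) ◁ p ≫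
          (E.equiv a).unit.inv ▷ F.map f) := by
        dsimp only [p]; bicategory
      _ = 𝟙 _ ⊗≫ F.map f ◁ (E.equiv b).unit.hom ⊗≫
          (E.naturality f).hom ▷ (E.equiv b).inv ⊗≫
          ((E.equiv a).hom ◁ (E.equiv a).counit.inv ⊗≫
            (E.equiv a).unit.inv ▷ (E.equiv a).hom) ▷ (G.map f ≫ (E.equiv b).inv) ⊗≫
          p ⊗≫ 𝟙 _ := by
        rw [whisker_exchange]; bicategory
      _ = 𝟙 _ ⊗≫ F.map f ◁ (E.equiv b).unit.hom ⊗≫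
          ((E.naturality f).hom ≫ (E.naturality f).inv) ▷ (E.equiv b).inv ⊗≫
          F.map f ◁ (E.equiv b).unit.inv ⊗≫ 𝟙 _ := by
        rw [equivalence_left_zigzag_inv]; dsimp only [p]; bicategory
      _ = 𝟙 _ ⊗≫ F.map f ◁ ((E.equiv b).unit.hom ≫ (E.equiv b).unit.inv) ⊗≫ 𝟙 _ := by
        rw [Iso.hom_inv_id]; bicategory
      _ = _ := by rw [Iso.hom_inv_id]; bicategory)

/-- The counit of the equivalence. -/
def counitIso : E.inv ≫ E.hom ≅ 𝟙 G :=
  Pseudofunctor.StrongTrans.isoMk (fun a => (E.equiv a).counit) (fun {a b} f => by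
    change G.map f ◁ (E.equiv b).counit.hom ≫ (ρ_ _).hom ≫ (λ_ _).inv =
      ((α_ _ _ _).inv ≫ (E.invNaturality f).hom ▷ (E.equiv b).hom ≫ (α_ _ _ _).hom ≫
        (E.equiv a).inv ◁ (E.naturality f).hom ≫ (α_ _ _ _).inv) ≫
      (E.equiv a).counit.hom ▷ G.map f
    rw [← cancel_epi (G.map f ◁ (E.equiv b).counit.inv), ← whiskerLeft_comp_assoc,
      Iso.inv_hom_id, invNaturality_hom]
    symm
    let p : G.map f ⟶ (E.equiv a).inv ≫ F.map f ≫ (E.equiv b).hom :=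
      𝟙 _ ⊗≫ (E.equiv a).counit.inv ▷ G.map f ⊗≫ (E.equiv a).inv ◁ (E.naturality f).inv
    calc
      _ = (G.map f ◁ (E.equiv b).counit.inv ≫ p ▷ ((E.equiv b).inv ≫ (E.equiv b).hom)) ⊗≫
          ((E.equiv a).inv ≫ F.map f) ◁ (E.equiv b).unit.inv ▷ (E.equiv b).hom ⊗≫
          (E.equiv a).inv ◁ (E.naturality f).hom ⊗≫ (E.equiv a).counit.hom ▷ G.map f := by
        dsimp only [p]; bicategory
      _ = 𝟙 _ ⊗≫ p ⊗≫
          ((E.equiv a).inv ≫ F.map f) ◁ ((E.equiv b).hom ◁ (E.equiv b).counit.inv ⊗≫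
            (E.equiv b).unit.inv ▷ (E.equiv b).hom) ⊗≫
          (E.equiv a).inv ◁ (E.naturality f).hom ⊗≫ (E.equiv a).counit.hom ▷ G.map f := by
        rw [whisker_exchange]; bicategory
      _ = 𝟙 _ ⊗≫ (E.equiv a).counit.inv ▷ G.map f ⊗≫
          (E.equiv a).inv ◁ ((E.naturality f).inv ≫ (E.naturality f).hom) ⊗≫
          (E.equiv a).counit.hom ▷ G.map f := by
        rw [equivalence_left_zigzag_inv]; dsimp only [p]; bicategory
      _ = 𝟙 _ ⊗≫ ((E.equiv a).counit.inv ≫ (E.equiv a).counit.hom) ▷ G.map f ⊗≫ 𝟙 _ := by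
        rw [Iso.inv_hom_id]; bicategory
      _ = _ := by rw [Iso.inv_hom_id]; bicategory)

/-- A pointwise equivalence is an equivalence in the bicategory of pseudofunctors. -/
def toEquivalence : F ≌ G :=
  Bicategory.Equivalence.mkOfAdjointifyCounit E.unitIso E.counitIso

end PointwiseEquivalence

end PointwiseEquivalence

/-! ### Closure properties of orthogonal classes -/

section Orthogonality

variable {C : Type u} [Category.{v} C] {D : Type u₁} [Category.{v₁} D]

lemma orthogonal_op_iff {A B X Y : C} (e : A ⟶ B) (m : X ⟶ Y) :
    Orthogonal m.op e.op ↔ Orthogonal e m := by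
  constructor
  · intro h u v w
    obtain ⟨d, ⟨hd₁, hd₂⟩, hd⟩ := h v.op u.op (by rw [← op_comp, ← op_comp, w])
    refine ⟨d.unop, ⟨Quiver.Hom.op_inj hd₂, Quiver.Hom.op_inj hd₁⟩, fun d' hd' => ?_⟩
    exact Quiver.Hom.op_inj
      (hd d'.op ⟨Quiver.Hom.unop_inj hd'.2, Quiver.Hom.unop_inj hd'.1⟩)
  · intro h u v w
    obtain ⟨d, ⟨hd₁, hd₂⟩, hd⟩ := h v.unop u.unop (Quiver.Hom.op_inj w.symm)
    refine ⟨d.op, ⟨Quiver.Hom.unop_inj hd₂, Quiver.Hom.unop_inj hd₁⟩, fun d' hd' => ?_⟩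
    exact Quiver.Hom.unop_inj
      (hd d'.unop ⟨Quiver.Hom.op_inj hd'.2, Quiver.Hom.op_inj hd'.1⟩)

lemma Orthogonal.of_isIso_left {A B X Y : C} (e : A ⟶ B) [IsIso e] (m : X ⟶ Y) :
    Orthogonal e m := fun u v w =>
  ⟨inv e ≫ u, ⟨by simp, by simp [w]⟩, fun d hd => by simp [← hd.1]⟩

lemma Orthogonal.of_isIso_right {A B X Y : C} (e : A ⟶ B) (m : X ⟶ Y) [IsIso m] :
    Orthogonal e m := fun u v w =>
  ⟨v ≫ inv m, ⟨by simp [← reassoc_of% w], by simp⟩, fun d hd => by simp [← hd.2]⟩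

lemma Orthogonal.isIso {A B : C} {f : A ⟶ B} (h : Orthogonal f f) : IsIso f := by
  obtain ⟨d, hd, -⟩ := h (𝟙 A) (𝟙 B) (by simp)
  exact ⟨d, hd⟩

lemma Orthogonal.hom_ext {A B X Y : C} {e : A ⟶ B} {m : X ⟶ Y} (h : Orthogonal e m)
    {d d' : B ⟶ X} (h₁ : e ≫ d = e ≫ d') (h₂ : d ≫ m = d' ≫ m) : d = d' :=
  (h (e ≫ d') (d' ≫ m) (by simp)).unique ⟨h₁, h₂⟩ ⟨rfl, rfl⟩

lemma Orthogonal.comp_left {A B B' X Y : C} {e : A ⟶ B} {e' : B ⟶ B'} {m : X ⟶ Y}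
    (h : Orthogonal e m) (h' : Orthogonal e' m) : Orthogonal (e ≫ e') m := by
  intro u v w
  obtain ⟨d, ⟨hd₁, hd₂⟩, -⟩ := h u (e' ≫ v) (by simpa using w)
  obtain ⟨d', ⟨hd₁', hd₂'⟩, -⟩ := h' d v hd₂
  refine ⟨d', ⟨by simp [hd₁', hd₁], hd₂'⟩, fun t ht => h'.hom_ext (h.hom_ext ?_ ?_) ?_⟩
  · simpa [hd₁', hd₁] using ht.1
  · simp [hd₂', ht.2]
  · simp [hd₂', ht.2]

lemma Orthogonal.of_comp_left {A B B' X Y : C} {e : A ⟶ B} {e' : B ⟶ B'} {m : X ⟶ Y}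
    (h : Orthogonal e m) (h' : Orthogonal (e ≫ e') m) : Orthogonal e' m := by
  intro u v w
  obtain ⟨d, ⟨hd₁, hd₂⟩, -⟩ := h' (e ≫ u) v (by simp [w])
  refine ⟨d, ⟨h.hom_ext (by simpa using hd₁) (by simp [hd₂, w]), hd₂⟩, fun t ht => ?_⟩
  exact h'.hom_ext (by simp [hd₁, ← ht.1]) (by simp [hd₂, ht.2])

lemma Orthogonal.comp_right {A B X Y Y' : C} {e : A ⟶ B} {m : X ⟶ Y} {m' : Y ⟶ Y'}
    (h : Orthogonal e m) (h' : Orthogonal e m') : Orthogonal e (m ≫ m') := by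
  rw [← orthogonal_op_iff] at h h' ⊢
  exact h'.comp_left h

lemma Orthogonal.of_comp_right {A B X Y Y' : C} {e : A ⟶ B} {m : X ⟶ Y} {m' : Y ⟶ Y'}
    (h : Orthogonal e m') (h' : Orthogonal e (m ≫ m')) : Orthogonal e m := by
  rw [← orthogonal_op_iff] at h h' ⊢
  exact h.of_comp_left h'

/-- Orthogonality is invariant under isomorphisms of arrows, on the left. -/
lemma Orthogonal.of_arrow_iso_left {A B A' B' X Y : C} {e : A ⟶ B} {e' : A' ⟶ B'} {m : X ⟶ Y}
    (i : A' ⟶ A) [IsIso i] (j : B ⟶ B') [IsIso j] (h : i ≫ e ≫ j = e') (he : Orthogonal e m) :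
    Orthogonal e' m := by
  rw [← h]
  exact (of_isIso_left _ _).comp_left (he.comp_left (of_isIso_left _ _))

lemma Orthogonal.of_arrow_iso_right {A B X Y X' Y' : C} {e : A ⟶ B} {m : X ⟶ Y} {m' : X' ⟶ Y'}
    (i : X' ⟶ X) [IsIso i] (j : Y ⟶ Y') [IsIso j] (h : i ≫ m ≫ j = m') (hm : Orthogonal e m) :
    Orthogonal e m' := by
  rw [← h]
  exact (of_isIso_right _ _).comp_right (hm.comp_right (of_isIso_right _ _))

/-- Orthogonality is compatible with adjunctions. -/
lemma orthogonal_map_iff_of_adjunction {L : C ⥤ D} {R : D ⥤ C} (adj : L ⊣ R)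
    {A B : C} (e : A ⟶ B) {X Y : D} (m : X ⟶ Y) :
    Orthogonal (L.map e) m ↔ Orthogonal e (R.map m) := by
  constructor
  · intro h u v w
    obtain ⟨d, ⟨hd₁, hd₂⟩, -⟩ := h ((adj.homEquiv _ _).symm u) ((adj.homEquiv _ _).symm v) (by
      rw [← adj.homEquiv_naturality_right_symm, ← adj.homEquiv_naturality_left_symm, w])
    refine ⟨adj.homEquiv _ _ d, ⟨?_, ?_⟩, fun t ht => ?_⟩
    · rw [← adj.homEquiv_naturality_left, hd₁, Equiv.apply_symm_apply]
    · rw [← adj.homEquiv_naturality_right, hd₂, Equiv.apply_symm_apply]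
    · apply (adj.homEquiv _ _).symm.injective
      rw [Equiv.symm_apply_apply]
      refine h.hom_ext ?_ ?_
      · rw [hd₁, ← adj.homEquiv_naturality_left_symm, ht.1]
      · rw [hd₂, ← adj.homEquiv_naturality_right_symm, ht.2]
  · intro h u v w
    obtain ⟨d, ⟨hd₁, hd₂⟩, -⟩ := h (adj.homEquiv _ _ u) (adj.homEquiv _ _ v) (by
      rw [← adj.homEquiv_naturality_right, ← adj.homEquiv_naturality_left, w])
    refine ⟨(adj.homEquiv _ _).symm d, ⟨?_, ?_⟩, fun t ht => ?_⟩
    · rw [← adj.homEquiv_naturality_left_symm, hd₁, Equiv.symm_apply_apply]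
    · rw [← adj.homEquiv_naturality_right_symm, hd₂, Equiv.symm_apply_apply]
    · apply (adj.homEquiv _ _).injective
      rw [Equiv.apply_symm_apply]
      refine h.hom_ext ?_ ?_
      · rw [hd₁, ← adj.homEquiv_naturality_left, ht.1]
      · rw [hd₂, ← adj.homEquiv_naturality_right, ht.2]

/-- Fully faithful functors reflect orthogonality. -/
lemma Orthogonal.of_map {F : C ⥤ D} [F.Full] [F.Faithful] {A B X Y : C} {e : A ⟶ B}
    {m : X ⟶ Y} (h : Orthogonal (F.map e) (F.map m)) : Orthogonal e m := by
  intro u v w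
  obtain ⟨d, ⟨hd₁, hd₂⟩, -⟩ := h (F.map u) (F.map v) (by rw [← F.map_comp, w, F.map_comp])
  refine ⟨F.preimage d, ⟨F.map_injective (by simpa using hd₁),
    F.map_injective (by simpa using hd₂)⟩, fun t ht => F.map_injective (h.hom_ext ?_ ?_)⟩
  · simp [hd₁, ← ht.1]
  · simp [hd₂, ← ht.2]

/-- The left class is closed under colimits. -/
lemma Orthogonal.of_isColimit {J : Type u₂} [Category.{v₂} J] {F G : J ⥤ C} (α : F ⟶ G)
    {c : Cocone F} (hc : IsColimit c) {d : Cocone G} (hd : IsColimit d) (φ : c.pt ⟶ d.pt)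
    (hφ : ∀ j, c.ι.app j ≫ φ = α.app j ≫ d.ι.app j) {X Y : C} {m : X ⟶ Y}
    (h : ∀ j, Orthogonal (α.app j) m) : Orthogonal φ m := by
  intro u v w
  have hw (j) : (c.ι.app j ≫ u) ≫ m = α.app j ≫ d.ι.app j ≫ v := by
    rw [Category.assoc, w, reassoc_of% hφ]
  choose t ht _ using fun j => h j _ _ (hw j)
  let s : Cocone G :=
    { pt := X
      ι :=
        { app := t
          naturality := fun i j f => by
            dsimp
            rw [Category.comp_id]
            refine (h i).hom_ext ?_ ?_
            · rw [(ht i).1, ← NatTrans.naturality_assoc, (ht j).1, c.w_assoc]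
            · rw [Category.assoc, (ht i).2, (ht j).2, d.w_assoc] } }
  have hs (j) : d.ι.app j ≫ hd.desc s = t j := hd.fac s j
  refine ⟨hd.desc s, ⟨hc.hom_ext fun j => ?_, hd.hom_ext fun j => ?_⟩, fun t' ht' =>
    hd.hom_ext fun j => ?_⟩
  · rw [reassoc_of% hφ, hs, (ht j).1]
  · rw [← Category.assoc, hs, (ht j).2]
  · rw [hs]
    refine (h j).hom_ext ?_ ?_
    · rw [(ht j).1, ← ht'.1, reassoc_of% hφ]
    · rw [(ht j).2, Category.assoc, ht'.2]

/-- The right class is closed under multiple pullbacks. -/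
lemma Orthogonal.of_isLimit_wideCospan {I : Type w} {F : WidePullbackShape I ⥤ C} {c : Cone F}
    (hc : IsLimit c) {A B : C} {e : A ⟶ B}
    (h : ∀ i, Orthogonal e (F.map (WidePullbackShape.Hom.term i))) :
    Orthogonal e (c.π.app none) := by
  intro u v w
  have hw (i) : (u ≫ c.π.app (some i)) ≫ F.map (WidePullbackShape.Hom.term i) = e ≫ v := by
    rw [Category.assoc, c.w, w]
  choose t ht _ using fun i => h i _ _ (hw i)
  obtain ⟨l, hl₀, hl⟩ : ∃ l : B ⟶ c.pt, l ≫ c.π.app none = v ∧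
      ∀ i, l ≫ c.π.app (some i) = t i :=
    ⟨hc.lift (WidePullbackShape.mkCone v t (fun i => (ht i).2)), hc.fac _ none,
      fun i => hc.fac _ (some i)⟩
  refine ⟨l, ⟨hc.hom_ext fun j => ?_, hl₀⟩, fun (t' : B ⟶ c.pt) ht' => hc.hom_ext fun j => ?_⟩
  · rcases j with _ | i
    · exact (Category.assoc _ _ _).trans ((congrArg _ hl₀).trans w.symm)
    · exact (Category.assoc _ _ _).trans ((congrArg _ (hl i)).trans (ht i).1)
  · rcases j with _ | i
    · rw [hl₀]
      exact ht'.2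
    · rw [hl]
      refine (h i).hom_ext ?_ ?_
      · rw [(ht i).1, ← ht'.1]
        exact (Category.assoc _ _ _).symm
      · rw [(ht i).2, Category.assoc, c.w]
        exact ht'.2

/-- The left class is closed under multiple pushouts. -/
lemma Orthogonal.of_isColimit_wideSpan {I : Type w} {F : WidePullbackShape I ⥤ Cᵒᵖ}
    {c : Cocone F.leftOp} (hc : IsColimit c) {X Y : C} {m : X ⟶ Y}
    (h : ∀ i, Orthogonal (F.map (WidePullbackShape.Hom.term i)).unop m) :
    Orthogonal (c.ι.app (op none)) m := by
  rw [← orthogonal_op_iff]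
  exact of_isLimit_wideCospan (c := coneOfCoconeLeftOp c) (isLimitConeOfCoconeLeftOp _ hc)
    (fun i => (orthogonal_op_iff _ _).2 (h i))

/-- The right class is closed under base change. -/
lemma Orthogonal.of_isPullback {A B : C} {e : A ⟶ B} {P X Y Z : C} {p : P ⟶ X} {q : P ⟶ Y}
    {f : X ⟶ Z} {m : Y ⟶ Z} (sq : IsPullback p q f m) (h : Orthogonal e m) :
    Orthogonal e p := by
  intro u v w
  obtain ⟨d, ⟨hd₁, hd₂⟩, -⟩ := h (u ≫ q) (v ≫ f) (by
    rw [Category.assoc, ← sq.w, reassoc_of% w])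
  refine ⟨sq.lift v d hd₂.symm, ⟨sq.hom_ext ?_ ?_, by simp⟩, fun t ht => sq.hom_ext ?_ ?_⟩
  · simp [w]
  · simp [hd₁]
  · simp [ht.2]
  · simp only [IsPullback.lift_snd]
    refine h.hom_ext ?_ ?_
    · rw [hd₁, ← ht.1, Category.assoc]
    · rw [hd₂, Category.assoc, ← sq.w, reassoc_of% ht.2]

end Orthogonality

namespace IsFactorizationSystem

variable {C : Type u} [Category.{v} C] {E M : MorphismProperty C}

lemma orthogonal (h : IsFactorizationSystem E M)
    {A B X Y : C} {e : A ⟶ B} {m : X ⟶ Y} (he : E e) (hm : M m) :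
    Orthogonal e m := by
  rw [h.left_eq] at he
  exact he m hm

lemma left_of_orthogonal (h : IsFactorizationSystem E M) {A B : C} {e : A ⟶ B}
    (he : ∀ ⦃X Y : C⦄ (m : X ⟶ Y), M m → Orthogonal e m) : E e := by
  rw [h.left_eq]
  exact he

lemma right_of_orthogonal (h : IsFactorizationSystem E M) {X Y : C} {m : X ⟶ Y}
    (hm : ∀ ⦃A B : C⦄ (e : A ⟶ B), E e → Orthogonal e m) : M m := by
  rw [h.right_eq]
  exact hm

lemma left_of_isIso (h : IsFactorizationSystem E M) {A B : C} (e : A ⟶ B) [IsIso e] : E e :=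
  h.left_of_orthogonal fun _ _ _ _ => .of_isIso_left _ _

lemma right_of_isIso (h : IsFactorizationSystem E M) {A B : C} (e : A ⟶ B) [IsIso e] : M e :=
  h.right_of_orthogonal fun _ _ _ _ => .of_isIso_right _ _

lemma left_comp (h : IsFactorizationSystem E M)
    {X Y Z : C} {f : X ⟶ Y} {g : Y ⟶ Z} (hf : E f) (hg : E g) : E (f ≫ g) :=
  h.left_of_orthogonal fun _ _ _ hm => (h.orthogonal hf hm).comp_left (h.orthogonal hg hm)

lemma right_comp (h : IsFactorizationSystem E M)
    {X Y Z : C} {f : X ⟶ Y} {g : Y ⟶ Z} (hf : M f) (hg : M g) : M (f ≫ g) :=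
  h.right_of_orthogonal fun _ _ _ he => (h.orthogonal he hf).comp_right (h.orthogonal he hg)

lemma left_of_comp (h : IsFactorizationSystem E M)
    {X Y Z : C} {f : X ⟶ Y} {g : Y ⟶ Z} (hf : E f) (hfg : E (f ≫ g)) : E g :=
  h.left_of_orthogonal fun _ _ _ hm => (h.orthogonal hf hm).of_comp_left (h.orthogonal hfg hm)

lemma isIso (h : IsFactorizationSystem E M) {X Y : C} {f : X ⟶ Y} (he : E f) (hm : M f) : IsIso f :=
  (h.orthogonal he hm).isIso

lemma left_of_arrow_iso (h : IsFactorizationSystem E M)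
    {A B A' B' : C} {e : A ⟶ B} {e' : A' ⟶ B'} (i : A' ⟶ A) [IsIso i]
    (j : B ⟶ B') [IsIso j] (w : i ≫ e ≫ j = e') (he : E e) : E e' :=
  h.left_of_orthogonal fun _ _ _ hm => (h.orthogonal he hm).of_arrow_iso_left i j w

lemma right_of_arrow_iso (h : IsFactorizationSystem E M)
    {A B A' B' : C} {e : A ⟶ B} {e' : A' ⟶ B'} (i : A' ⟶ A) [IsIso i]
    (j : B ⟶ B') [IsIso j] (w : i ≫ e ≫ j = e') (he : M e) : M e' :=
  h.right_of_orthogonal fun _ _ _ hm => (h.orthogonal hm he).of_arrow_iso_right i j w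

lemma right_of_isPullback (h : IsFactorizationSystem E M)
    {P X Y Z : C} {p : P ⟶ X} {q : P ⟶ Y} {f : X ⟶ Z} {m : Y ⟶ Z}
    (sq : IsPullback p q f m) (hm : M m) : M p :=
  h.right_of_orthogonal fun _ _ _ he => (h.orthogonal he hm).of_isPullback sq

lemma right_of_isLimit_wideCospan (h : IsFactorizationSystem E M)
    {I : Type w} {F : WidePullbackShape I ⥤ C} {c : Cone F}
    (hc : IsLimit c) (hF : IsWideCospanIn M F) : M (c.π.app none) :=
  h.right_of_orthogonal fun _ _ _ he => .of_isLimit_wideCospan hc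
    fun i => h.orthogonal he (hF i)

protected lemma op (h : IsFactorizationSystem E M) : IsFactorizationSystem M.op E.op where
  left_eq := by
    ext X Y f
    refine ⟨fun hf A B g hg => ?_, fun hf => h.right_of_orthogonal fun A B e he => ?_⟩
    · exact (orthogonal_op_iff g.unop f.unop).2 (h.orthogonal hg hf)
    · exact (orthogonal_op_iff e f.unop).1 (hf e.op he)
  right_eq := by
    ext X Y f
    refine ⟨fun hf A B g hg => ?_, fun hf => h.left_of_orthogonal fun A B e he => ?_⟩
    · exact (orthogonal_op_iff f.unop g.unop).2 (h.orthogonal hf hg)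
    · exact (orthogonal_op_iff f.unop e).1 (hf e.op he)
  exists_factorization X Y f := by
    obtain ⟨Z, e, m, he, hm, w⟩ := h.exists_factorization f.unop
    exact ⟨op Z, m.op, e.op, hm, he, by rw [← op_comp, w, Quiver.Hom.op_unop]⟩

/-- A factorization system restricts along a fully faithful functor whose essential image is
closed under the factorizations. -/
lemma inverseImage (h : IsFactorizationSystem E M)
    {S : Type u₁} [Category.{v₁} S] (F : S ⥤ C) [F.Full] [F.Faithful]
    (hF : ∀ ⦃X Y : S⦄ ⦃Z : C⦄ (e : F.obj X ⟶ Z) (m : Z ⟶ F.obj Y), E e → M m →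
      F.essImage Z) :
    IsFactorizationSystem (E.inverseImage F) (M.inverseImage F) := by
  have fact : ∀ ⦃X Y : S⦄ (f : X ⟶ Y), ∃ (Z : S) (e : X ⟶ Z) (m : Z ⟶ Y),
      E (F.map e) ∧ M (F.map m) ∧ e ≫ m = f := fun X Y f => by
    obtain ⟨Z, e, m, he, hm, w⟩ := h.exists_factorization (F.map f)
    obtain ⟨Z', ⟨i⟩⟩ := hF e m he hm
    refine ⟨Z', F.preimage (e ≫ i.inv), F.preimage (i.hom ≫ m), ?_, ?_,
      F.map_injective (by simp [w])⟩
    · simpa using h.left_comp he (h.left_of_isIso i.inv)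
    · simpa using h.right_comp (h.right_of_isIso i.hom) hm
  have orth : ∀ ⦃X Y : S⦄ (f : X ⟶ Y) ⦃X' Y' : S⦄ (g : X' ⟶ Y'), E (F.map f) → M (F.map g) →
      Orthogonal f g := fun X Y f X' Y' g hf hg => (h.orthogonal hf hg).of_map
  refine ⟨?_, ?_, fact⟩
  · ext X Y f
    refine ⟨fun hf X' Y' g hg => orth f g hf hg, fun hf => ?_⟩
    obtain ⟨Z, e, m, he, hm, rfl⟩ := fact f
    have : Orthogonal m m := (orth e m he hm).of_comp_left (hf m hm)
    have := this.isIso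
    exact h.left_of_arrow_iso (𝟙 _) (F.map m) (by simp) he
  · ext X Y f
    refine ⟨fun hf X' Y' g hg => orth g f hg hf, fun hf => ?_⟩
    obtain ⟨Z, e, m, he, hm, rfl⟩ := fact f
    have : Orthogonal e e := (orth e m he hm).of_comp_right (hf e he)
    have := this.isIso
    exact h.right_of_arrow_iso (F.map e) (𝟙 _) (by simp) hm

end IsFactorizationSystem

/-! ### Generated objects -/

section GeneratedObjects

variable {κ : Cardinal.{w}} [Fact κ.IsRegular] {C : Type u} [Category.{v} C]
  {D : Type u₁} [Category.{v₁} D] {E M : MorphismProperty C}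

lemma IsGenerated.exists_hom {A : C} (hA : IsGenerated κ M A) {J : Type w} [PartialOrder J]
    [IsCardinalFiltered J κ] {F : J ⥤ C} (hF : IsDiagramIn M F) {c : Cocone F}
    (hc : IsColimit c) (f : A ⟶ c.pt) : ∃ (j : J) (g : A ⟶ F.obj j), g ≫ c.ι.app j = f := by
  have := hA J F hF
  exact Types.jointly_surjective_of_isColimit
    (isColimitOfPreserves (coyoneda.obj (op A)) hc) f

lemma IsGenerated.exists_eq {A : C} (hA : IsGenerated κ M A) {J : Type w} [PartialOrder J]
    [IsCardinalFiltered J κ] {F : J ⥤ C} (hF : IsDiagramIn M F) {c : Cocone F}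
    (hc : IsColimit c) {j : J} (f g : A ⟶ F.obj j) (h : f ≫ c.ι.app j = g ≫ c.ι.app j) :
    ∃ (k : J) (t : j ⟶ k), f ≫ F.map t = g ≫ F.map t := by
  have := hA J F hF
  have := isFiltered_of_isCardinalFiltered J κ
  exact (Types.FilteredColimit.isColimit_eq_iff'
    (isColimitOfPreserves (coyoneda.obj (op A)) hc) f g).1 h

lemma isGenerated_of_exists {A : C}
    (h : ∀ (J : Type w) [PartialOrder J] [IsCardinalFiltered J κ] (F : J ⥤ C),
      IsDiagramIn M F → ∀ (c : Cocone F), IsColimit c →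
        (∀ f : A ⟶ c.pt, ∃ (j : J) (g : A ⟶ F.obj j), g ≫ c.ι.app j = f) ∧
        (∀ (j : J) (f g : A ⟶ F.obj j), f ≫ c.ι.app j = g ≫ c.ι.app j →
          ∃ (k : J) (t : j ⟶ k), f ≫ F.map t = g ≫ F.map t)) : IsGenerated κ M A := by
  intro J _ _ F hF
  have := isFiltered_of_isCardinalFiltered J κ
  refine ⟨fun {c} hc => ⟨Types.FilteredColimit.isColimitOf' _ _ (fun f => ?_) (h J F hF c hc).2⟩⟩
  obtain ⟨j, g, hg⟩ := (h J F hF c hc).1 f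
  exact ⟨j, g, hg.symm⟩

lemma IsGenerated.of_left (h : IsConvenient κ E M) {A B : C} {e : A ⟶ B} (he : E e)
    (hA : IsGenerated κ M A) : IsGenerated κ M B := by
  refine isGenerated_of_exists fun J _ _ F hF c hc => ⟨fun f => ?_, fun j f g hfg => ?_⟩
  · obtain ⟨j, g, hg⟩ := hA.exists_hom hF hc (e ≫ f)
    obtain ⟨d, hd, -⟩ := h.isFactorizationSystem.orthogonal he (h.ι_mem J F hF c hc j) g f hg
    exact ⟨j, d, hd.2⟩
  · obtain ⟨k, t, ht⟩ := hA.exists_eq hF hc (e ≫ f) (e ≫ g) (by simp [hfg])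
    refine ⟨k, t, (h.isFactorizationSystem.orthogonal he
      (h.ι_mem J F hF c hc k)).hom_ext (by simpa using ht) (by simp [hfg])⟩

lemma IsGenerated.of_isColimit {C : Type u} [Category.{w} C] {M : MorphismProperty C}
    {J : Type w} [SmallCategory J] (hJ : HasCardinalLT (Arrow J) κ) {F : J ⥤ C}
    {c : Cocone F} (hc : IsColimit c) (hF : ∀ j, IsGenerated κ M (F.obj j)) :
    IsGenerated κ M c.pt := by
  intro J' _ _ F' hF'
  refine ⟨fun {c'} hc' => ⟨?_⟩⟩
  refine Functor.Accessible.Limits.isColimitMapCocone (coyoneda.mapCone c.op)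
      (fun Y => isLimitOfPreserves ((evaluation C (Type w)).obj Y)
        (isLimitOfPreserves coyoneda hc.op)) κ (by simpa using hJ) c' (fun k => ?_)
  have := hF k.unop J' F' hF'
  exact isColimitOfPreserves (coyoneda.obj (op (F.obj k.unop))) hc'

lemma IsGenerated.of_iso {A B : C} (i : A ≅ B) (hA : IsGenerated κ M A) :
    IsGenerated κ M B := by
  intro J _ _ F hF
  have := hA J F hF
  exact preservesColimit_of_natIso F (coyoneda.mapIso i.symm.op)

lemma isGenerated_map_of_adjunction {M' : MorphismProperty D} {L : C ⥤ D} {R : D ⥤ C}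
    (adj : L ⊣ R) (hM : ∀ ⦃X Y : D⦄ (f : X ⟶ Y), M' f → M (R.map f))
    (hR : PreservesDirectedColimitsOf κ M' R) {X : C} (hX : IsGenerated κ M X) :
    IsGenerated κ M' (L.obj X) := by
  refine isGenerated_of_exists fun J _ _ F hF c hc => ?_
  have := hR J F hF
  have hF' : IsDiagramIn M (F ⋙ R) := fun i j f => hM _ (hF f)
  refine ⟨fun f => ?_, fun j f g hfg => ?_⟩
  · obtain ⟨j, g, hg⟩ := hX.exists_hom hF' (isColimitOfPreserves R hc) (adj.homEquiv _ _ f)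
    refine ⟨j, (adj.homEquiv _ _).symm g, (adj.homEquiv _ _).injective ?_⟩
    rw [adj.homEquiv_naturality_right, Equiv.apply_symm_apply]
    exact hg
  · obtain ⟨k, t, ht⟩ := hX.exists_eq hF' (isColimitOfPreserves R hc)
      (adj.homEquiv _ _ f) (adj.homEquiv _ _ g)
      (((adj.homEquiv_naturality_right _ _).symm.trans (congrArg _ hfg)).trans
        (adj.homEquiv_naturality_right _ _))
    refine ⟨k, t, (adj.homEquiv _ _).injective ?_⟩
    rw [adj.homEquiv_naturality_right, adj.homEquiv_naturality_right]
    exact ht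

/-- The generated objects are retracts of the objects of any generating class. -/
lemma IsGenerated.exists_retract {S : ObjectProperty C}
    (hS : ∀ X : C, ∃ (J : Type w) (_ : PartialOrder J) (_ : IsCardinalFiltered J κ) (F : J ⥤ C)
      (c : Cocone F), IsDiagramIn M F ∧ (∀ j, S (F.obj j)) ∧ Nonempty (IsColimit c) ∧
        Nonempty (c.pt ≅ X)) : IsGenerated κ M ≤ S.retractClosure := by
  intro X hX
  obtain ⟨J, _, _, F, c, hF, hFS, ⟨hc⟩, ⟨i⟩⟩ := hS X
  obtain ⟨j, g, hg⟩ := hX.exists_hom hF hc i.inv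
  exact ⟨_, hFS j, ⟨{ i := g, r := c.ι.app j ≫ i.hom, retract := by simp [reassoc_of% hg] }⟩⟩

lemma IsLocallyGenerated.essentiallySmall_isGenerated {C : Type u} [Category.{w} C]
    {E M : MorphismProperty C} (h : IsLocallyGenerated κ E M) :
    ObjectProperty.EssentiallySmall.{w} (IsGenerated κ M) := by
  obtain ⟨S, _, -, hS⟩ := h.exists_generators
  exact .of_le (IsGenerated.exists_retract hS)

end GeneratedObjects

/-- A fully faithful functor creates a colimit which belongs to its essential image. -/
lemma hasColimit_and_preservesColimit_of_fullyFaithful {S : Type u} [Category.{v} S] {C : Type u₁}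
    [Category.{v₁} C] {J : Type u₂} [Category.{v₂} J] (F : S ⥤ C) [F.Full] [F.Faithful]
    (D : J ⥤ S) {c : Cocone (D ⋙ F)} (hc : IsColimit c) (h : F.essImage c.pt) :
    HasColimit D ∧ PreservesColimit D F := by
  obtain ⟨X, ⟨i⟩⟩ := h
  let s : Cocone D :=
    { pt := X
      ι :=
        { app := fun j => F.preimage (c.ι.app j ≫ i.inv)
          naturality := fun j k f => F.map_injective (by
            simpa using c.w_assoc f i.inv) } }
  have hs : IsColimit (F.mapCocone s) :=
    IsColimit.ofIsoColimit hc (Cocone.ext i.symm (fun j => by simp [s]))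
  exact ⟨⟨s, isColimitOfReflects F hs⟩,
    preservesColimit_of_preserves_colimit_cocone (isColimitOfReflects F hs) hs⟩

namespace LocGenCat

variable {κ : Cardinal.{w}} [Fact κ.IsRegular]

instance essentiallySmall_gen (K : LocGenCat κ) : EssentiallySmall.{w} K.Gen := by
  have := K.isLocallyGenerated.essentiallySmall_isGenerated
  infer_instance

variable (K L : LocGenCat κ)

instance : K.incl.Full := K.inclFullyFaithful.full

instance : K.incl.Faithful := K.inclFullyFaithful.faithful

lemma isFactorizationSystem : IsFactorizationSystem K.E K.M :=
  K.isLocallyGenerated.isConvenient.isFactorizationSystem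

instance : HasColimitsOfSize.{w, w} K.carrier := K.isLocallyGenerated.cocomplete

lemma isGenerated_incl_obj (X : K.SmallGen) : IsGenerated κ K.M (K.incl.obj X) :=
  ((equivSmallModel.{w} K.Gen).inverse.obj X).property

lemma essImage_incl_iff (X : K.carrier) : K.incl.essImage X ↔ IsGenerated κ K.M X := by
  refine ⟨fun ⟨Y, ⟨i⟩⟩ => (K.isGenerated_incl_obj Y).of_iso i, fun h => ?_⟩
  exact ⟨(equivSmallModel.{w} K.Gen).functor.obj ⟨X, h⟩,
    ⟨(IsGenerated κ K.M).ι.mapIso ((equivSmallModel.{w} K.Gen).unitIso.symm.app ⟨X, h⟩)⟩⟩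

lemma incl_colimit_of_small {J : Type w} [SmallCategory J] (hJ : HasCardinalLT (Arrow J) κ)
    (D : J ⥤ K.SmallGen) : HasColimit D ∧ PreservesColimit D K.incl :=
  hasColimit_and_preservesColimit_of_fullyFaithful K.incl D (colimit.isColimit (D ⋙ K.incl))
    ((K.essImage_incl_iff _).2
      (.of_isColimit hJ (colimit.isColimit _) (fun _ => K.isGenerated_incl_obj _)))

lemma incl_colimit_of_wideSpan {I : Type w} {F : WidePullbackShape I ⥤ K.SmallGenᵒᵖ}
    (hF : IsWideCospanIn K.genM F) :
    HasColimit F.leftOp ∧ PreservesColimit F.leftOp K.incl := by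
  refine hasColimit_and_preservesColimit_of_fullyFaithful K.incl F.leftOp
    (colimit.isColimit (F.leftOp ⋙ K.incl)) ((K.essImage_incl_iff _).2 ?_)
  have h := K.isLocallyGenerated.isConvenient
  refine .of_left h (e := colimit.ι (F.leftOp ⋙ K.incl) (op none)) ?_
    (K.isGenerated_incl_obj _)
  refine h.isFactorizationSystem.left_of_orthogonal fun X Y m hm => ?_
  exact Orthogonal.of_isColimit_wideSpan (F := F ⋙ K.incl.op)
    (colimit.isColimit (F.leftOp ⋙ K.incl))
    (fun i => h.isFactorizationSystem.orthogonal (hF i) hm)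

lemma isNest_gen : IsNest κ K.genE K.genM where
  isFactorizationSystem := by
    have h := K.isLocallyGenerated.isConvenient
    exact (h.isFactorizationSystem.inverseImage K.incl fun X Y Z e m he _ =>
      (K.essImage_incl_iff Z).2 ((K.isGenerated_incl_obj X).of_left h he)).op
  hasSmallLimits J _ hJ := by
    have : HasColimitsOfShape Jᵒᵖ K.SmallGen :=
      ⟨fun D => (K.incl_colimit_of_small (by simpa using hJ) D).1⟩
    exact hasLimitsOfShape_op_of_hasColimitsOfShape
  hasMultiplePullbacks I F hF := by
    have := (K.incl_colimit_of_wideSpan hF).1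
    exact hasLimit_of_hasColimit_leftOp F

variable {K L}

lemma preservesGen (R : K ⟶ L) : Hom.PreservesGen R := fun _ hX =>
  isGenerated_map_of_adjunction (Hom.adj R) R.isLocGenMorphism.map_mem
    R.isLocGenMorphism.preserves hX

lemma left_map_mem (R : K ⟶ L) {X Y : L.carrier} {f : X ⟶ Y} (hf : L.E f) :
    K.E ((Hom.left R).map f) :=
  K.isFactorizationSystem.left_of_orthogonal fun _ _ m hm =>
    (orthogonal_map_iff_of_adjunction (Hom.adj R) f m).2
      (L.isFactorizationSystem.orthogonal hf (R.isLocGenMorphism.map_mem m hm))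

lemma preservesColimit_genMap (R : K ⟶ L) {J : Type u} [Category.{v} J] (D : J ⥤ L.SmallGen)
    [PreservesColimit D L.incl] : PreservesColimit D (genMap R (preservesGen R)) := by
  have : PreservesColimitsOfSize.{v, u} (Hom.left R) := (Hom.adj R).leftAdjoint_preservesColimits
  have : PreservesColimit D (genMap R (preservesGen R) ⋙ K.incl) :=
    preservesColimit_of_natIso D (genMapIncl R (preservesGen R)).symm
  exact preservesColimit_of_reflects_of_preserves _ K.incl

lemma isNestMorphism_genMap (R : K ⟶ L) :
    IsNestMorphism κ L.genM K.genM (genMap R (preservesGen R)).op where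
  map_mem X Y f hf := by
    let i := genMapIncl R (preservesGen R)
    refine K.isFactorizationSystem.left_of_arrow_iso (i.hom.app Y.unop) (i.inv.app X.unop) ?_
      (left_map_mem R (f := L.incl.map f.unop) hf)
    have := i.inv.naturality f.unop
    dsimp at this ⊢
    rw [this, Iso.hom_inv_id_app_assoc]
  preservesSmallLimits J _ hJ := by
    have (D : Jᵒᵖ ⥤ L.SmallGen) : PreservesColimit D (genMap R (preservesGen R)) := by
      have := (L.incl_colimit_of_small (by simpa using hJ) D).2
      exact preservesColimit_genMap R D
    have : PreservesColimitsOfShape Jᵒᵖ (genMap R (preservesGen R)) := ⟨fun {D} => this D⟩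
    exact preservesLimitsOfShape_op J _
  preservesMultiplePullbacks I F hF := by
    have := (L.incl_colimit_of_wideSpan hF).2
    have := preservesColimit_genMap R F.leftOp
    exact preservesLimit_op F _

end LocGenCat

/-- The pseudofunctor `Gen_κ` is well defined. -/
lemma genWellDefined (κ : Cardinal.{w}) [Fact κ.IsRegular] : GenWellDefined κ where
  essentiallySmall _ := inferInstance
  isNest K := K.isNest_gen
  preservesGen R := LocGenCat.preservesGen R
  isNestMorphism R := LocGenCat.isNestMorphism_genMap R

/-! ### Nests and models in terms of elements -/

section

variable {κ : Cardinal.{w}} [Fact κ.IsRegular]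

lemma hasCardinalLT_arrow_asSmall (J : Type) [SmallCategory J] [FinCategory J] :
    HasCardinalLT (Arrow (AsSmall.{w} J)) κ := by
  have : Finite (Arrow (AsSmall.{w} J)) :=
    Finite.of_injective (fun f => (AsSmall.down (C := J)).mapArrow.obj f) (by
      rintro ⟨⟨X⟩, ⟨Y⟩, ⟨f⟩⟩ ⟨⟨X'⟩, ⟨Y'⟩, ⟨f'⟩⟩ h
      cases h
      rfl)
  exact hasCardinalLT_of_finite _ κ (Cardinal.IsRegular.aleph0_le Fact.out)

end

namespace Nest

variable {κ : Cardinal.{w}} (A : Nest κ)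

lemma isFactorizationSystem : IsFactorizationSystem A.E A.M := A.isNest.isFactorizationSystem

/-- Since a nest is small, the existence of multiple pullbacks forces the morphisms in the right
class to be monomorphisms. -/
lemma mono {X Y : A.carrier} {m : X ⟶ Y} (hm : A.M m) : Mono m := by
  refine ⟨fun {Z} f g hfg => by_contra fun hne => ?_⟩
  let I : Type w := Σ P : A.carrier, Z ⟶ P
  let F : WidePullbackShape I ⥤ A.carrier :=
    WidePullbackShape.wideCospan Y (fun _ => X) (fun _ => m)
  have hF : IsWideCospanIn A.M F := fun _ => hm
  have := A.isNest.hasMultiplePullbacks I F hF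
  have key (s : Set I) : ∃ l : Z ⟶ limit F, ∀ i,
      (i ∈ s → l ≫ limit.π F (some i) = f) ∧ (i ∉ s → l ≫ limit.π F (some i) = g) := by
    classical
    let t (i : I) : Z ⟶ X := if i ∈ s then f else g
    have ht (i : I) : t i ≫ m = g ≫ m := by
      by_cases hi : i ∈ s
      · simp [t, hi, hfg]
      · simp [t, hi]
    refine ⟨limit.lift F (WidePullbackShape.mkCone (g ≫ m) t ht),
      fun i => ⟨fun hi => ?_, fun hi => ?_⟩⟩
    · exact (limit.lift_π _ _).trans (if_pos hi)
    · exact (limit.lift_π _ _).trans (if_neg hi)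
  choose l hl using key
  refine Function.cantor_injective (fun s => (⟨limit F, l s⟩ : I)) fun s t hst => ?_
  have hst' : l s = l t := eq_of_heq (Sigma.mk.inj hst).2
  ext i
  by_contra hi
  rw [not_iff] at hi
  by_cases hs : i ∈ s
  · have ht : i ∉ t := fun ht => (hi.2 ht) hs
    exact hne (((hl s i).1 hs).symm.trans (hst' ▸ (hl t i).2 ht))
  · have ht : i ∈ t := hi.1 hs
    exact hne (((hl t i).1 ht).symm.trans (hst' ▸ (hl s i).2 hs))

variable [Fact κ.IsRegular]

instance : HasFiniteLimits A.carrier where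
  out J _ _ := by
    have := A.isNest.hasSmallLimits (AsSmall.{w} J) (hasCardinalLT_arrow_asSmall J)
    exact hasLimitsOfShape_of_equivalence (AsSmall.equiv (C := J)).symm

end Nest

section

variable {κ : Cardinal.{w}} [Fact κ.IsRegular] {A : Type u} [Category.{v} A]

lemma PreservesSmallLimits.preservesFiniteLimits {H : A ⥤ Type w}
    (h : PreservesSmallLimits κ H) : PreservesFiniteLimits H where
  preservesFiniteLimits J _ _ := by
    have := h (AsSmall.{w} J) (hasCardinalLT_arrow_asSmall J)
    exact preservesLimitsOfShape_of_equiv (AsSmall.equiv (C := J)).symm H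

end

section Models

variable {κ : Cardinal.{w}} {A : Nest κ} {H : A.carrier ⥤ Type w}

lemma exists_of_preservesLimit {I : Type w} {F : WidePullbackShape I ⥤ A.carrier}
    [PreservesLimit F H] {c : Cone F} (hc : IsLimit c) (z : H.obj (F.obj none))
    (hz : ∀ i, ∃ x, H.map (F.map (WidePullbackShape.Hom.term i)) x = z) :
    ∃ p : H.obj c.pt, H.map (c.π.app none) p = z := by
  choose x hx using hz
  let s : Cone (F ⋙ H) := WidePullbackShape.mkCone (X := PUnit) (↾fun _ => z)
    (fun i => ↾fun _ => x i) (fun i => by ext; exact hx i)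
  refine ⟨(isLimitOfPreserves H hc).lift s PUnit.unit, ?_⟩
  exact ConcreteCategory.congr_hom ((isLimitOfPreserves H hc).fac s none) PUnit.unit

/-- An element of a model lies in a multiple pullback of `M`-morphisms as soon as it lies in all
the factors. -/
lemma IsModel.exists_of_isLimit (hH : IsModel κ A.M H) {I : Type w}
    {F : WidePullbackShape I ⥤ A.carrier} (hF : IsWideCospanIn A.M F) {c : Cone F}
    (hc : IsLimit c) (z : H.obj (F.obj none))
    (hz : ∀ i, ∃ x, H.map (F.map (WidePullbackShape.Hom.term i)) x = z) :
    ∃ p : H.obj c.pt, H.map (c.π.app none) p = z :=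
  haveI := hH.preservesMultiplePullbacks I F hF
  exists_of_preservesLimit hc z hz

variable [Fact κ.IsRegular]

lemma PreservesSmallLimits.map_injective (hH : PreservesSmallLimits κ H) {X Y : A.carrier}
    {m : X ⟶ Y} (hm : A.M m) : Function.Injective (H.map m) := by
  have := hH.preservesFiniteLimits
  have := A.mono hm
  exact (mono_iff_injective (H.map m)).1 inferInstance

/-- A functor which preserves `κ`-small limits is a model if every element that lies in a set of
`M`-subobjects lies in their multiple pullback. -/
lemma isModel_of_exists (hH : PreservesSmallLimits κ H)
    (h : ∀ (Y : A.carrier) (S : Set (Over Y)) (_ : ∀ f ∈ S, A.M f.hom)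
      (c : Cone (WidePullbackShape.wideCospan Y (fun f : S => f.1.left) (fun f => f.1.hom))),
      IsLimit c → ∀ z : H.obj Y, (∀ f ∈ S, ∃ x, H.map f.hom x = z) →
        ∃ p : H.obj c.pt, H.map (c.π.app none) p = z) : IsModel κ A.M H where
  preservesSmallLimits := hH
  preservesMultiplePullbacks I F hF := by
    refine ⟨fun {c} hc => ?_⟩
    have hcM := A.isFactorizationSystem.right_of_isLimit_wideCospan hc hF
    refine (Types.isLimit_iff _).2 fun s hs => ?_
    have hs' (i : I) : H.map (F.map (WidePullbackShape.Hom.term i)) (s (some i)) = s none :=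
      hs (WidePullbackShape.Hom.term i)
    let S : Set (Over (F.obj none)) :=
      Set.range fun i => Over.mk (F.map (WidePullbackShape.Hom.term i))
    have hS : ∀ f ∈ S, A.M f.hom := by
      rintro _ ⟨i, rfl⟩
      exact hF i
    let F' := WidePullbackShape.wideCospan (F.obj none) (fun f : S => f.1.left) (fun f => f.1.hom)
    have := A.isNest.hasMultiplePullbacks S F' (fun f => hS _ f.2)
    obtain ⟨p, hp⟩ := h _ S hS _ (limit.isLimit F') (s none) (by
      rintro _ ⟨i, rfl⟩
      exact ⟨_, hs' i⟩)
    obtain ⟨l, hl⟩ : ∃ l : limit F' ⟶ c.pt, l ≫ c.π.app none = limit.π F' none :=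
      ⟨hc.lift (WidePullbackShape.mkCone (F := F) (limit.π F' none)
        (fun i => limit.π F' (some (⟨_, i, rfl⟩ : S)))
        (fun i => limit.w F' (WidePullbackShape.Hom.term (⟨_, i, rfl⟩ : S)))), hc.fac _ none⟩
    have hl' : H.map (c.π.app none) (H.map l p) = s none := by
      rw [← hp]
      refine Eq.trans ?_ (congrArg (fun t => H.map t p) hl)
      simp
    refine ⟨H.map l p, fun j => ?_, fun y hy => hH.map_injective hcM ?_⟩
    · rcases j with _ | i
      · exact hl'
      · refine hH.map_injective (hF i) ?_
        rw [hs', ← hl']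
        exact ConcreteCategory.congr_hom ((H.mapCone c).w (WidePullbackShape.Hom.term i))
          (H.map l p)
    · exact (hy none).trans hl'.symm

end Models

/-! ### Filtered colimits of models -/

section

variable {κ : Cardinal.{w}} [Fact κ.IsRegular] {A : Type u} [Category.{v} A]

/-- `κ`-filtered colimits of functors to types preserve the `κ`-small limits which are preserved
by all the functors of the diagram. -/
lemma preservesLimit_of_isColimit {J : Type w} [SmallCategory J] [IsCardinalFiltered J κ]
    {F : J ⥤ A ⥤ Type w} {c : Cocone F} (hc : IsColimit c) {J' : Type w} [SmallCategory J']
    (hJ' : HasCardinalLT (Arrow J') κ) (D : J' ⥤ A) (h : ∀ j, PreservesLimit D (F.obj j)) :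
    PreservesLimit D c.pt := by
  refine ⟨fun {l} hl => ?_⟩
  let E : J' ⥤ (A ⥤ Type w) ⥤ Type w := D ⋙ evaluation A (Type w)
  let t (Y : A ⥤ Type w) : IsLimit (((evaluation _ (Type w)).obj Y).mapCone (limit.cone E)) :=
    isLimitOfPreserves _ (limit.isLimit E)
  let α : (evaluation A (Type w)).obj l.pt ⟶ limit E := limit.lift E ((evaluation _ _).mapCone l)
  have hα (Y : A ⥤ Type w) (k : J') :
      α.app Y ≫ (limit.π E k).app Y = Y.map (l.π.app k) := by
    rw [← NatTrans.comp_app, limit.lift_π]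
    rfl
  have hα' (Y : A ⥤ Type w) : α.app Y = (t Y).lift (Y.mapCone l) :=
    (t Y).hom_ext fun k => (hα Y k).trans ((t Y).fac (Y.mapCone l) k).symm
  have h₁ (j : J) : IsIso (α.app (F.obj j)) := by
    have := h j
    let i := (isLimitOfPreserves (F.obj j) hl).conePointUniqueUpToIso (t (F.obj j))
    have hi : α.app (F.obj j) = i.hom := (hα' _).trans
      ((t (F.obj j)).hom_ext fun k => by
        rw [IsLimit.fac, IsLimit.conePointUniqueUpToIso_hom_comp])
    rw [hi]
    infer_instance
  let hG := isColimitOfPreserves ((evaluation A (Type w)).obj l.pt) hc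
  let hG' : IsColimit ((limit E).mapCocone c) :=
    Functor.Accessible.Limits.isColimitMapCocone (limit.cone E) t κ hJ' c
      (fun k => isColimitOfPreserves ((evaluation A (Type w)).obj (D.obj k)) hc)
  let i : F ⋙ (evaluation A (Type w)).obj l.pt ≅ F ⋙ limit E :=
    NatIso.ofComponents (fun j => asIso (α.app (F.obj j))) (fun f => α.naturality _)
  have h₂ : IsIso (α.app c.pt) := by
    have : α.app c.pt = (hG.coconePointsIsoOfNatIso hG' i).hom :=
      hG.hom_ext fun j => by
        rw [IsColimit.comp_coconePointsIsoOfNatIso_hom]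
        exact α.naturality (c.ι.app j)
    rw [this]
    infer_instance
  have : IsIso ((t c.pt).lift (c.pt.mapCone l)) := by
    rw [← hα']
    exact h₂
  exact ⟨IsLimit.ofPointIso (t c.pt)⟩

end

namespace Nest

variable {κ : Cardinal.{w}} {A : Nest κ}

/-- The Yoneda lemma in `Mod_κ(A)`. -/
def modYonedaEquiv {X : A.carrier} {H : A.Mod} :
    (A.modYoneda.obj (op X) ⟶ H) ≃ H.obj.obj X :=
  (ObjectProperty.fullyFaithfulι _).homEquiv.trans coyonedaEquiv

/-- The morphism from a representable functor which corresponds to an element of a model. -/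
def elem (H : A.Mod) {X : A.carrier} (x : H.obj.obj X) : A.modYoneda.obj (op X) ⟶ H :=
  modYonedaEquiv.symm x

variable {H K : A.Mod}

lemma elem_surjective {X : A.carrier} (f : A.modYoneda.obj (op X) ⟶ H) :
    ∃ x, elem H x = f :=
  modYonedaEquiv.symm.surjective f

lemma elem_injective {X : A.carrier} {x x' : H.obj.obj X} (h : elem H x = elem H x') : x = x' :=
  modYonedaEquiv.symm.injective h

lemma elem_hom_app {X Y : A.carrier} (x : H.obj.obj X) (f : X ⟶ Y) :
    (elem H x).hom.app Y f = H.obj.map f x := rfl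

lemma elem_modYonedaEquiv {X : A.carrier} (f : A.modYoneda.obj (op X) ⟶ H) :
    elem H (modYonedaEquiv f) = f := modYonedaEquiv.symm_apply_apply f

lemma modYonedaEquiv_elem {X : A.carrier} (x : H.obj.obj X) :
    modYonedaEquiv (elem H x) = x := modYonedaEquiv.apply_symm_apply x

lemma elem_comp {X : A.carrier} (x : H.obj.obj X) (f : H ⟶ K) :
    elem H x ≫ f = elem K (f.hom.app X x) := by
  apply modYonedaEquiv.injective
  rw [modYonedaEquiv_elem]
  change f.hom.app X (H.obj.map (𝟙 X) x) = _
  simp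

lemma map_elem {X Y : A.carrier} (m : X ⟶ Y) (x : H.obj.obj X) :
    A.modYoneda.map m.op ≫ elem H x = elem H (H.obj.map m x) := by
  apply modYonedaEquiv.injective
  rw [modYonedaEquiv_elem]
  change H.obj.map (m ≫ 𝟙 Y) x = _
  simp

instance : A.modYoneda.Full := by
  unfold modYoneda
  infer_instance

instance : A.modYoneda.Faithful := by
  unfold modYoneda
  infer_instance

lemma modM_of_comp {L : A.Mod} {f : H ⟶ K} {g : K ⟶ L} (hg : A.modM g) (hfg : A.modM (f ≫ g)) :
    A.modM f := fun _ _ m hm => (hg m hm).of_comp_right (hfg m hm)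

lemma modE_map {X Y : A.carrier} {m : X ⟶ Y} (hm : A.M m) :
    A.modE (A.modYoneda.map m.op) := fun _ _ _ hf => hf m hm

variable [Fact κ.IsRegular]

/-- The right class of `Mod_κ(A)` in terms of elements. -/
lemma modM_iff (f : H ⟶ K) :
    A.modM f ↔ ∀ ⦃X Y : A.carrier⦄ (m : X ⟶ Y), A.M m → ∀ (y : H.obj.obj Y) (x : K.obj.obj X),
      f.hom.app Y y = K.obj.map m x → ∃ x', H.obj.map m x' = y ∧ f.hom.app X x' = x := by
  constructor
  · intro h X Y m hm y x hxy
    obtain ⟨d, ⟨hd₁, hd₂⟩, -⟩ := h m hm (elem H y) (elem K x) (by rw [elem_comp, map_elem, hxy])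
    obtain ⟨x', rfl⟩ := elem_surjective d
    rw [map_elem] at hd₁
    rw [elem_comp] at hd₂
    exact ⟨x', elem_injective hd₁, elem_injective hd₂⟩
  · intro h X Y m hm u v huv
    obtain ⟨y, rfl⟩ := elem_surjective u
    obtain ⟨x, rfl⟩ := elem_surjective v
    rw [elem_comp, map_elem] at huv
    obtain ⟨x', rfl, rfl⟩ := h m hm y x (elem_injective huv)
    refine ⟨elem H x', ⟨map_elem m x', elem_comp x' f⟩, fun d hd => ?_⟩
    obtain ⟨x'', rfl⟩ := elem_surjective d
    congr 1
    refine H.property.preservesSmallLimits.map_injective hm (elem_injective ?_)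
    rw [← map_elem, hd.1]

/-! Filtered colimits of `M`-morphisms are computed pointwise. -/

section Colimits

variable {J : Type w} [SmallCategory J] [IsCardinalFiltered J κ] {F : J ⥤ A.Mod}

lemma exists_of_isColimit (hF : IsDiagramIn A.modM F)
    {c : Cocone (F ⋙ ObjectProperty.ι _)} (hc : IsColimit c) (j : J) {X Y : A.carrier}
    {m : X ⟶ Y} (hm : A.M m) (y : (F.obj j).obj.obj Y) (x : c.pt.obj X)
    (h : (c.ι.app j).app Y y = c.pt.map m x) :
    ∃ x', (F.obj j).obj.map m x' = y ∧ (c.ι.app j).app X x' = x := by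
  have := isFiltered_of_isCardinalFiltered J κ
  have hX := isColimitOfPreserves ((evaluation _ _).obj X) hc
  have hY := isColimitOfPreserves ((evaluation _ _).obj Y) hc
  obtain ⟨k, x, rfl⟩ := Types.jointly_surjective_of_isColimit hX x
  have h' : (c.ι.app j).app Y y = (c.ι.app k).app Y ((F.obj k).obj.map m x) :=
    h.trans (ConcreteCategory.congr_hom ((c.ι.app k).naturality m) x).symm
  obtain ⟨l, t, t', ht⟩ := (Types.FilteredColimit.isColimit_eq_iff _ hY).1 h'
  obtain ⟨x', hx', hx''⟩ := (modM_iff (F.map t)).1 (hF t) m hm y ((F.map t').hom.app X x)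
    (ht.trans (ConcreteCategory.congr_hom ((F.map t').hom.naturality m) x))
  refine ⟨x', hx', ?_⟩
  have h₁ := ConcreteCategory.congr_hom (congr_app (c.w t) X) x'
  have h₂ := ConcreteCategory.congr_hom (congr_app (c.w t') X) x
  exact h₁.symm.trans ((congrArg ((c.ι.app l).app X) hx'').trans h₂)

lemma isModel_of_isColimit (hF : IsDiagramIn A.modM F)
    {c : Cocone (F ⋙ ObjectProperty.ι _)} (hc : IsColimit c) : IsModel κ A.M c.pt := by
  refine isModel_of_exists (fun J' _ hJ' => ⟨fun {D} => ?_⟩) fun Y S hS l hl z hz => ?_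
  · refine preservesLimit_of_isColimit hc hJ' D fun j => ?_
    have := (F.obj j).property.preservesSmallLimits J' hJ'
    exact inferInstanceAs (PreservesLimit D (F.obj j).obj)
  · obtain ⟨j, z, rfl⟩ := Types.jointly_surjective_of_isColimit
      (isColimitOfPreserves ((evaluation _ _).obj Y) hc) z
    obtain ⟨p, hp⟩ := (F.obj j).property.exists_of_isLimit (fun f => hS _ f.2) hl z
      (fun f => by
        obtain ⟨x, hx⟩ := hz _ f.2
        obtain ⟨x', hx', -⟩ := exists_of_isColimit hF hc j (hS _ f.2) z x hx.symm
        exact ⟨x', hx'⟩)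
    refine ⟨(c.ι.app j).app _ p, ?_⟩
    rw [← hp]
    exact (ConcreteCategory.congr_hom ((c.ι.app j).naturality (l.π.app none)) p).symm

lemma hasColimit_and_preservesColimit (hF : IsDiagramIn A.modM F) :
    HasColimit F ∧
      PreservesColimit F (ObjectProperty.ι (fun H : A.carrier ⥤ Type w => IsModel κ A.M H)) :=
  hasColimit_and_preservesColimit_of_fullyFaithful (ObjectProperty.ι _) F
    (colimit.isColimit _) ⟨⟨_, isModel_of_isColimit hF (colimit.isColimit _)⟩, ⟨Iso.refl _⟩⟩

/-- A colimit cocone of a filtered diagram of `M`-morphisms is a pointwise colimit. -/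
def isColimitMapιOfModM (hF : IsDiagramIn A.modM F) {c : Cocone F} (hc : IsColimit c) :
    IsColimit ((ObjectProperty.ι _).mapCocone c) :=
  haveI := (hasColimit_and_preservesColimit hF).2
  isColimitOfPreserves _ hc

lemma modM_ι (hF : IsDiagramIn A.modM F) {c : Cocone F} (hc : IsColimit c) (j : J) :
    A.modM (c.ι.app j) :=
  (modM_iff _).2 fun _ _ _ hm y x h =>
    exists_of_isColimit hF (isColimitMapιOfModM hF hc) j hm y x h

lemma modM_desc (hF : IsDiagramIn A.modM F) {c : Cocone F} (hc : IsColimit c)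
    (f : c.pt ⟶ H) (hf : ∀ j, A.modM (c.ι.app j ≫ f)) : A.modM f := by
  refine (modM_iff _).2 fun X Y m hm y x h => ?_
  obtain ⟨j, y, rfl⟩ := Types.jointly_surjective_of_isColimit
    (isColimitOfPreserves ((evaluation _ _).obj Y) (isColimitMapιOfModM hF hc)) y
  obtain ⟨x', rfl, rfl⟩ := (modM_iff _).1 (hf j) m hm y x h
  exact ⟨(c.ι.app j).hom.app X x',
    (ConcreteCategory.congr_hom ((c.ι.app j).hom.naturality m) x').symm, rfl⟩

lemma preservesColimit_coyoneda_modYoneda (hF : IsDiagramIn A.modM F) (X : A.carrier) :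
    PreservesColimit F (coyoneda.obj (op (A.modYoneda.obj (op X)))) := by
  have := (hasColimit_and_preservesColimit hF).2
  let e : (ObjectProperty.ι (fun H : A.carrier ⥤ Type w => IsModel κ A.M H)) ⋙
      (evaluation _ _).obj X ≅ coyoneda.obj (op (A.modYoneda.obj (op X))) :=
    NatIso.ofComponents (fun H => modYonedaEquiv.symm.toIso) (fun f => by
      ext x
      exact (elem_comp x f).symm)
  exact preservesColimit_of_natIso F e

end Colimits

lemma isGenerated_modYoneda (X : A.carrier) :
    IsGenerated κ A.modM (A.modYoneda.obj (op X)) := fun _ _ _ _ hF =>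
  preservesColimit_coyoneda_modYoneda hF X

/-! Every element of a model factors through an `M`-subobject of the model. -/

lemma exists_minimal (H : A.Mod) {X : A.carrier} (x : H.obj.obj X) :
    ∃ (Q : A.carrier) (q : Q ⟶ X) (p : H.obj.obj Q), A.M q ∧ H.obj.map q p = x ∧
      A.modM (elem H p) := by
  have hH := H.property.preservesSmallLimits
  have := hH.preservesFiniteLimits
  obtain ⟨Q, q, hq, ⟨p, hp⟩, hproj⟩ : ∃ (Q : A.carrier) (q : Q ⟶ X), A.M q ∧
      (∃ p, H.obj.map q p = x) ∧ ∀ ⦃Y : A.carrier⦄ (f : Y ⟶ X), A.M f →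
        (∃ y, H.obj.map f y = x) → ∃ π : Q ⟶ Y, π ≫ f = q := by
    let S : Set (Over X) := {f | A.M f.hom ∧ ∃ y, H.obj.map f.hom y = x}
    let F := WidePullbackShape.wideCospan X (fun f : S => f.1.left) (fun f => f.1.hom)
    have hF : IsWideCospanIn A.M F := fun f => f.2.1
    have := A.isNest.hasMultiplePullbacks S F hF
    exact ⟨limit F, limit.π F none,
      A.isFactorizationSystem.right_of_isLimit_wideCospan (limit.isLimit F) hF,
      H.property.exists_of_isLimit hF (limit.isLimit F) x (fun f => f.2.2),
      fun Y f hf hy => ⟨limit.π F (some (⟨Over.mk f, hf, hy⟩ : S)),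
        limit.w F (WidePullbackShape.Hom.term _)⟩⟩
  have := A.mono hq
  refine ⟨Q, q, p, hq, hp, (modM_iff _).2 fun U V n hn (g : Q ⟶ V) u hgu => ?_⟩
  have sq := IsPullback.of_hasPullback g n
  obtain ⟨u', hu₁, hu₂⟩ := Types.exists_of_isPullback (sq.map H.obj) p u hgu
  have hM := A.isFactorizationSystem.right_of_isPullback sq hn
  obtain ⟨π, hπ⟩ := hproj (pullback.fst g n ≫ q) (A.isFactorizationSystem.right_comp hM hq)
    ⟨u', by rw [Functor.map_comp_apply, hu₁, hp]⟩
  have hπ' : π ≫ pullback.fst g n = 𝟙 _ := by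
    rw [← cancel_mono q, Category.assoc, hπ, Category.id_comp]
  have hd : (π ≫ pullback.snd g n) ≫ n = g := by
    rw [Category.assoc, ← pullback.condition, reassoc_of% hπ']
  refine ⟨π ≫ pullback.snd g n, hd, hH.map_injective hn ?_⟩
  rw [← hgu, elem_hom_app, elem_hom_app, ← Functor.map_comp_apply, hd]

end Nest

/-! ### Cocompleteness of the category of models -/

section Reflection

variable {A : Type w} [SmallCategory A]

/-- The comparison morphism from the colimit of the representable functors given by a diagram to
the functor represented by the vertex of a cone. -/
def coyonedaComparison {J : Type w} [SmallCategory J] {D : J ⥤ A} (l : Cone D) :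
    colimit (D.op ⋙ coyoneda) ⟶ coyoneda.obj (op l.pt) :=
  colimit.desc (D.op ⋙ coyoneda) (coyoneda.mapCocone l.op)

lemma ι_coyonedaComparison {J : Type w} [SmallCategory J] {D : J ⥤ A} (l : Cone D) (j : Jᵒᵖ) :
    colimit.ι (D.op ⋙ coyoneda) j ≫ coyonedaComparison l =
      coyoneda.map (l.π.app j.unop).op :=
  colimit.ι_desc _ _

/-- The compatible family of elements given by a morphism out of a colimit of representable
functors. -/
def colimitCoyonedaSection {J : Type w} [SmallCategory J] (D : J ⥤ A) {H : A ⥤ Type w}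
    (f : colimit (D.op ⋙ coyoneda) ⟶ H) : (D ⋙ H).sections where
  val j := coyonedaEquiv (X := D.obj j) (colimit.ι (D.op ⋙ coyoneda) (op j) ≫ f)
  property {j k} g :=
    (coyonedaEquiv_naturality (X := D.obj j) (colimit.ι (D.op ⋙ coyoneda) (op j) ≫ f)
      (D.map g)).trans (congrArg (coyonedaEquiv (X := D.obj k))
        (colimit.w_assoc (D.op ⋙ coyoneda) g.op f))

lemma bijective_colimitCoyonedaSection {J : Type w} [SmallCategory J] (D : J ⥤ A)
    (H : A ⥤ Type w) : Function.Bijective (colimitCoyonedaSection D (H := H)) := by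
  constructor
  · intro f g h
    refine colimit.hom_ext fun j => (coyonedaEquiv (X := D.obj j.unop)).injective ?_
    exact congrFun (congrArg Subtype.val h) j.unop
  · intro s
    let c : Cocone (D.op ⋙ coyoneda) :=
      { pt := H
        ι :=
          { app := fun j => (coyonedaEquiv (X := D.obj j.unop)).symm (s.1 j.unop)
            naturality := fun j k g => by
              have h : H.map (D.map g.unop) (s.1 k.unop) = s.1 j.unop := s.2 g.unop
              have h' := coyonedaEquiv_symm_map (D.map g.unop) (s.1 k.unop)
              rw [h] at h'
              exact h'.symm.trans (Category.comp_id _).symm } }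
    refine ⟨colimit.desc (D.op ⋙ coyoneda) c, Subtype.ext (funext fun j => ?_)⟩
    exact (congrArg (coyonedaEquiv (X := D.obj j)) (colimit.ι_desc c (op j))).trans
      ((coyonedaEquiv (X := D.obj j)).apply_symm_apply _)

lemma bijective_coyonedaComparison_comp_iff {J : Type w} [SmallCategory J] {D : J ⥤ A}
    (l : Cone D) (H : A ⥤ Type w) :
    Function.Bijective (fun g : coyoneda.obj (op l.pt) ⟶ H => coyonedaComparison l ≫ g) ↔
      Nonempty (IsLimit (H.mapCone l)) := by
  rw [Types.isLimit_iff_bijective_sectionOfCone,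
    ← Function.Bijective.of_comp_iff' (bijective_colimitCoyonedaSection D H),
    ← Function.Bijective.of_comp_iff (Types.sectionOfCone (H.mapCone l)) coyonedaEquiv.bijective]
  convert Iff.rfl using 2
  ext g j
  have h : colimit.ι (D.op ⋙ coyoneda) (op j) ≫ coyonedaComparison l ≫ g =
      coyoneda.map (l.π.app j).op ≫ g := by
    rw [← Category.assoc, ι_coyonedaComparison]
  exact ((congrArg (coyonedaEquiv (X := D.obj j)) h).trans
    (coyonedaEquiv_naturality g (l.π.app j)).symm).symm

lemma coyonedaEquiv_symm_comp {X : A} {H K : A ⥤ Type w} (x : H.obj X) (f : H ⟶ K) :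
    coyonedaEquiv.symm x ≫ f = coyonedaEquiv.symm (f.app X x) := by
  apply coyonedaEquiv.injective
  rw [coyonedaEquiv_comp, Equiv.apply_symm_apply, Equiv.apply_symm_apply]

instance isCardinalPresentable_coyoneda (κ : Cardinal.{w}) [Fact κ.IsRegular] (X : A) :
    IsCardinalPresentable (coyoneda.obj (op X)) κ where
  preservesColimitOfShape J _ _ := by
    let e : (evaluation A (Type w)).obj X ≅
        coyoneda.obj (op (coyoneda.obj (op X))) :=
      NatIso.ofComponents (fun H => (coyonedaEquiv (X := X) (F := H)).symm.toIso) (fun f => by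
        ext x
        exact (coyonedaEquiv_symm_comp x f).symm)
    exact preservesColimitsOfShape_of_natIso e

/-- The functors which send a small family of cones to limit cones form a reflective
subcategory. -/
lemma isRightAdjoint_ι_of_iff {I : Type w} {J : I → Type w} [∀ i, SmallCategory (J i)]
    {D : ∀ i, J i ⥤ A} (l : ∀ i, Cone (D i)) {P : ObjectProperty (A ⥤ Type w)}
    (hP : ∀ H, P H ↔ ∀ i, Nonempty (IsLimit (H.mapCone (l i)))) : P.ι.IsRightAdjoint := by
  let W : MorphismProperty (A ⥤ Type w) :=
    MorphismProperty.ofHoms (fun i => coyonedaComparison (l i))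
  obtain rfl : P = W.isLocal := by
    ext H
    rw [hP]
    constructor
    · rintro h _ _ _ ⟨i⟩
      exact (bijective_coyonedaComparison_comp_iff _ _).2 (h i)
    · exact fun h i => (bijective_coyonedaComparison_comp_iff _ _).1 (h _ ⟨i⟩)
  obtain ⟨κ, hκ, h⟩ := HasCardinalLT.exists_regular_cardinal_forall.{w}
    (fun i => Arrow (J i)ᵒᵖ)
  have : Fact κ.IsRegular := ⟨hκ⟩
  refine W.isRightAdjoint_ι_isLocal κ ?_
  rintro _ _ _ ⟨i⟩
  have (k : (J i)ᵒᵖ) : IsCardinalPresentable (((D i).op ⋙ coyoneda).obj k) κ :=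
    isCardinalPresentable_coyoneda κ _
  exact ⟨isCardinalPresentable_of_isColimit' _ (colimit.isColimit _) κ (h i), inferInstance⟩

end Reflection

namespace Nest

variable {κ : Cardinal.{w}} [Fact κ.IsRegular] (A : Nest κ)

instance isRightAdjoint_ι :
    (ObjectProperty.ι (fun H : A.carrier ⥤ Type w => IsModel κ A.M H)).IsRightAdjoint := by
  let I₁ : Type w := Σ S : SmallCategoryCardinalLT κ,
    SmallCategoryCardinalLT.categoryFamily κ S ⥤ A.carrier
  let I₂ : Type w := { p : Σ Y : A.carrier, Set (Over Y) // ∀ f ∈ p.2, A.M f.hom }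
  have h₁ (i : I₁) : HasLimit i.2 :=
    have := A.isNest.hasSmallLimits _ i.1.hasCardinalLT
    inferInstance
  let D₂ (i : I₂) := WidePullbackShape.wideCospan i.1.1
    (fun f : i.1.2 => f.1.left) (fun f => f.1.hom)
  have hD₂ (i : I₂) : IsWideCospanIn A.M (D₂ i) := fun f => i.2 f.1 f.2
  have h₂ (i : I₂) : HasLimit (D₂ i) :=
    A.isNest.hasMultiplePullbacks _ (D₂ i) (hD₂ i)
  let J : I₁ ⊕ I₂ → Type w :=
    Sum.elim (fun i => SmallCategoryCardinalLT.categoryFamily κ i.1)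
      (fun i => WidePullbackShape i.1.2)
  let (i : I₁ ⊕ I₂) : SmallCategory (J i) := match i with
    | .inl i => inferInstanceAs (SmallCategory (SmallCategoryCardinalLT.categoryFamily κ i.1))
    | .inr i => inferInstanceAs (SmallCategory (WidePullbackShape i.1.2))
  let D (i : I₁ ⊕ I₂) : J i ⥤ A.carrier := match i with
    | .inl i => i.2
    | .inr i => D₂ i
  let l (i : I₁ ⊕ I₂) : Cone (D i) := match i with
    | .inl i => limit.cone i.2
    | .inr i => limit.cone (D₂ i)
  refine isRightAdjoint_ι_of_iff (D := D) l fun H => ⟨fun hH i => ?_, fun hH => ?_⟩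
  · rcases i with i | i
    · have := hH.preservesSmallLimits _ i.1.hasCardinalLT
      have : PreservesLimit i.2 H := inferInstance
      exact this.preserves (limit.isLimit i.2)
    · have := hH.preservesMultiplePullbacks _ (D₂ i) (hD₂ i)
      exact this.preserves (limit.isLimit (D₂ i))
  · refine isModel_of_exists (fun J' _ hJ' => ?_) fun Y S hS c hc z hz => ?_
    · obtain ⟨S, ⟨e⟩⟩ := SmallCategoryCardinalLT.exists_equivalence κ J' hJ'
      have : PreservesLimitsOfShape (SmallCategoryCardinalLT.categoryFamily κ S) H := ⟨fun {F} =>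
        have : HasLimit F := h₁ ⟨S, F⟩
        preservesLimit_of_preserves_limit_cone (limit.isLimit F) (hH (.inl ⟨S, F⟩)).some⟩
      exact preservesLimitsOfShape_of_equiv e H
    · have := preservesLimit_of_preserves_limit_cone (limit.isLimit (D₂ ⟨⟨Y, S⟩, hS⟩))
        (hH (.inr ⟨⟨Y, S⟩, hS⟩)).some
      exact exists_of_preservesLimit hc z (fun f => hz _ f.2)

instance : Reflective (ObjectProperty.ι (fun H : A.carrier ⥤ Type w => IsModel κ A.M H)) where
  L := _
  adj := Adjunction.ofIsRightAdjoint _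

instance : HasColimitsOfSize.{w, w} A.Mod :=
  hasColimits_of_reflective (ObjectProperty.ι (fun H : A.carrier ⥤ Type w => IsModel κ A.M H))

variable {A} {B : Nest κ}

lemma isLocGenMorphism_modMap (F : A ⟶ B) : IsLocGenMorphism κ B.modM A.modM (modMap F) where
  isRightAdjoint := by
    let R := ObjectProperty.ι (fun H : B.carrier ⥤ Type w => IsModel κ B.M H) ⋙
      (Functor.whiskeringLeft _ _ (Type w)).obj F.functor
    have : ((Functor.whiskeringLeft _ _ (Type w)).obj F.functor).IsRightAdjoint :=
      (F.functor.lanAdjunction (Type w)).isRightAdjoint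
    have : R.IsRightAdjoint := inferInstance
    exact ((Adjunction.ofIsRightAdjoint R).restrictFullyFaithful
      (ObjectProperty.fullyFaithfulι (fun H : A.carrier ⥤ Type w => IsModel κ A.M H))
      (.id _) (L := ObjectProperty.ι _ ⋙ R.leftAdjoint) (R := modMap F) (Iso.refl _)
      (Iso.refl _)).isRightAdjoint
  map_mem X Y f hf := (modM_iff _).2 fun _ _ m hm y x h =>
    (modM_iff _).1 hf (F.functor.map m) (F.isNestMorphism.map_mem m hm) y x h
  preserves J _ _ D hD := by
    have := (hasColimit_and_preservesColimit hD).2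
    have : PreservesColimit D (modMap F ⋙
        ObjectProperty.ι (fun H : A.carrier ⥤ Type w => IsModel κ A.M H)) :=
      inferInstanceAs (PreservesColimit D
        (ObjectProperty.ι (fun H : B.carrier ⥤ Type w => IsModel κ B.M H) ⋙
          (Functor.whiskeringLeft _ _ (Type w)).obj F.functor))
    exact preservesColimit_of_reflects_of_preserves _
      (ObjectProperty.ι (fun H : A.carrier ⥤ Type w => IsModel κ A.M H))

end Nest

/-! ### The category of models is locally generated -/

namespace Nest

section

variable {κ : Cardinal.{w}} {A : Nest κ}

/-- The cocone of the representable functors over a model. -/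
def elemCocone (H : A.Mod) : Cocone ((CategoryOfElements.π H.obj).op ⋙ A.modYoneda) where
  pt := H
  ι :=
    { app := fun e => elem H e.unop.2
      naturality := fun _ e' g =>
        (map_elem g.unop.val e'.unop.2).trans
          ((congrArg (elem H) g.unop.property).trans (Category.comp_id _).symm) }

/-- The components of the morphism out of a model which is induced by a cocone of representable
functors. -/
def elemDesc {H : A.Mod} (s : Cocone ((CategoryOfElements.π H.obj).op ⋙ A.modYoneda)) :
    H ⟶ s.pt :=
  ObjectProperty.homMk
    { app := fun X => ↾fun x => modYonedaEquiv (s.ι.app (op ⟨X, x⟩))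
      naturality := fun X Y f => by
        ext x
        let a : H.obj.Elements := ⟨X, x⟩
        let b : H.obj.Elements := ⟨Y, H.obj.map f x⟩
        let g : a ⟶ b := ⟨f, rfl⟩
        have h : A.modYoneda.map f.op ≫ elem s.pt (modYonedaEquiv (s.ι.app (op a))) =
            elem s.pt (modYonedaEquiv (s.ι.app (op b))) :=
          (congrArg (A.modYoneda.map f.op ≫ ·) (elem_modYonedaEquiv _)).trans
            ((s.w g.op).trans (elem_modYonedaEquiv _).symm)
        rw [map_elem] at h
        exact (elem_injective h).symm }

/-- Every model is a colimit of representable functors. -/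
def isColimitElemCocone (H : A.Mod) : IsColimit (elemCocone H) where
  desc s := elemDesc s
  fac s e := (elem_comp e.unop.2 (elemDesc s)).trans (elem_modYonedaEquiv _)
  uniq s m hm := by
    apply ObjectProperty.hom_ext
    ext X x
    apply elem_injective
    refine (elem_comp x m).symm.trans ((hm (op ⟨X, x⟩)).trans ?_)
    exact (elem_modYonedaEquiv _).symm

end

variable {κ : Cardinal.{w}} [Fact κ.IsRegular] {A : Nest κ}

instance isCardinalFiltered_elements (H : A.Mod) : IsCardinalFiltered (H.obj.Elementsᵒᵖ) κ where
  nonempty_cocone {J _} F hJ := by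
    have hJ' : HasCardinalLT (Arrow Jᵒᵖ) κ := by rwa [hasCardinalLT_arrow_op_iff]
    have := A.isNest.hasSmallLimits Jᵒᵖ hJ'
    have := H.property.preservesSmallLimits Jᵒᵖ hJ'
    have : HasColimitsOfShape J (H.obj.Elementsᵒᵖ) := hasColimitsOfShape_op_of_hasLimitsOfShape
    exact ⟨colimit.cocone F⟩

/-- The elements which are `M`-subobjects of a model. -/
def minimalElements (H : A.Mod) : ObjectProperty (H.obj.Elementsᵒᵖ) :=
  fun e => A.modM (elem H e.unop.2)

lemma exists_hom_minimalElements {H : A.Mod} (e : H.obj.Elementsᵒᵖ) :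
    ∃ e' : (minimalElements H).FullSubcategory, Nonempty (e ⟶ e'.obj) := by
  obtain ⟨Q, q, p, _, hqp, hp⟩ := exists_minimal H e.unop.2
  let a : H.obj.Elements := ⟨Q, p⟩
  let g : a ⟶ e.unop := ⟨q, hqp⟩
  exact ⟨⟨op a, hp⟩, ⟨g.op⟩⟩

instance isCardinalFiltered_minimalElements (H : A.Mod) :
    IsCardinalFiltered (minimalElements H).FullSubcategory κ where
  nonempty_cocone F hJ := by
    let c := IsCardinalFiltered.cocone (F ⋙ (minimalElements H).ι) hJ
    obtain ⟨e', ⟨g⟩⟩ := exists_hom_minimalElements c.pt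
    exact ⟨{
      pt := e'
      ι :=
        { app := fun j => ObjectProperty.homMk (c.ι.app j ≫ g)
          naturality := fun i j f => ObjectProperty.hom_ext _
            ((c.w_assoc f g).trans (Category.comp_id _).symm) } }⟩

instance final_minimalElements_ι (H : A.Mod) : (minimalElements H).ι.Final := by
  have := isFiltered_of_isCardinalFiltered (H.obj.Elementsᵒᵖ) κ
  exact Functor.final_of_exists_of_isFiltered_of_fullyFaithful _ exists_hom_minimalElements

lemma exists_directed_colimit (H : A.Mod) :
    ∃ (J : Type w) (_ : PartialOrder J) (_ : IsCardinalFiltered J κ) (G : J ⥤ A.carrierᵒᵖ)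
      (s : G ⋙ A.modYoneda ⟶ (Functor.const J).obj H),
        IsDiagramIn A.modM (G ⋙ A.modYoneda) ∧ Nonempty (IsColimit (Cocone.mk H s)) := by
  obtain ⟨J, _, _, G, _⟩ :=
    IsCardinalFiltered.exists_cardinal_directed (minimalElements H).FullSubcategory κ
  let c := (elemCocone H).whisker (G ⋙ (minimalElements H).ι)
  have hc : IsColimit c :=
    (Functor.Final.isColimitWhiskerEquiv (G ⋙ (minimalElements H).ι) _).symm
      (isColimitElemCocone H)
  refine ⟨J, _, inferInstance, G ⋙ (minimalElements H).ι ⋙ (CategoryOfElements.π H.obj).op, c.ι,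
    fun i j f => ?_, ⟨hc⟩⟩
  refine modM_of_comp (g := c.ι.app j) (G.obj j).property ?_
  have h : A.modM (c.ι.app i) := (G.obj i).property
  rwa [← c.w f] at h

/-! The factorization system. -/

section

variable (H : A.Mod) (Φ : H.obj.Elements ⥤ A.carrier) (τ : Φ ⟶ CategoryOfElements.π H.obj)

/-- The quotient of a model which is given by subobjects of the domains of its elements. -/
def quotient : A.Mod := colimit (Φ.op ⋙ A.modYoneda)

/-- The projection to the quotient. -/
def quotientMap : H ⟶ quotient H Φ :=
  (isColimitElemCocone H).desc ((Cocone.precompose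
    (Functor.whiskerRight (NatTrans.op τ) A.modYoneda)).obj (colimit.cocone (Φ.op ⋙ A.modYoneda)))

lemma elem_quotientMap (e : H.obj.Elementsᵒᵖ) :
    elem H e.unop.2 ≫ quotientMap H Φ τ =
      A.modYoneda.map (τ.app e.unop).op ≫ colimit.ι (Φ.op ⋙ A.modYoneda) e :=
  (isColimitElemCocone H).fac _ e

variable {τ} in
lemma modE_quotientMap (hτ : ∀ e, A.M (τ.app e)) : A.modE (quotientMap H Φ τ) :=
  fun _ _ _ hm => Orthogonal.of_isColimit
    (Functor.whiskerRight (NatTrans.op τ) A.modYoneda) (isColimitElemCocone H)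
    (colimit.isColimit (Φ.op ⋙ A.modYoneda)) (quotientMap H Φ τ) (elem_quotientMap H Φ τ)
    (fun e => hm (τ.app e.unop) (hτ e.unop))

end

lemma exists_quotient_factorization {H K : A.Mod} (f : H ⟶ K) :
    ∃ (Φ : H.obj.Elements ⥤ A.carrier) (τ : Φ ⟶ CategoryOfElements.π H.obj)
      (m : quotient H Φ ⟶ K), A.modE (quotientMap H Φ τ) ∧ A.modM m ∧
        quotientMap H Φ τ ≫ m = f := by
  choose Q q p hq hqp hp using
    fun e : H.obj.Elements => exists_minimal K (f.hom.app e.1 e.2)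
  have hmono (e) := A.mono (hq e)
  have hex {e e' : H.obj.Elements} (g : e ⟶ e') : ∃ h : Q e ⟶ Q e',
      h ≫ q e' = q e ≫ g.val ∧ K.obj.map h (p e) = p e' := by
    refine (modM_iff _).1 (hp e) (q e') (hq e') (q e ≫ g.val) (p e') ?_
    rw [elem_hom_app, hqp, Functor.map_comp_apply, hqp]
    exact ((congrArg (f.hom.app e'.1) g.property).symm.trans
      (ConcreteCategory.congr_hom (f.hom.naturality g.val) e.2)).symm
  choose h hh hh' using @hex
  let Φ : H.obj.Elements ⥤ A.carrier :=
    { obj := Q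
      map := h
      map_id := fun e => by
        rw [← cancel_mono (q e), hh]
        simp
      map_comp := fun {e₁ e₂ e₃} g g' => by
        rw [← cancel_mono (q e₃), hh, Category.assoc, hh, reassoc_of% hh g]
        simp }
  let τ : Φ ⟶ CategoryOfElements.π H.obj := { app := q, naturality := fun _ _ g => hh g }
  let c : Cocone (Φ.op ⋙ A.modYoneda) :=
    { pt := K
      ι :=
        { app := fun e => elem K (p e.unop)
          naturality := fun e e' g =>
            (map_elem _ _).trans ((congrArg (elem K) (hh' g.unop)).trans
              (Category.comp_id _).symm) } }
  let m : quotient H Φ ⟶ K := colimit.desc _ c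
  have hm (e) : colimit.ι (Φ.op ⋙ A.modYoneda) e ≫ m = elem K (p e.unop) := colimit.ι_desc c e
  refine ⟨Φ, τ, m, modE_quotientMap H Φ hq, ?_, ?_⟩
  · have hΦ : IsDiagramIn A.modM (Φ.op ⋙ A.modYoneda) := fun e e' g =>
      modM_of_comp (g := c.ι.app e') (hp e'.unop) (by
        rw [c.w g]
        exact hp e.unop)
    refine modM_desc hΦ (colimit.isColimit _) m fun e => ?_
    have := hm e
    exact this ▸ hp e.unop
  · refine (isColimitElemCocone H).hom_ext fun e => ?_
    have h₁ := congrArg (· ≫ m) (elem_quotientMap H Φ τ e)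
    refine (Category.assoc _ _ _).symm.trans (h₁.trans ((Category.assoc _ _ _).trans
      ((congrArg _ (hm e)).trans ((map_elem (q e.unop) (p e.unop)).trans
        ((congrArg (elem K) (hqp e.unop)).trans (elem_comp _ f).symm)))))

variable (A) in
lemma isFactorizationSystem_mod : IsFactorizationSystem A.modE A.modM where
  left_eq := rfl
  right_eq := by
    ext H K f
    exact ⟨fun hf _ _ e he => he f hf, fun hf _ _ m hm => hf _ (modE_map hm)⟩
  exists_factorization H K f := by
    obtain ⟨Φ, τ, m, he, hm, hf⟩ := exists_quotient_factorization f
    exact ⟨_, _, m, he, hm, hf⟩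

lemma essentiallySmall_quotients (H : A.Mod) :
    ObjectProperty.EssentiallySmall.{w} (fun q : Under H => A.modE q.hom) where
  exists_small_le' := by
    let ι := Σ Φ : H.obj.Elements ⥤ A.carrier, Φ ⟶ CategoryOfElements.π H.obj
    refine ⟨ObjectProperty.ofObj (fun i : ι => Under.mk (quotientMap H i.1 i.2)),
      inferInstance, fun q hq => ?_⟩
    obtain ⟨Φ, τ, m, he, hm, hf⟩ := exists_quotient_factorization q.hom
    have : IsIso m := A.isFactorizationSystem_mod.isIso
      (A.isFactorizationSystem_mod.left_of_comp he (by rwa [hf])) hm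
    exact ⟨_, .mk (⟨Φ, τ⟩ : ι), ⟨(Under.isoMk (asIso m) hf).symm⟩⟩

variable (A) in
lemma isConvenient_mod : IsConvenient κ A.modE A.modM where
  isFactorizationSystem := A.isFactorizationSystem_mod
  cowellpowered := essentiallySmall_quotients
  ι_mem _ _ _ _ hF _ hc := modM_ι hF hc
  desc_mem _ _ _ _ hF _ hc s hs := modM_desc hF hc (hc.desc s) fun j => by
    rw [hc.fac]
    exact hs j

variable (A) in
lemma isLocallyGenerated_mod : IsLocallyGenerated κ A.modE A.modM where
  cocomplete := inferInstance
  isConvenient := A.isConvenient_mod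
  exists_generators := ⟨ObjectProperty.ofObj A.modYoneda.obj, inferInstance, by
    rintro _ ⟨X⟩
    exact isGenerated_modYoneda X.unop, fun H => by
    obtain ⟨J, _, _, G, s, hG, ⟨hs⟩⟩ := exists_directed_colimit H
    exact ⟨J, _, inferInstance, _, _, hG, fun j => .mk _, ⟨hs⟩, ⟨Iso.refl _⟩⟩⟩

end Nest

lemma modWellDefined (κ : Cardinal.{w}) [Fact κ.IsRegular] : ModWellDefined κ where
  isLocallyGenerated A := A.isLocallyGenerated_mod
  isLocGenMorphism F := Nest.isLocGenMorphism_modMap F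

/-! ### Locally generated categories as categories of models -/

lemma Nest.modM_map_iff {κ : Cardinal.{w}} [Fact κ.IsRegular] (A : Nest κ) {X Y : A.carrier}
    (e : X ⟶ Y) : A.modM (A.modYoneda.map e.op) ↔ A.E e := by
  refine ⟨fun h => ?_, fun h => ?_⟩
  · refine A.isFactorizationSystem.left_of_orthogonal fun U V m hm => ?_
    exact (orthogonal_op_iff e m).1 (Orthogonal.of_map (h m hm))
  · refine (modM_iff _).2 fun U V m hm y x hxy => ?_
    obtain ⟨d, ⟨h₁, h₂⟩, -⟩ := A.isFactorizationSystem.orthogonal h hm x y hxy.symm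
    exact ⟨d, h₂, h₁⟩

namespace LocGenCat

variable {κ : Cardinal.{w}} [Fact κ.IsRegular] (K : LocGenCat κ)

/-- The nest `Gen_κ(K)ᵒᵖ`. -/
abbrev genNest : Nest κ where
  carrier := K.SmallGenᵒᵖ
  E := K.genE
  M := K.genM
  isNest := K.isNest_gen

variable {K} in
lemma exists_incl_colimit (X : K.carrier) :
    ∃ (J : Type w) (_ : PartialOrder J) (_ : IsCardinalFiltered J κ) (G : J ⥤ K.SmallGen)
      (s : G ⋙ K.incl ⟶ (Functor.const J).obj X),
        IsDiagramIn K.M (G ⋙ K.incl) ∧ Nonempty (IsColimit (Cocone.mk X s)) := by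
  obtain ⟨S, -, hS, h⟩ := K.isLocallyGenerated.exists_generators
  obtain ⟨J, _, _, F, c, hF, hFS, ⟨hc⟩, ⟨i⟩⟩ := h X
  have hF' (j) : K.incl.essImage (F.obj j) := (K.essImage_incl_iff _).2 (hS _ (hFS j))
  let φ := Functor.essImage.liftFunctorCompIso F K.incl hF'
  let c' := (Cocone.precompose φ.hom).obj c
  have hc' : IsColimit c' := (IsColimit.precomposeHomEquiv φ c).symm hc
  refine ⟨J, _, inferInstance, Functor.essImage.liftFunctor F K.incl hF', (c'.extend i.hom).ι,
    fun j k f => ?_, ⟨IsColimit.extendIso (s := c') i.hom hc'⟩⟩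
  refine K.isFactorizationSystem.right_of_arrow_iso (φ.hom.app j) (φ.inv.app k) ?_ (hF f)
  rw [← φ.hom.naturality_assoc, Iso.hom_inv_id_app, Category.comp_id]

variable {K} in
/-- The generated objects are jointly epimorphic. -/
lemma hom_ext_of_incl {X Y : K.carrier} {f g : X ⟶ Y}
    (h : ∀ (A : K.SmallGen) (a : K.incl.obj A ⟶ X), a ≫ f = a ≫ g) : f = g := by
  obtain ⟨J, _, _, G, s, -, ⟨hs⟩⟩ := exists_incl_colimit X
  exact hs.hom_ext fun j => h _ (s.app j)

variable {K} in
/-- The right class of `K` is determined by the generated objects. -/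
lemma M_of_exists {X Y : K.carrier} (f : X ⟶ Y)
    (h : ∀ ⦃A B : K.SmallGen⦄ (e : A ⟶ B), K.E (K.incl.map e) →
      ∀ (a : K.incl.obj A ⟶ X) (b : K.incl.obj B ⟶ Y), a ≫ f = K.incl.map e ≫ b →
        ∃ d : K.incl.obj B ⟶ X, K.incl.map e ≫ d = a ∧ d ≫ f = b) : K.M f := by
  have hK := K.isLocallyGenerated.isConvenient
  have hfs := K.isFactorizationSystem
  obtain ⟨J, _, _, G, s, hG, ⟨hs⟩⟩ := exists_incl_colimit X
  suffices ∀ j, K.M (s.app j ≫ f) by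
    have := hK.desc_mem J _ hG _ hs ((Cocone.mk X s).extend f) this
    rwa [show hs.desc ((Cocone.mk X s).extend f) = f from
      (hs.uniq ((Cocone.mk X s).extend f) f (fun j => rfl)).symm] at this
  intro j
  obtain ⟨a, ha⟩ : ∃ a : K.incl.obj (G.obj j) ⟶ X, s.app j = a := ⟨_, rfl⟩
  have haM : K.M a := ha ▸ hK.ι_mem J _ hG _ hs j
  have goal : K.M (a ≫ f) := by
    obtain ⟨Z, e, m, he, hm, hem⟩ := hfs.exists_factorization (a ≫ f)
    obtain ⟨B, ⟨i⟩⟩ := (K.essImage_incl_iff Z).2 ((K.isGenerated_incl_obj _).of_left hK he)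
    obtain ⟨e', he'⟩ := K.incl.map_surjective (e ≫ i.inv)
    obtain ⟨d, hd₁, hd₂⟩ := h e' (he' ▸ hfs.left_comp he (hfs.left_of_isIso _)) a (i.hom ≫ m)
      (by simp [he', hem])
    obtain ⟨t, ⟨ht₁, ht₂⟩, -⟩ := hfs.orthogonal he haM (𝟙 _) (i.inv ≫ d)
      (by rw [Category.id_comp, ← hd₁, he', Category.assoc])
    have ht₃ : t ≫ e = 𝟙 _ := (hfs.orthogonal he hm).hom_ext
      (by rw [reassoc_of% ht₁, Category.comp_id])
      (by rw [Category.assoc, hem, reassoc_of% ht₂, hd₂, Category.id_comp,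
        Iso.inv_hom_id_assoc])
    have : IsIso e := ⟨t, ht₁, ht₃⟩
    rw [← hem]
    exact hfs.right_comp (hfs.right_of_isIso e) hm
  exact ha ▸ goal

lemma isModel_nerve (X : K.carrier) : IsModel κ K.genM (K.incl.op ⋙ yoneda.obj X) where
  preservesSmallLimits J _ hJ := by
    have : PreservesColimitsOfShape Jᵒᵖ K.incl :=
      ⟨fun {D} => (K.incl_colimit_of_small (by simpa using hJ) D).2⟩
    have := preservesLimitsOfShape_op J K.incl
    infer_instance
  preservesMultiplePullbacks I F hF := by
    have := (K.incl_colimit_of_wideSpan hF).2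
    have := preservesLimit_op F K.incl
    infer_instance

/-- The functor which sends an object of `K` to the model of the morphisms from generated
objects. -/
def nerve : K.carrier ⥤ K.genNest.Mod :=
  ObjectProperty.lift _ (yoneda ⋙ (Functor.whiskeringLeft _ _ (Type w)).obj K.incl.op)
    K.isModel_nerve

instance : K.nerve.Faithful where
  map_injective h := hom_ext_of_incl fun A a =>
    ConcreteCategory.congr_hom (congr_app (congrArg (·.hom) h) (op A)) a

instance : K.nerve.Full where
  map_surjective {X Y} α := by
    obtain ⟨J, _, _, G, s, hG, ⟨hs⟩⟩ := exists_incl_colimit X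
    let φ (A : K.SmallGen) (a : K.incl.obj A ⟶ X) : K.incl.obj A ⟶ Y := α.hom.app (op A) a
    have hφ {A B : K.SmallGen} (g : A ⟶ B) (b : K.incl.obj B ⟶ X) :
        φ A (K.incl.map g ≫ b) = K.incl.map g ≫ φ B b :=
      ConcreteCategory.congr_hom (α.hom.naturality g.op) b
    let t : Cocone (G ⋙ K.incl) :=
      { pt := Y
        ι :=
          { app := fun j => φ (G.obj j) (s.app j)
            naturality := fun i j f =>
              ((hφ (G.map f) (s.app j)).symm.trans
                (congrArg (φ (G.obj i)) ((s.naturality f).trans (Category.comp_id _)))).trans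
                (Category.comp_id _).symm } }
    refine ⟨hs.desc t, ?_⟩
    apply ObjectProperty.hom_ext
    ext A a
    obtain ⟨j, g, hg⟩ := (K.isGenerated_incl_obj A.unop).exists_hom hG hs a
    obtain ⟨g, rfl⟩ := K.incl.map_surjective g
    have hg' : K.incl.map g ≫ s.app j = a := hg
    have h₁ : s.app j ≫ hs.desc t = φ (G.obj j) (s.app j) := hs.fac t j
    change a ≫ hs.desc t = φ A.unop a
    rw [← hg', hφ, ← h₁, Category.assoc]

lemma preservesColimit_nerve {J : Type w} [PartialOrder J] [IsCardinalFiltered J κ]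
    {F : J ⥤ K.carrier} (hF : IsDiagramIn K.M F) : PreservesColimit F K.nerve where
  preserves {c} hc := by
    have (A : K.SmallGenᵒᵖ) : PreservesColimit F (coyoneda.obj (op (K.incl.obj A.unop))) :=
      K.isGenerated_incl_obj A.unop J F hF
    refine ⟨isColimitOfReflects (ObjectProperty.ι _) (evaluationJointlyReflectsColimits _
      fun A => ?_)⟩
    exact isColimitOfPreserves (coyoneda.obj (op (K.incl.obj A.unop))) hc

/-- The representable functors correspond to the generated objects. -/
def modYonedaIso : K.genNest.modYoneda ≅ unopUnop _ ⋙ K.incl ⋙ K.nerve :=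
  NatIso.ofComponents
    (fun Z => ObjectProperty.isoMk _ (NatIso.ofComponents
      (fun B => ((opEquiv Z.unop B).trans K.inclFullyFaithful.homEquiv).toIso)
      (fun f => by
        ext a
        exact K.incl.map_comp _ _)))
    (fun g => by
      apply ObjectProperty.hom_ext
      ext B a
      exact K.incl.map_comp _ _)

instance : K.nerve.EssSurj where
  mem_essImage H := by
    obtain ⟨J, _, _, G, s, hG, ⟨hs⟩⟩ := Nest.exists_directed_colimit H
    let D := G ⋙ unopUnop K.SmallGen
    have hD : IsDiagramIn K.M (D ⋙ K.incl) := fun i j f =>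
      (K.genNest.modM_map_iff (G.map f).unop).1 (hG f)
    have := K.preservesColimit_nerve hD
    let i : (D ⋙ K.incl) ⋙ K.nerve ≅ G ⋙ K.genNest.modYoneda :=
      Functor.isoWhiskerLeft G K.modYonedaIso.symm
    exact ⟨colimit (D ⋙ K.incl), ⟨(isColimitOfPreserves K.nerve
      (colimit.isColimit (D ⋙ K.incl))).coconePointsIsoOfNatIso hs i⟩⟩

instance : K.nerve.IsEquivalence where

lemma modM_nerve_map_iff {X Y : K.carrier} (f : X ⟶ Y) :
    K.genNest.modM (K.nerve.map f) ↔ K.M f := by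
  rw [Nest.modM_iff]
  refine ⟨fun h => M_of_exists f fun A B e he a b hab => h e.op he a b hab,
    fun hf A B m hm y x hxy => ?_⟩
  obtain ⟨d, hd, -⟩ := K.isFactorizationSystem.orthogonal (e := K.incl.map m.unop) hm hf y x hxy
  exact ⟨d, hd⟩

end LocGenCat

/-! ### The unit of the biequivalence -/

lemma conjugateEquiv_symm_app_comp {C : Type u₁} [Category.{v₁} C] {D : Type u₂} [Category.{v₂} D]
    {L₁ L₂ : C ⥤ D} {R₁ R₂ : D ⥤ C} (adj₁ : L₁ ⊣ R₁) (adj₂ : L₂ ⊣ R₂) (α : R₁ ⟶ R₂) {Y : C} {X : D}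
    (x : Y ⟶ R₁.obj X) :
    ((conjugateEquiv adj₁ adj₂).symm α).app Y ≫ (adj₁.homEquiv Y X).symm x =
      (adj₂.homEquiv Y X).symm (x ≫ α.app X) := by
  apply (adj₂.homEquiv Y X).injective
  have h := unit_conjugateEquiv_symm adj₁ adj₂ α Y
  dsimp at h
  rw [Equiv.apply_symm_apply, adj₂.homEquiv_unit, Functor.map_comp, ← Category.assoc, ← h,
    Category.assoc, ← α.naturality, ← Category.assoc, ← adj₁.homEquiv_unit,
    Equiv.apply_symm_apply]

lemma Nest.mod_natTrans_ext {κ : Cardinal.{w}} {C : Type u} [Category.{v} C] {A : Nest κ}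
    {S T : C ⥤ A.Mod} {α β : S ⟶ T}
    (h : ∀ X A x, (α.app X).hom.app A x = (β.app X).hom.app A x) : α = β := by
  ext X : 2
  apply ObjectProperty.hom_ext
  ext A x
  exact h X A x

namespace LocGenCat

variable {κ : Cardinal.{w}} [Fact κ.IsRegular]

section

variable {K L N : LocGenCat κ}

lemma conj_app_comp {R S : K ⟶ L} (α : R ⟶ S) {Y : L.carrier} {X : K.carrier}
    (x : Y ⟶ R.functor.obj X) :
    (conj α).app Y ≫ ((Hom.adj R).homEquiv Y X).symm x =
      ((Hom.adj S).homEquiv Y X).symm (x ≫ α.natTrans.app X) :=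
  conjugateEquiv_symm_app_comp _ _ _ _

lemma leftId_hom_app_comp {Y X : K.carrier} (x : Y ⟶ X) :
    K.leftId.hom.app Y ≫ x = ((Hom.adj (𝟙 K)).homEquiv Y X).symm x := by
  refine Eq.trans ?_ ((conjugateEquiv_symm_app_comp .id (Hom.adj (𝟙 K)) (𝟙 _) x).trans ?_)
  · have h : Adjunction.id.homEquiv Y X x = x := Category.id_comp x
    exact congrArg _ ((Equiv.eq_symm_apply _).2 h)
  · exact congrArg _ (Category.comp_id x)

lemma leftComp_hom_app_comp (R : K ⟶ L) (S : L ⟶ N) {Y : N.carrier} {X : K.carrier}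
    (x : Y ⟶ S.functor.obj (R.functor.obj X)) :
    (leftComp R S).hom.app Y ≫ ((Hom.adj (R ≫ S)).homEquiv Y X).symm x =
      ((Hom.adj R).homEquiv _ X).symm (((Hom.adj S).homEquiv Y _).symm x) := by
  refine (conjugateEquiv_symm_app_comp (Hom.adj (R ≫ S)) ((Hom.adj S).comp (Hom.adj R))
    (𝟙 _) x).trans ?_
  rw [Adjunction.comp_homEquiv]
  exact congrArg (fun y => ((Hom.adj R).homEquiv _ X).symm
    (((Hom.adj S).homEquiv Y (R.functor.obj X)).symm y)) (Category.comp_id x)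

/-- An equivalence of categories which preserves and reflects the right classes is an equivalence
in the 2-category of locally generated categories. -/
def equivalenceMk (e : K.carrier ≌ L.carrier)
    (he : ∀ ⦃X Y : K.carrier⦄ (f : X ⟶ Y), L.M (e.functor.map f) ↔ K.M f) :
    Bicategory.Equivalence K L :=
  Bicategory.Equivalence.mkOfAdjointifyCounit
    (f := (⟨e.functor, inferInstance, fun _ _ f => (he f).2, fun _ _ _ _ _ => inferInstance⟩ :
      Hom K L))
    (g := (⟨e.inverse, inferInstance, fun _ _ f hf => (he _).1
      (L.isFactorizationSystem.right_of_arrow_iso (e.counit.app _) (e.counitInv.app _)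
        (by simp) hf), fun _ _ _ _ _ => inferInstance⟩ : Hom L K))
    (isoMk e.unitIso) (isoMk e.counitIso)

/-- The morphism of nests induced by a morphism of locally generated categories. -/
abbrev genNestMap (R : K ⟶ L) : L.genNest ⟶ K.genNest :=
  (⟨(genMap R (preservesGen R)).op, isNestMorphism_genMap R⟩ : Nest.Hom L.genNest K.genNest)

/-- The transposition of morphisms from generated objects. -/
def nerveEquiv (R : K ⟶ L) (X : K.carrier) (A : L.SmallGen) :
    (L.incl.obj A ⟶ R.functor.obj X) ≃ (K.incl.obj ((genMap R (preservesGen R)).obj A) ⟶ X) :=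
  ((Hom.adj R).homEquiv (L.incl.obj A) X).symm.trans
    ((genMapIncl R (preservesGen R)).app A).symm.homFromEquiv

lemma nerveEquiv_apply (R : K ⟶ L) {X : K.carrier} {A : L.SmallGen}
    (x : L.incl.obj A ⟶ R.functor.obj X) : nerveEquiv R X A x =
      (genMapIncl R (preservesGen R)).hom.app A ≫ ((Hom.adj R).homEquiv _ X).symm x := rfl

lemma nerveEquiv_naturality_left (R : K ⟶ L) {X : K.carrier} {A B : L.SmallGen} (f : B ⟶ A)
    (x : L.incl.obj A ⟶ R.functor.obj X) : nerveEquiv R X B (L.incl.map f ≫ x) =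
      K.incl.map ((genMap R (preservesGen R)).map f) ≫ nerveEquiv R X A x := by
  rw [nerveEquiv_apply, nerveEquiv_apply, Adjunction.homEquiv_naturality_left_symm,
    genMapIncl_naturality_assoc]

lemma nerveEquiv_naturality_right (R : K ⟶ L) {X Y : K.carrier} {A : L.SmallGen}
    (x : L.incl.obj A ⟶ R.functor.obj X) (f : X ⟶ Y) :
    nerveEquiv R Y A (x ≫ R.functor.map f) = nerveEquiv R X A x ≫ f := by
  rw [nerveEquiv_apply, nerveEquiv_apply, Adjunction.homEquiv_naturality_right_symm,
    Category.assoc]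

lemma nerveEquiv_comp_app {R S : K ⟶ L} (α : R ⟶ S) {X : K.carrier} {A : L.SmallGen}
    (x : L.incl.obj A ⟶ R.functor.obj X) : nerveEquiv S X A (x ≫ α.natTrans.app X) =
      K.incl.map ((genMap₂ (preservesGen R) (preservesGen S) α).app A) ≫ nerveEquiv R X A x := by
  rw [nerveEquiv_apply, nerveEquiv_apply, ← conj_app_comp]
  simp

lemma nerveEquiv_id {X : K.carrier} {A : K.SmallGen} (x : K.incl.obj A ⟶ X) :
    K.incl.map ((genMapId (preservesGen (𝟙 K))).inv.app A) ≫ nerveEquiv (𝟙 K) X A x =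
      x ≫ 𝟙 X := by
  rw [nerveEquiv_apply, ← leftId_hom_app_comp]
  simp

lemma nerveEquiv_comp (R : K ⟶ L) (S : L ⟶ N) {X : K.carrier} {A : N.SmallGen}
    (x : N.incl.obj A ⟶ S.functor.obj (R.functor.obj X)) :
    K.incl.map ((genMapComp R S (preservesGen R) (preservesGen S)
        (preservesGen (R ≫ S))).hom.app A) ≫ nerveEquiv (R ≫ S) X A x =
      nerveEquiv R X _ (nerveEquiv S _ A (x ≫ 𝟙 _)) := by
  rw [nerveEquiv_apply, nerveEquiv_apply, nerveEquiv_apply,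
    Adjunction.homEquiv_naturality_left_symm, Category.comp_id]
  refine Eq.trans ?_ (congrArg (fun y => (genMapIncl R (preservesGen R)).hom.app _ ≫
    (Hom.left R).map ((genMapIncl S (preservesGen S)).hom.app A) ≫ y)
    (leftComp_hom_app_comp R S x))
  simp

/-- The nerve is compatible with the morphisms of locally generated categories. -/
def nerveMapIso (R : K ⟶ L) :
    R.functor ⋙ L.nerve ≅ K.nerve ⋙ Nest.modMap (genNestMap R) :=
  NatIso.ofComponents
    (fun X => ObjectProperty.isoMk _ (NatIso.ofComponents
      (fun A => (nerveEquiv R X A.unop).toIso)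
      (fun f => by
        ext x
        exact nerveEquiv_naturality_left R f.unop x)))
    (fun f => by
      apply ObjectProperty.hom_ext
      ext A x
      exact nerveEquiv_naturality_right R x f)

end

variable (κ) in
/-- The unit of the biequivalence. -/
def unit : PointwiseEquivalence (Pseudofunctor.id (LocGenCat κ))
    ((genWellDefined κ).pseudofunctor.comp (modWellDefined κ).pseudofunctor) where
  equiv K := equivalenceMk (K := K) (L := (modWellDefined κ).obj ((genWellDefined κ).obj K))
    K.nerve.asEquivalence (fun _ _ f => K.modM_nerve_map_iff f)
  naturality R := isoMk (nerveMapIso R)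
  naturality_naturality α := hom₂_ext <| Nest.mod_natTrans_ext fun _ _ x =>
    nerveEquiv_comp_app α x
  naturality_id _ := hom₂_ext <| Nest.mod_natTrans_ext fun _ _ x => nerveEquiv_id x
  naturality_comp R S := hom₂_ext <| Nest.mod_natTrans_ext fun _ _ x => nerveEquiv_comp R S x

end LocGenCat

/-! ### Nests as categories of generated models -/

namespace Nest

section

variable {κ : Cardinal.{w}} {A : Nest κ}

lemma app_modYonedaEquiv {H K : A.Mod} {X : A.carrier} (f : A.modYoneda.obj (op X) ⟶ H)
    (g : H ⟶ K) : g.hom.app X (modYonedaEquiv f) = modYonedaEquiv (f ≫ g) := rfl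

lemma map_modYonedaEquiv {H : A.Mod} {X Y : A.carrier} (f : X ⟶ Y)
    (g : A.modYoneda.obj (op X) ⟶ H) :
    H.obj.map f (modYonedaEquiv g) = modYonedaEquiv (A.modYoneda.map f.op ≫ g) := by
  apply elem_injective
  rw [← map_elem, elem_modYonedaEquiv, elem_modYonedaEquiv]

end

variable {κ : Cardinal.{w}} [Fact κ.IsRegular] (A : Nest κ)

/-- The locally generated category `Mod_κ(A)`. -/
abbrev modCat : LocGenCat κ where
  carrier := A.Mod
  E := A.modE
  M := A.modM
  isLocallyGenerated := A.isLocallyGenerated_mod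

lemma modE_map_iff {X Y : A.carrier} (m : X ⟶ Y) : A.modE (A.modYoneda.map m.op) ↔ A.M m := by
  refine ⟨fun h => ?_, modE_map⟩
  refine A.isFactorizationSystem.right_of_orthogonal fun U V e he => ?_
  exact (orthogonal_op_iff e m).1 (Orthogonal.of_map (h _ ((A.modM_map_iff e).2 he)))

variable {A} in
/-- The generated models are representable. -/
lemma essImage_modYoneda {H : A.Mod} (hH : IsGenerated κ A.modM H) : A.modYoneda.essImage H := by
  obtain ⟨_, ⟨X⟩, ⟨r⟩⟩ := IsGenerated.exists_retract
    (S := ObjectProperty.ofObj A.modYoneda.obj) (fun H => by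
      obtain ⟨J, _, _, G, s, hG, ⟨hs⟩⟩ := exists_directed_colimit H
      exact ⟨J, _, inferInstance, _, _, hG, fun j => .mk _, ⟨hs⟩, ⟨Iso.refl _⟩⟩) H hH
  obtain ⟨p, hp⟩ := A.modYoneda.map_surjective (r.r ≫ r.i)
  have : IsIdempotentComplete A.carrier :=
    Idempotents.isIdempotentComplete_iff_hasEqualizer_of_id_and_idempotent _ |>.2
      fun _ _ _ => inferInstance
  obtain ⟨Y, i, e, hie, hei⟩ := IsIdempotentComplete.idempotents_split X p
    (A.modYoneda.map_injective (by simp [hp]))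
  have h : i ≫ p ≫ e = 𝟙 _ := by rw [← hei, Category.assoc, reassoc_of% hie, hie]
  refine ⟨Y, ⟨⟨A.modYoneda.map i ≫ r.r, r.i ≫ A.modYoneda.map e, ?_, ?_⟩⟩⟩
  · rw [Category.assoc, ← Category.assoc r.r, ← hp, ← Functor.map_comp, ← Functor.map_comp, h]
    exact A.modYoneda.map_id Y
  · rw [Category.assoc, ← Functor.map_comp_assoc, hei, hp]
    simp

instance essentiallySmall_gen_modCat : EssentiallySmall.{w} A.modCat.Gen :=
  A.modCat.essentiallySmall_gen

/-- The Yoneda embedding, with values in (a small model of) the category of generated models. -/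
def genYoneda : A.carrierᵒᵖ ⥤ A.modCat.SmallGen :=
  ObjectProperty.lift _ A.modYoneda (fun X => isGenerated_modYoneda X.unop) ⋙
    (equivSmallModel.{w} A.modCat.Gen).functor

/-- `genYoneda` is, up to isomorphism, the Yoneda embedding. -/
def genYonedaIncl : A.genYoneda ⋙ A.modCat.incl ≅ A.modYoneda :=
  Functor.isoWhiskerRight
    (Functor.isoWhiskerLeft
      (ObjectProperty.lift _ A.modYoneda (fun X => isGenerated_modYoneda X.unop))
      (equivSmallModel.{w} A.modCat.Gen).unitIso.symm)
    (IsGenerated κ A.modM).ι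

instance : A.genYoneda.IsEquivalence := by
  have : (ObjectProperty.lift (IsGenerated κ A.modM) A.modYoneda
      (fun X => isGenerated_modYoneda X.unop)).EssSurj := ⟨fun H => by
    obtain ⟨X, ⟨i⟩⟩ := essImage_modYoneda H.property
    exact ⟨X, ⟨ObjectProperty.isoMk _ i⟩⟩⟩
  have : (ObjectProperty.lift (IsGenerated κ A.modM) A.modYoneda
      (fun X => isGenerated_modYoneda X.unop)).IsEquivalence := { }
  unfold genYoneda
  infer_instance

lemma genYonedaIncl_naturality {X Y : A.carrierᵒᵖ} (f : X ⟶ Y) :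
    A.modCat.incl.map (A.genYoneda.map f) ≫ A.genYonedaIncl.hom.app Y =
      A.genYonedaIncl.hom.app X ≫ A.modYoneda.map f :=
  A.genYonedaIncl.hom.naturality f

lemma genM_genYoneda_map_iff {X Y : A.carrier} (f : X ⟶ Y) :
    A.modCat.genM (A.genYoneda.rightOp.map f) ↔ A.M f := by
  rw [← A.modE_map_iff]
  have h := A.isFactorizationSystem_mod
  have := A.genYonedaIncl_naturality f.op
  constructor
  · refine h.left_of_arrow_iso (A.genYonedaIncl.inv.app _) (A.genYonedaIncl.hom.app _) ?_
    dsimp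
    rw [this, Iso.inv_hom_id_app_assoc]
  · refine h.left_of_arrow_iso (A.genYonedaIncl.hom.app _) (A.genYonedaIncl.inv.app _) ?_
    rw [← reassoc_of% this, Iso.hom_inv_id_app]
    exact Category.comp_id _

variable {A} {B C : Nest κ}

/-- An equivalence of categories which preserves and reflects the right classes is an equivalence
in the opposite of the 2-category of nests. -/
def opEquivalenceMk (e : A.carrier ≌ B.carrier)
    (he : ∀ ⦃X Y : A.carrier⦄ (f : X ⟶ Y), B.M (e.functor.map f) ↔ A.M f) :
    Bicategory.Equivalence (op B) (op A) :=
  let F : A ⟶ B := (⟨e.functor, fun _ _ f => (he f).2, fun _ _ _ => inferInstance,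
    fun _ _ _ => inferInstance⟩ : Hom A B)
  let G : B ⟶ A := (⟨e.inverse, fun _ _ f hf => (he _).1
      (B.isFactorizationSystem.right_of_arrow_iso (e.counit.app _) (e.counitInv.app _)
        (by simp) hf), fun _ _ _ => inferInstance, fun _ _ _ => inferInstance⟩ : Hom B A)
  Bicategory.Equivalence.mkOfAdjointifyCounit (f := F.op) (g := G.op)
    (isoMk (F := 𝟙 B) (G := G ≫ F) e.counitIso.symm).op2
    (isoMk (F := F ≫ G) (G := 𝟙 A) e.unitIso.symm).op2

/-- The morphism of locally generated categories induced by a morphism of nests. -/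
abbrev modCatMap (F : A ⟶ B) : B.modCat ⟶ A.modCat :=
  (⟨modMap F, isLocGenMorphism_modMap F⟩ : LocGenCat.Hom B.modCat A.modCat)

section

open LocGenCat

/-- The morphism to `Mod_κ(F)(H)` which corresponds to an element of `H`. -/
def elemMap (F : A ⟶ B) {H : B.Mod} {X : A.carrier} (x : H.obj.obj (F.functor.obj X)) :
    A.modYoneda.obj (op X) ⟶ (modCatMap F).functor.obj H :=
  elem ((modMap F).obj H) x

lemma elemMap_comp (F : A ⟶ B) {H K : B.Mod} {X : A.carrier}
    (x : H.obj.obj (F.functor.obj X)) (g : H ⟶ K) :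
    elemMap F x ≫ (modCatMap F).functor.map g = elemMap F (g.hom.app _ x) :=
  elem_comp (H := (modMap F).obj H) x ((modMap F).map g)

lemma map_elemMap (F : A ⟶ B) {H : B.Mod} {X Y : A.carrier} (f : X ⟶ Y)
    (x : H.obj.obj (F.functor.obj X)) :
    A.modYoneda.map f.op ≫ elemMap F x = elemMap F (H.obj.map (F.functor.map f) x) :=
  map_elem (H := (modMap F).obj H) f x

/-- The 2-cell induced by a 2-cell of nests. -/
abbrev modCatMap₂ {F G : A ⟶ B} (α : F ⟶ G) : modCatMap F ⟶ modCatMap G :=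
  (⟨modMap₂ α⟩ : LocGenCat.Hom₂ (modCatMap F) (modCatMap G))

lemma elemMap_comp_app {F G : A ⟶ B} (α : F ⟶ G) {H : B.Mod} {X : A.carrier}
    (x : H.obj.obj (F.functor.obj X)) :
    elemMap F x ≫ (modCatMap₂ α).natTrans.app H =
      elemMap G (H.obj.map (α.natTrans.app X) x) :=
  elem_comp (H := (modMap F).obj H) x ((modMap₂ α).app H)

lemma elemMap_surjective (F : A ⟶ B) {H : B.Mod} {X : A.carrier}
    (g : A.modYoneda.obj (op X) ⟶ (modCatMap F).functor.obj H) :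
    ∃ x : H.obj.obj (F.functor.obj X), elemMap F x = g :=
  elem_surjective (H := (modMap F).obj H) g

/-- The morphism out of the left adjoint of `Mod_κ(F)` at a representable functor which
corresponds to an element. -/
def leftElem (F : A ⟶ B) {H : B.Mod} {X : A.carrier} (x : H.obj.obj (F.functor.obj X)) :
    (Hom.left (modCatMap F)).obj (A.modYoneda.obj (op X)) ⟶ H :=
  ((Hom.adj (modCatMap F)).homEquiv _ _).symm (elemMap F x)

lemma leftElem_comp (F : A ⟶ B) {H K : B.Mod} {X : A.carrier}
    (x : H.obj.obj (F.functor.obj X)) (g : H ⟶ K) :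
    leftElem F x ≫ g = leftElem F (g.hom.app _ x) := by
  unfold leftElem
  rw [← Adjunction.homEquiv_naturality_right_symm, elemMap_comp]

lemma map_leftElem (F : A ⟶ B) {H : B.Mod} {X Y : A.carrier} (f : X ⟶ Y)
    (x : H.obj.obj (F.functor.obj X)) :
    (Hom.left (modCatMap F)).map (A.modYoneda.map f.op) ≫ leftElem F x =
      leftElem F (H.obj.map (F.functor.map f) x) := by
  unfold leftElem
  rw [← Adjunction.homEquiv_naturality_left_symm, map_elemMap]

lemma conj_leftElem {F G : A ⟶ B} (α : F ⟶ G) {H : B.Mod} {X : A.carrier}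
    (x : H.obj.obj (F.functor.obj X)) :
    (conj (modCatMap₂ α)).app (A.modYoneda.obj (op X)) ≫ leftElem F x =
      leftElem G (H.obj.map (α.natTrans.app X) x) :=
  (conj_app_comp (modCatMap₂ α) (elemMap F x)).trans (congrArg _ (elemMap_comp_app α x))

lemma leftElem_surjective (F : A ⟶ B) {H : B.Mod} {X : A.carrier}
    (g : (Hom.left (modCatMap F)).obj (A.modYoneda.obj (op X)) ⟶ H) :
    ∃ x, leftElem F x = g := by
  obtain ⟨x, hx⟩ := elemMap_surjective F ((Hom.adj (modCatMap F)).homEquiv _ _ g)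
  refine ⟨x, ?_⟩
  unfold leftElem
  rw [hx, Equiv.symm_apply_apply]

lemma leftElem_injective (F : A ⟶ B) {H : B.Mod} {X : A.carrier}
    {x y : H.obj.obj (F.functor.obj X)} (h : leftElem F x = leftElem F y) : x = y :=
  elem_injective (H := (modMap F).obj H) (((Hom.adj (modCatMap F)).homEquiv _ _).symm.injective h)

/-- The comparison morphism from the left adjoint of `Mod_κ(F)` at a representable functor. -/
def leftYoneda (F : A ⟶ B) (X : A.carrier) :
    (Hom.left (modCatMap F)).obj (A.modYoneda.obj (op X)) ⟶
      B.modYoneda.obj (op (F.functor.obj X)) :=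
  leftElem F (modYonedaEquiv (𝟙 (B.modYoneda.obj (op (F.functor.obj X)))))

lemma leftYoneda_comp (F : A ⟶ B) {H : B.Mod} {X : A.carrier}
    (g : B.modYoneda.obj (op (F.functor.obj X)) ⟶ H) :
    leftYoneda F X ≫ g = leftElem F (modYonedaEquiv g) := by
  unfold leftYoneda
  rw [leftElem_comp, app_modYonedaEquiv, Category.id_comp]

instance (F : A ⟶ B) (X : A.carrier) : IsIso (leftYoneda F X) := by
  obtain ⟨x, hx⟩ := leftElem_surjective F (𝟙 ((Hom.left (modCatMap F)).obj
    (A.modYoneda.obj (op X))))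
  have h₁ : leftYoneda F X ≫ elem _ x = 𝟙 _ := by
    rw [leftYoneda_comp, modYonedaEquiv_elem, hx]
  refine ⟨elem _ x, h₁, modYonedaEquiv.injective (leftElem_injective F ?_)⟩
  rw [← leftYoneda_comp, ← leftYoneda_comp, reassoc_of% h₁, Category.comp_id]

lemma map_leftYoneda (F : A ⟶ B) {X Y : A.carrier} (f : X ⟶ Y) :
    (Hom.left (modCatMap F)).map (A.modYoneda.map f.op) ≫ leftYoneda F X =
      leftYoneda F Y ≫ B.modYoneda.map (F.functor.map f).op := by
  rw [leftYoneda_comp]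
  unfold leftYoneda
  rw [map_leftElem, map_modYonedaEquiv, Category.comp_id]

lemma conj_leftYoneda {F G : A ⟶ B} (α : F ⟶ G) (X : A.carrier) :
    (conj (modCatMap₂ α)).app (A.modYoneda.obj (op X)) ≫ leftYoneda F X =
      leftYoneda G X ≫ B.modYoneda.map (α.natTrans.app X).op := by
  rw [leftYoneda_comp]
  unfold leftYoneda
  rw [conj_leftElem, map_modYonedaEquiv, Category.comp_id]

end

end Nest

/-! ### The counit of the biequivalence -/

namespace Nest

open LocGenCat

variable {κ : Cardinal.{w}} [Fact κ.IsRegular] {A B C : Nest κ}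

/-- The compatibility of `Mod_κ` with identities. -/
abbrev modCatMapId (A : Nest κ) : modCatMap (𝟙 A) ≅ 𝟙 A.modCat :=
  LocGenCat.isoMk (R := modCatMap (𝟙 A)) (S := 𝟙 A.modCat) (modMapId A)

/-- The compatibility of `Mod_κ` with compositions. -/
abbrev modCatMapComp (F : A ⟶ B) (G : B ⟶ C) :
    modCatMap (F ≫ G) ≅ modCatMap G ≫ modCatMap F :=
  LocGenCat.isoMk (R := modCatMap (F ≫ G)) (S := modCatMap G ≫ modCatMap F) (modMapComp F G)

lemma conj_leftYoneda_id (X : A.carrier) :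
    (conj (modCatMapId A).hom).app (A.modYoneda.obj (op X)) ≫ leftYoneda (𝟙 A) X =
      A.modCat.leftId.hom.app (A.modYoneda.obj (op X)) := by
  refine (conj_app_comp (modCatMapId A).hom _).trans ?_
  refine (leftId_hom_app_comp (K := A.modCat) _).symm.trans ?_
  refine (congrArg _ ?_).trans (Category.comp_id _)
  exact (elem_comp (H := (modMap (𝟙 A)).obj (A.modYoneda.obj (op X))) _ _).trans
    (elem_modYonedaEquiv (𝟙 (A.modYoneda.obj (op X))))

lemma conj_leftYoneda_comp (F : A ⟶ B) (G : B ⟶ C) (X : A.carrier) :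
    (leftComp (modCatMap G) (modCatMap F)).hom.app (A.modYoneda.obj (op X)) ≫
        (conj (modCatMapComp F G).hom).app (A.modYoneda.obj (op X)) ≫ leftYoneda (F ≫ G) X =
      (Hom.left (modCatMap G)).map (leftYoneda F X) ≫ leftYoneda G (F.functor.obj X) := by
  refine (congrArg (_ ≫ ·) (conj_app_comp (modCatMapComp F G).hom _)).trans ?_
  refine (leftComp_hom_app_comp (modCatMap G) (modCatMap F) _).trans ?_
  refine Eq.trans ?_ ((Hom.adj (modCatMap G)).homEquiv_naturality_left_symm (leftYoneda F X) _)
  refine congrArg _ ?_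
  refine Eq.trans ?_ (leftYoneda_comp F (H := (modMap G).obj
    (C.modYoneda.obj (op (G.functor.obj (F.functor.obj X))))) _).symm
  refine congrArg _ ((elem_comp (H := (modMap (F ≫ G)).obj _) _ _).trans ?_)
  let y := C.modYoneda.obj (op (G.functor.obj (F.functor.obj X)))
  let z : y.obj.obj (G.functor.obj (F.functor.obj X)) := modYonedaEquiv (𝟙 y)
  exact congrArg (elem ((modMap F).obj ((modMap G).obj y)))
    (modYonedaEquiv_elem (H := (modMap G).obj y) (X := F.functor.obj X) z).symm

/-- The left adjoint of `Mod_κ(F)` extends `F`. -/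
def leftYonedaIso (F : A ⟶ B) :
    A.modYoneda ⋙ Hom.left (modCatMap F) ≅ F.functor.op ⋙ B.modYoneda :=
  NatIso.ofComponents (fun X => asIso (leftYoneda F X.unop)) (fun f => map_leftYoneda F f.unop)

lemma leftYonedaIso_hom_app (F : A ⟶ B) (X : A.carrierᵒᵖ) :
    (leftYonedaIso F).hom.app X = leftYoneda F X.unop := rfl

/-- The Yoneda embeddings are compatible with the morphisms of nests. -/
def genYonedaMapIso (F : A ⟶ B) :
    A.genYoneda ⋙ genMap (modCatMap F) (preservesGen _) ≅ F.functor.op ⋙ B.genYoneda :=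
  (B.modCat.inclFullyFaithful.whiskeringRight _).preimageIso
    (Functor.associator _ _ _ ≪≫
      Functor.isoWhiskerLeft A.genYoneda (genMapIncl (modCatMap F) (preservesGen _)) ≪≫
      (Functor.associator _ _ _).symm ≪≫
      Functor.isoWhiskerRight A.genYonedaIncl (Hom.left (modCatMap F)) ≪≫ leftYonedaIso F ≪≫
      Functor.isoWhiskerLeft F.functor.op B.genYonedaIncl.symm ≪≫
      (Functor.associator _ _ _).symm)

lemma incl_map_genYonedaMapIso_hom (F : A ⟶ B) (X : A.carrier) :
    B.modCat.incl.map ((genYonedaMapIso F).hom.app (op X)) =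
      (genMapIncl (modCatMap F) (preservesGen _)).hom.app (A.genYoneda.obj (op X)) ≫
        (Hom.left (modCatMap F)).map (A.genYonedaIncl.hom.app (op X)) ≫ leftYoneda F X ≫
          B.genYonedaIncl.inv.app (op (F.functor.obj X)) := by
  simp [genYonedaMapIso, leftYonedaIso_hom_app]

lemma genMap₂_genYonedaMapIso_hom {F G : A ⟶ B} (α : F ⟶ G) (X : A.carrier) :
    (genMap₂ (preservesGen _) (preservesGen _) (modCatMap₂ α)).app (A.genYoneda.obj (op X)) ≫
        (genYonedaMapIso F).hom.app (op X) =
      (genYonedaMapIso G).hom.app (op X) ≫ B.genYoneda.map (α.natTrans.app X).op := by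
  apply B.modCat.inclFullyFaithful.map_injective
  have h₁ := (conj (modCatMap₂ α)).naturality (A.genYonedaIncl.hom.app (op X))
  have h₂ := B.genYonedaIncl.inv.naturality (α.natTrans.app X).op
  have h₃ := conj_leftYoneda α X
  dsimp at h₁ h₂
  simp only [Functor.map_comp, incl_map_genMap₂, incl_map_genYonedaMapIso_hom, Category.assoc,
    Iso.inv_hom_id_app_assoc]
  rw [← h₂, ← reassoc_of% h₃, reassoc_of% h₁]

lemma genMapId_genYonedaMapIso_hom (X : A.carrier) :
    (genMapId (preservesGen (𝟙 A.modCat))).inv.app (A.genYoneda.obj (op X)) ≫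
      (genMap₂ (preservesGen _) (preservesGen _) (modCatMapId A).hom).app
        (A.genYoneda.obj (op X)) ≫ (genYonedaMapIso (𝟙 A)).hom.app (op X) = 𝟙 _ := by
  apply A.modCat.inclFullyFaithful.map_injective
  have h₁ := (conj (modCatMapId A).hom).naturality (A.genYonedaIncl.hom.app (op X))
  have h₂ := A.modCat.leftId.inv.naturality (A.genYonedaIncl.hom.app (op X))
  have h₃ := conj_leftYoneda_id X
  dsimp at h₁ h₂
  simp only [Functor.map_comp, incl_map_genMap₂, incl_map_genYonedaMapIso_hom, Category.assoc,
    Iso.inv_hom_id_app_assoc, incl_map_genMapId_inv]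
  rw [← reassoc_of% h₁, reassoc_of% h₃, ← reassoc_of% h₂, Iso.inv_hom_id_app_assoc]
  exact (A.genYonedaIncl.hom_inv_id_app (op X)).trans (A.modCat.incl.map_id _).symm

lemma genMapComp_genYonedaMapIso_hom (F : A ⟶ B) (G : B ⟶ C) (X : A.carrier) :
    (genMapComp (modCatMap G) (modCatMap F) (preservesGen _) (preservesGen _)
        (preservesGen _)).hom.app (A.genYoneda.obj (op X)) ≫
      (genMap₂ (preservesGen _) (preservesGen _) (modCatMapComp F G).hom).app
        (A.genYoneda.obj (op X)) ≫ (genYonedaMapIso (F ≫ G)).hom.app (op X) =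
      (genMap (modCatMap G) (preservesGen _)).map ((genYonedaMapIso F).hom.app (op X)) ≫
        (genYonedaMapIso G).hom.app (op (F.functor.obj X)) := by
  apply C.modCat.inclFullyFaithful.map_injective
  have h₁ := (conj (modCatMapComp F G).hom).naturality (A.genYonedaIncl.hom.app (op X))
  have h₂ := (leftComp (modCatMap G) (modCatMap F)).hom.naturality
    (A.genYonedaIncl.hom.app (op X))
  have h₃ := conj_leftYoneda_comp F G X
  dsimp at h₁ h₂
  simp only [Functor.map_comp, incl_map_genMap₂, incl_map_genYonedaMapIso_hom, Category.assoc,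
    Iso.inv_hom_id_app_assoc, incl_map_genMapComp_hom]
  rw [genMapIncl_naturality_assoc, ← reassoc_of% h₁, ← reassoc_of% h₂, reassoc_of% h₃,
    incl_map_genYonedaMapIso_hom]
  simp only [Functor.map_comp, Category.assoc]
  have h₄ := congrArg (Hom.left (modCatMap G)).map
    (B.genYonedaIncl.inv_hom_id_app (op (F.functor.obj X)))
  rw [Functor.map_comp, CategoryTheory.Functor.map_id] at h₄
  rw [reassoc_of% h₄]
  rfl

lemma genYonedaMapIso_inv_genMap₂ {F G : A ⟶ B} (α : F ⟶ G) (X : A.carrier) :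
    (genYonedaMapIso G).inv.app (op X) ≫
        (genMap₂ (preservesGen _) (preservesGen _) (modCatMap₂ α)).app (A.genYoneda.obj (op X)) =
      B.genYoneda.map (α.natTrans.app X).op ≫ (genYonedaMapIso F).inv.app (op X) := by
  rw [← cancel_mono ((genYonedaMapIso F).hom.app (op X)), Category.assoc,
    genMap₂_genYonedaMapIso_hom, Iso.inv_hom_id_app_assoc, Category.assoc, Iso.inv_hom_id_app]
  exact (Category.comp_id _).symm

lemma genYonedaMapIso_id_inv (X : A.carrier) :
    (genYonedaMapIso (𝟙 A)).inv.app (op X) =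
      (genMapId (preservesGen (𝟙 A.modCat))).inv.app (A.genYoneda.obj (op X)) ≫
        (genMap₂ (preservesGen _) (preservesGen _) (modCatMapId A).hom).app
          (A.genYoneda.obj (op X)) := by
  rw [← cancel_mono ((genYonedaMapIso (𝟙 A)).hom.app (op X)), Iso.inv_hom_id_app, Category.assoc]
  exact (genMapId_genYonedaMapIso_hom X).symm

lemma genYonedaMapIso_comp_inv (F : A ⟶ B) (G : B ⟶ C) (X : A.carrier) :
    (genYonedaMapIso (F ≫ G)).inv.app (op X) =
      (genYonedaMapIso G).inv.app (op (F.functor.obj X)) ≫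
        (genMap (modCatMap G) (preservesGen _)).map ((genYonedaMapIso F).inv.app (op X)) ≫
          (genMapComp (modCatMap G) (modCatMap F) (preservesGen _) (preservesGen _)
              (preservesGen _)).hom.app (A.genYoneda.obj (op X)) ≫
            (genMap₂ (preservesGen _) (preservesGen _) (modCatMapComp F G).hom).app
              (A.genYoneda.obj (op X)) := by
  rw [← cancel_mono ((genYonedaMapIso (F ≫ G)).hom.app (op X)), Iso.inv_hom_id_app]
  simp only [Category.assoc]
  rw [genMapComp_genYonedaMapIso_hom, ← Functor.map_comp_assoc, Iso.inv_hom_id_app,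
    CategoryTheory.Functor.map_id]
  exact ((congrArg _ (Category.id_comp _)).trans ((genYonedaMapIso G).inv_hom_id_app _)).symm

/-- The naturality constraint of the counit. -/
def genYonedaRightOpIso (F : A ⟶ B) :
    A.genYoneda.rightOp ⋙ (genMap (modCatMap F) (preservesGen _)).op ≅
      F.functor ⋙ B.genYoneda.rightOp :=
  NatIso.ofComponents (fun X => ((genYonedaMapIso F).symm.app (op X)).op)
    (fun f => Quiver.Hom.unop_inj ((genYonedaMapIso F).inv.naturality f.op).symm)

variable (κ) in
/-- The counit of the biequivalence. -/
def counit : PointwiseEquivalence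
    ((modWellDefined κ).pseudofunctor.comp (genWellDefined κ).pseudofunctor)
    (Pseudofunctor.id (Nest κ)ᵒᵖ) where
  equiv A := opEquivalenceMk (A := A.unop)
    (B := (genWellDefined κ).obj ((modWellDefined κ).obj A.unop))
    A.unop.genYoneda.rightOp.asEquivalence (fun _ _ f => A.unop.genM_genYoneda_map_iff f)
  naturality F := (Nest.isoMk (genYonedaRightOpIso F.unop)).op2
  naturality_naturality α := op_hom₂_ext <| by
    ext X
    exact Quiver.Hom.unop_inj (genYonedaMapIso_inv_genMap₂ α.unop2 X)
  naturality_id A := op_hom₂_ext <| by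
    ext X
    refine Quiver.Hom.unop_inj ?_
    refine Eq.trans (b := 𝟙 _ ≫ (genYonedaMapIso (𝟙 A.unop)).inv.app (op X)) ?_
      ((congrArg (𝟙 _ ≫ ·) (genYonedaMapIso_id_inv X)).trans ?_)
    · exact congrArg (· ≫ (genYonedaMapIso (𝟙 A.unop)).inv.app (op X))
        (A.unop.genYoneda.map_id (op X))
    · exact congrArg (· ≫ _) (Category.comp_id _).symm
  naturality_comp {A _ _} F G := op_hom₂_ext <| by
    ext X
    refine Quiver.Hom.unop_inj ?_
    refine Eq.trans (b := 𝟙 _ ≫ (genYonedaMapIso (G.unop ≫ F.unop)).inv.app (op X)) ?_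
      ((congrArg (𝟙 _ ≫ ·) (genYonedaMapIso_comp_inv G.unop F.unop X)).trans ?_)
    · exact congrArg (· ≫ (genYonedaMapIso (G.unop ≫ F.unop)).inv.app (op X))
        (A.unop.genYoneda.map_id (op _))
    · let p := (genYonedaMapIso F.unop).inv.app (op (G.unop.functor.obj X))
      let q := (genMap (modCatMap F.unop) (preservesGen _)).map
        ((genYonedaMapIso G.unop).inv.app (op X))
      let r := (genMapComp (modCatMap F.unop) (modCatMap G.unop) (preservesGen _)
        (preservesGen _) (preservesGen _)).hom.app (Nest.genYoneda _ |>.obj (op X)) ≫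
          (genMap₂ (preservesGen _) (preservesGen _) (modCatMapComp G.unop F.unop).hom).app _
      have h : 𝟙 _ ≫ p ≫ q ≫ r = ((((𝟙 _ ≫ p) ≫ 𝟙 _) ≫ q) ≫ 𝟙 _) ≫ r := by
        simp only [Category.id_comp, Category.comp_id, Category.assoc]
      exact h

end Nest

end ExtendedGabrielUlmer

end

open ExtendedGabrielUlmer in
/-- Extended Gabriel–Ulmer duality: for every regular cardinal `κ`, the constructions `Gen_κ` and
`Mod_κ` are well defined and form a biequivalence between `LG_κ` and `(N_κ)ᵒᵖ`. -/
theorem mainTheorem1 (κ : Cardinal.{w}) [Fact κ.IsRegular] :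
    ∃ (hGen : GenWellDefined κ) (hMod : ModWellDefined κ),
      IsBiequivalence hGen.pseudofunctor hMod.pseudofunctor :=
  ⟨genWellDefined κ, modWellDefined κ, ⟨(LocGenCat.unit κ).toEquivalence⟩,
    ⟨(Nest.counit κ).toEquivalence⟩⟩
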